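/- A circular-arc model $\mathcal M$ is a finite family of open arcs $(s,t)$ of a circle (where $(s,t)$ is traversed clockwise from $s$ to $t$) such that no two extremes of arcs in the family coincide and no single arc covers the circle. Its intersection graph has the arcs as vertices, two distinct arcs being adjacent if and only if they have a common point; $\mathcal M$ is a model of a graph $G$ if its intersection graph is isomorphic to $G$, and two models are equivalent if their intersection graphs are isomorphic. The model is NCA (normal) if no two of its arcs together cover the circle, and NHCA if it is normal and, in addition, every family of pairwise intersecting arcs of $\mathcal M$ has a common point. A graph is NCA (respectively NHCA) if it has an NCA (respectively NHCA) model. A model contains a graph $F$ as an induced submodel if some of its arcs form a model of $F$. Consider the following graphs. * For $n\ge 4$, the $n$-wheel is the chordless cycle of length $n$ together with one vertex adjacent to all its vertices. * The 3-sun $S_3$ is a triangle $v_1v_2v_3$ together with three pairwise non-adjacent vertices $w_1,w_2,w_3$, where $w_i$ is adjacent to exactly $v_i$ and $v_{i+1}$ (indices modulo $3$). * For $n\ge 4$, the $n$-rising sun is obtained from an induced path $v_2,\dots,v_{n-1}$ by adding two vertices $v_1$ and $v_n$, adjacent to each other and to all vertices of the path, and then three pairwise non-adjacent vertices $w_1,w_{n-1},w_n$,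 where $w_i$ is adjacent to exactly $v_i$ and $v_{i+1}$ (with $v_{n+1}=v_1$). * The umbrella is an induced path on five vertices together with a vertex adjacent to all of them and a vertex adjacent only to the middle vertex of the path. * The tent is the complement $\overline{S_3}$ of the 3-sun. Theorem. Let $\mathcal M$ be an NCA model. Then $\mathcal M$ is equivalent to an NHCA model if and only if it contains no $n$-wheel ($n\ge4$), no 3-sun, no $n$-rising sun ($n\ge4$), no umbrella and no tent as an induced submodel. Moreover, an NCA graph is NHCA if and only if it contains no $n$-wheel ($n\ge4$), no 3-sun, no $n$-rising sun ($n\ge4$), no umbrella and no tent as an induced subgraph. -/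

import Mathlib

/-! Circular-arc models on the circle `UnitAddCircle = ℝ / ℤ`, with its cyclic order. -/

/-- An arc of the circle, given by its two extremes: the beginning point `s` and the ending
point `t`, which are distinct. -/
structure CircArc where
  s : UnitAddCircle
  t : UnitAddCircle
  s_ne_t : s ≠ t

/-- The points of the open arc `(s, t)`: those met strictly between `s` and `t` when the circle is
traversed from `s` to `t` (in the positive direction). -/
def CircArc.points (A : CircArc) : Set UnitAddCircle :=
  Set.cIoo A.s A.t

/-- A circular-arc model: a finite family of open arcs of the circle, no two extremes of which
coincide. (No arc covers the circle, since an open arc with distinct extremes misses them.) -/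
structure CircularArcModel where
  arcs : Finset CircArc
  s_ne_s : ∀ A ∈ arcs, ∀ B ∈ arcs, A ≠ B → A.s ≠ B.s
  t_ne_t : ∀ A ∈ arcs, ∀ B ∈ arcs, A ≠ B → A.t ≠ B.t
  s_ne_t : ∀ A ∈ arcs, ∀ B ∈ arcs, A.s ≠ B.t

namespace CircularArcModel

/-- The intersection graph: the vertices are the arcs, and two different arcs are adjacent iff
they have a common point. -/
def graph (M : CircularArcModel) : SimpleGraph {A : CircArc // A ∈ M.arcs} where
  Adj A B := A ≠ B ∧ (A.1.points ∩ B.1.points).Nonempty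
  symm := ⟨fun _ _ h => ⟨h.1.symm, Set.inter_comm _ _ ▸ h.2⟩⟩
  loopless := ⟨fun _ h => h.1 rfl⟩

/-- Normal models (NCA): no two arcs together cover the circle. -/
def IsNormal (M : CircularArcModel) : Prop :=
  ∀ A ∈ M.arcs, ∀ B ∈ M.arcs, A ≠ B → A.points ∪ B.points ≠ Set.univ

/-- Helly models (HCA): every family of pairwise intersecting arcs has a common point. -/
def IsHelly (M : CircularArcModel) : Prop :=
  ∀ F ⊆ M.arcs, (∀ A ∈ F, ∀ B ∈ F, (A.points ∩ B.points).Nonempty) →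
    ∃ p : UnitAddCircle, ∀ A ∈ F, p ∈ A.points

/-- `M` is a model of `G`: the intersection graph of `M` is isomorphic to `G`. -/
def IsModelOf (M : CircularArcModel) {V : Type*} (G : SimpleGraph V) : Prop :=
  Nonempty (M.graph ≃g G)

/-- Two models are equivalent when their intersection graphs are isomorphic. -/
def Equivalent (M M' : CircularArcModel) : Prop :=
  Nonempty (M.graph ≃g M'.graph)

/-- `M` contains a model of `F` as an induced submodel: some of the arcs of `M` form a model
of `F`. -/
def HasInducedSubmodel (M : CircularArcModel) {V : Type*} (F : SimpleGraph V) : Prop :=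
  ∃ M' : CircularArcModel, M'.arcs ⊆ M.arcs ∧ M'.IsModelOf F

end CircularArcModel

namespace SimpleGraph

/-- NCA graphs: those that admit a normal circular-arc model. -/
def IsNCA {V : Type*} (G : SimpleGraph V) : Prop :=
  ∃ M : CircularArcModel, M.IsModelOf G ∧ M.IsNormal

/-- NHCA graphs: those that admit a circular-arc model which is both normal and Helly. -/
def IsNHCA {V : Type*} (G : SimpleGraph V) : Prop :=
  ∃ M : CircularArcModel, M.IsModelOf G ∧ M.IsNormal ∧ M.IsHelly

/-- The `n`-wheel (meant for `4 ≤ n`): the cycle `some 0, …, some (n - 1)` and one universal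
vertex `none`. -/
def wheel (n : ℕ) : SimpleGraph (Option (Fin n)) :=
  SimpleGraph.fromRel fun x y =>
    match x, y with
    | none, _ => True
    | some i, some j => (cycleGraph n).Adj i j
    | some _, none => False

/-- The 3-sun: a triangle `inl 0, inl 1, inl 2`, and pairwise nonadjacent `inr 0, inr 1, inr 2`,
where `inr i` is adjacent to exactly `inl i` and `inl (i + 1)`. -/
def threeSun : SimpleGraph (Fin 3 ⊕ Fin 3) :=
  SimpleGraph.fromRel fun x y =>
    match x, y with
    | .inl _, .inl _ => True
    | .inl j, .inr i => j = i ∨ j = i + 1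
    | _, _ => False

/-- The tent: the complement of the 3-sun (a triangle with a pendant vertex at each corner). -/
def tent : SimpleGraph (Fin 3 ⊕ Fin 3) :=
  threeSunᶜ

/-- The umbrella: an induced path `0, 1, 2, 3, 4`, a vertex `5` adjacent to the whole path, and a
vertex `6` adjacent only to the middle vertex `2` of the path. -/
def umbrella : SimpleGraph (Fin 7) :=
  SimpleGraph.fromEdgeSet
    {s(0, 1), s(1, 2), s(2, 3), s(3, 4), s(5, 0), s(5, 1), s(5, 2), s(5, 3), s(5, 4), s(6, 2)}

/-- The `n`-rising sun (meant for `4 ≤ n`). With `v_k = inl (k - 1)` for `1 ≤ k ≤ n`: the induced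
path `v_2, …, v_{n-1}`; the vertices `v_1` and `v_n`, each adjacent to every other `v_k`;
and `inr 0, inr 1, inr 2` adjacent to exactly `v_1, v_2`, to `v_{n-1}, v_n` and to `v_n, v_1`. -/
def risingSun (n : ℕ) : SimpleGraph (Fin n ⊕ Fin 3) :=
  SimpleGraph.fromRel fun x y =>
    match x, y with
    | .inl i, .inl j => i.val + 1 = j.val ∨ i.val = 0 ∨ i.val + 1 = n
    | .inl i, .inr 0 => i.val = 0 ∨ i.val = 1
    | .inl i, .inr 1 => i.val + 2 = n ∨ i.val + 1 = n
    | .inl i, .inr 2 => i.val + 1 = n ∨ i.val = 0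
    | .inr _, _ => False

end SimpleGraph

/-! For a normal model, being Helly is the same as having no three arcs that cover the circle
(`IsNormal.isHelly`, `IsNormal.noTripleCover`). The whole argument is about such covering triples.

Necessity. The arcs of a hole cover the circle, since otherwise the circle could be cut open into a
line, and intervals of a line have no holes. An arc meeting all of them then completes two of them
to a covering triple (`IsNormal.not_universal`), which rules out wheels. The arcs witnessing an
asteroidal triple cover the circle for the same reason (`cover_of_isAT`). In a normal model without
holes, any cover contains a covering triple (`exists_triple_cover`). The 3-sun, the rising suns, the
umbrella and the tent are hole-free and have an asteroidal triple, so they too are excluded.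

Sufficiency. A normal model without covering triples is already Helly. If there is a covering
triple, a shortest hole would give a wheel (`exists_wheel_of_isCoveringTriple`), so the graph is
hole-free. If it also has no asteroidal triple, it is an interval graph by the theorem of
Lekkerkerker and Boland (`exists_isLeftOrder`), and intervals placed in `[0, 1)` form a normal Helly
model.

There remains a hole-free graph with an asteroidal triple. The covering triple found among the
witnesses of any asteroidal triple is a clique that dominates the graph (`HasDominatingCliques`).
From here on only this property and hole-freeness are used: a case analysis on how a dominating
clique sees the three vertices produces a 3-sun, rising sun, umbrella or tent
(`HasDominatingCliques.hasSunTentUmbrella`). -/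

section Circle

/-! ### Coordinates on the circle and elementary geometry of arcs -/

theorem sbtw_coe_iff {p x y z : ℝ} (hx : x ∈ Set.Ico p (p + 1)) (hy : y ∈ Set.Ico p (p + 1))
    (hz : z ∈ Set.Ico p (p + 1)) :
    sbtw (x : UnitAddCircle) (y : UnitAddCircle) (z : UnitAddCircle) ↔
      (x < y ∧ y < z) ∨ (y < z ∧ z < x) ∨ (z < x ∧ x < y) := by
  obtain ⟨hx0, hx1⟩ := hx
  obtain ⟨hy0, hy1⟩ := hy
  obtain ⟨hz0, hz1⟩ := hz
  have key : Btw.btw (z : UnitAddCircle) (y : UnitAddCircle) (x : UnitAddCircle) ↔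
      toIcoMod (one_pos : (0 : ℝ) < 1) z y ≤ toIocMod (one_pos : (0 : ℝ) < 1) z x :=
    QuotientAddGroup.btw_coe_iff
  have h1 : toIcoMod (one_pos : (0 : ℝ) < 1) z y = if z ≤ y then y else y + 1 := by
    split_ifs with h
    · exact (toIcoMod_eq_iff _).2 ⟨⟨h, by linarith⟩, 0, by simp⟩
    · exact (toIcoMod_eq_iff _).2 ⟨⟨by linarith, by push Not at h; linarith⟩, -1, by simp⟩
  have h2 : toIocMod (one_pos : (0 : ℝ) < 1) z x = if z < x then x else x + 1 := by
    split_ifs with h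
    · exact (toIocMod_eq_iff _).2 ⟨⟨h, by linarith⟩, 0, by simp⟩
    · exact (toIocMod_eq_iff _).2 ⟨⟨by linarith, by push Not at h; linarith⟩, -1, by simp⟩
  rw [sbtw_iff_not_btw, key, h1, h2]
  constructor
  · intro h
    split_ifs at h with h3 h4 h4 <;> push Not at * <;> grind
  · rintro (h | h | h) <;> split_ifs <;> push Not at * <;> grind

theorem exists_coe_eq (p : ℝ) (q : UnitAddCircle) :
    ∃ r ∈ Set.Ico p (p + 1), (r : UnitAddCircle) = q :=
  ⟨AddCircle.equivIco 1 p q, (AddCircle.equivIco 1 p q).2, AddCircle.coe_equivIco⟩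

theorem coe_inj_Ico {p x y : ℝ} (hx : x ∈ Set.Ico p (p + 1)) (hy : y ∈ Set.Ico p (p + 1)) :
    (x : UnitAddCircle) = y ↔ x = y :=
  AddCircle.coe_eq_coe_iff_of_mem_Ico hx hy

namespace CircArc

theorem exists_coords (A : CircArc) (p : ℝ) :
    ∃ s ∈ Set.Ico p (p + 1), ∃ t ∈ Set.Ico p (p + 1), s ≠ t ∧ (s : UnitAddCircle) = A.s ∧
      (t : UnitAddCircle) = A.t ∧ ∀ q ∈ Set.Ico p (p + 1),
        ((q : UnitAddCircle) ∈ A.points ↔ (s < q ∧ q < t) ∨ (q < t ∧ t < s) ∨ (t < s ∧ s < q)) := by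
  obtain ⟨s, hs, hs'⟩ := exists_coe_eq p A.s
  obtain ⟨t, ht, ht'⟩ := exists_coe_eq p A.t
  refine ⟨s, hs, t, ht, ?_, hs', ht', fun q hq => ?_⟩
  · rintro rfl
    exact A.s_ne_t (hs'.symm.trans ht')
  · rw [← sbtw_coe_iff hs hq ht, hs', ht']
    rfl

theorem exists_coords_self (A : CircArc) :
    ∃ p t : ℝ, p < t ∧ t < p + 1 ∧ (p : UnitAddCircle) = A.s ∧ (t : UnitAddCircle) = A.t ∧
      ∀ q ∈ Set.Ico p (p + 1), ((q : UnitAddCircle) ∈ A.points ↔ p < q ∧ q < t) := by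
  obtain ⟨p, -, hp⟩ := exists_coe_eq 0 A.s
  have hpp : p ∈ Set.Ico p (p + 1) := ⟨le_rfl, by linarith⟩
  obtain ⟨s, hs, t, ht, hst, hs', ht', h⟩ := A.exists_coords p
  have : s = p := (coe_inj_Ico hs hpp).1 (hs'.trans hp.symm)
  subst this
  refine ⟨s, t, lt_of_le_of_ne ht.1 hst, ht.2, hs', ht', fun q hq => ?_⟩
  rw [h q hq]
  obtain ⟨h1, h2⟩ := hq
  obtain ⟨h3, h4⟩ := ht
  grind

/-- Cutting the circle at a point outside the arc leaves the arc in one piece. -/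
theorem exists_coords_of_notMem (A : CircArc) {p : ℝ} (hp : (p : UnitAddCircle) ∉ A.points) :
    ∃ s t : ℝ, p ≤ s ∧ s < t ∧ t ≤ p + 1 ∧
      ∀ q ∈ Set.Ico p (p + 1), ((q : UnitAddCircle) ∈ A.points ↔ s < q ∧ q < t) := by
  obtain ⟨s, hs, t, ht, hst, -, -, h⟩ := A.exists_coords p
  have hpp : p ∈ Set.Ico p (p + 1) := ⟨le_rfl, by linarith⟩
  rw [h p hpp] at hp
  obtain ⟨hs1, hs2⟩ := hs
  obtain ⟨ht1, ht2⟩ := ht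
  -- An arc ending at the cut has end coordinate `p`, which has to be read as `p + 1`.
  by_cases htp : t = p
  · refine ⟨s, p + 1, hs1, hs2, le_rfl, fun q hq => ?_⟩
    rw [h q hq]
    obtain ⟨h1, h2⟩ := hq
    grind
  · refine ⟨s, t, hs1, ?_, ht2.le, fun q hq => ?_⟩
    · grind
    · rw [h q hq]
      obtain ⟨h1, h2⟩ := hq
      grind

theorem s_notMem (A : CircArc) : A.s ∉ A.points := by
  obtain ⟨p, t, h1, h2, h3, -, h⟩ := A.exists_coords_self
  rw [← h3, h p ⟨le_rfl, by linarith⟩]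
  grind

theorem t_notMem (A : CircArc) : A.t ∉ A.points := by
  obtain ⟨p, t, h1, h2, -, h3, h⟩ := A.exists_coords_self
  rw [← h3, h t ⟨h1.le, h2⟩]
  grind

theorem points_nonempty (A : CircArc) : A.points.Nonempty := by
  obtain ⟨p, t, h1, h2, -, h3, h⟩ := A.exists_coords_self
  exact ⟨((p + t) / 2 : ℝ), (h _ ⟨by linarith, by linarith⟩).2 ⟨by linarith, by linarith⟩⟩

theorem isOpen_preimage (A : CircArc) : IsOpen {r : ℝ | (r : UnitAddCircle) ∈ A.points} := by
  rw [isOpen_iff_mem_nhds]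
  intro r hr
  obtain ⟨s, hs, t, ht, hst, -, -, h⟩ := A.exists_coords (r - 1 / 2)
  have hrr : r ∈ Set.Ico (r - 1 / 2) (r - 1 / 2 + 1) := ⟨by linarith, by linarith⟩
  have h0 : ∀ᶠ q in nhds r, q ∈ Set.Ico (r - 1 / 2) (r - 1 / 2 + 1) :=
    Ico_mem_nhds (by linarith) (by linarith)
  rw [Set.mem_ofPred_eq, h r hrr] at hr
  rcases hr with ⟨h1, h2⟩ | ⟨h1, h2⟩ | ⟨h1, h2⟩
  · filter_upwards [h0, lt_mem_nhds h1, gt_mem_nhds h2] with q hq h3 h4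
    exact (h q hq).2 (Or.inl ⟨h3, h4⟩)
  · filter_upwards [h0, gt_mem_nhds h1] with q hq h3
    exact (h q hq).2 (Or.inr (Or.inl ⟨h3, h2⟩))
  · filter_upwards [h0, lt_mem_nhds h2] with q hq h3
    exact (h q hq).2 (Or.inr (Or.inr ⟨h1, h3⟩))

/-- The complement of an arc is connected: it is not separated by two unions of arcs. -/
theorem exists_mem_of_cover_compl (A : CircArc) (P Q : Set CircArc)
    (hcov : ∀ q ∉ A.points, (∃ B ∈ P, q ∈ B.points) ∨ ∃ B ∈ Q, q ∈ B.points)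
    (hs : ∃ B ∈ P, A.s ∈ B.points) (ht : ∃ B ∈ Q, A.t ∈ B.points) :
    ∃ v ∉ A.points, (∃ B ∈ P, v ∈ B.points) ∧ ∃ B ∈ Q, v ∈ B.points := by
  obtain ⟨p, t, h1, h2, hp, ht', h⟩ := A.exists_coords_self
  have key : ∀ r ∈ Set.Icc t (p + 1), (r : UnitAddCircle) ∉ A.points := by
    rintro r ⟨hr1, hr2⟩
    rcases hr2.lt_or_eq with hr2 | rfl
    · rw [h r ⟨by linarith, hr2⟩]
      grind
    · have : ((p + 1 : ℝ) : UnitAddCircle) = p := AddCircle.coe_add_period 1 p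
      rw [this, hp]
      exact A.s_notMem
  have open' : ∀ P : Set CircArc, IsOpen {r : ℝ | ∃ B ∈ P, (r : UnitAddCircle) ∈ B.points} := by
    intro P
    have : {r : ℝ | ∃ B ∈ P, (r : UnitAddCircle) ∈ B.points} =
        ⋃ B ∈ P, {r : ℝ | (r : UnitAddCircle) ∈ B.points} := by
      ext r
      simp
    rw [this]
    exact isOpen_biUnion fun B _ => B.isOpen_preimage
  obtain ⟨r, hr, hrP, hrQ⟩ := (isPreconnected_Icc (a := t) (b := p + 1)) _ _ (open' P) (open' Q)
    (fun r hr => hcov _ (key r hr))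
    ⟨p + 1, ⟨h2.le, le_rfl⟩, by
      simpa [show ((p + 1 : ℝ) : UnitAddCircle) = p from AddCircle.coe_add_period 1 p, hp] using hs⟩
    ⟨t, ⟨le_rfl, h2.le⟩, by simpa [ht'] using ht⟩
  exact ⟨r, key r hr, hrP, hrQ⟩

theorem inter_nonempty_of_s_mem {A L : CircArc} (h : A.s ∈ L.points) :
    (A.points ∩ L.points).Nonempty := by
  obtain ⟨p, t, h1, h2, hp, ht', hA⟩ := A.exists_coords_self
  obtain ⟨s, hs, u, hu, hsu, -, -, hL⟩ := L.exists_coords p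
  rw [← hp, hL p ⟨le_rfl, by linarith⟩] at h
  obtain ⟨hs1, hs2⟩ := hs
  obtain ⟨hu1, hu2⟩ := hu
  have hm : p < min t u := lt_min h1 (by grind)
  have hm1 := min_le_left t u
  have hm2 := min_le_right t u
  refine ⟨((p + min t u) / 2 : ℝ), (hA _ ⟨?_, ?_⟩).2 ⟨?_, ?_⟩, (hL _ ⟨?_, ?_⟩).2 ?_⟩ <;> grind

theorem inter_nonempty_of_t_mem {A L : CircArc} (h : A.t ∈ L.points) :
    (A.points ∩ L.points).Nonempty := by
  obtain ⟨p, t, h1, h2, hp, ht', hA⟩ := A.exists_coords_self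
  obtain ⟨s, hs, u, hu, hsu, -, -, hL⟩ := L.exists_coords p
  rw [← ht', hL t ⟨h1.le, h2⟩] at h
  obtain ⟨hs1, hs2⟩ := hs
  obtain ⟨hu1, hu2⟩ := hu
  by_cases hst : s < t
  · have hm : max p s < t := max_lt h1 hst
    have hm1 := le_max_left p s
    have hm2 := le_max_right p s
    refine ⟨((max p s + t) / 2 : ℝ), (hA _ ⟨?_, ?_⟩).2 ⟨?_, ?_⟩, (hL _ ⟨?_, ?_⟩).2 ?_⟩ <;> grind
  · refine ⟨((p + t) / 2 : ℝ), (hA _ ⟨?_, ?_⟩).2 ⟨?_, ?_⟩, (hL _ ⟨?_, ?_⟩).2 ?_⟩ <;> grind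

/-- `B` is connected and can leave `A` only through an extreme of `A`. -/
theorem subset_of_extremes_notMem {A B : CircArc} (h : (A.points ∩ B.points).Nonempty)
    (hs : A.s ∉ B.points) (ht : A.t ∉ B.points) : B.points ⊆ A.points := by
  obtain ⟨p, t, h1, h2, hp, ht', hA⟩ := A.exists_coords_self
  obtain ⟨s, hs', u, hu', hsu, -, -, hL⟩ := B.exists_coords p
  rw [← ht', hL t ⟨h1.le, h2⟩] at ht
  rw [← hp, hL p ⟨le_rfl, by linarith⟩] at hs
  obtain ⟨v, hv, hv'⟩ := h
  obtain ⟨v, hvI, rfl⟩ := exists_coe_eq p v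
  rw [hA v hvI] at hv
  rw [hL v hvI] at hv'
  intro q hq
  obtain ⟨q, hqI, rfl⟩ := exists_coe_eq p q
  rw [hL q hqI] at hq
  rw [hA q hqI]
  simp only [Set.mem_Ico] at *
  grind

theorem subset_or_cover_of_extremes_mem {A L : CircArc} (hs : A.s ∈ L.points)
    (ht : A.t ∈ L.points) : A.points ⊆ L.points ∨ A.points ∪ L.points = Set.univ := by
  obtain ⟨p, t, h1, h2, hp, ht', hA⟩ := A.exists_coords_self
  obtain ⟨s, hs', u, hu', hsu, -, -, hL⟩ := L.exists_coords p
  rw [← ht', hL t ⟨h1.le, h2⟩] at ht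
  rw [← hp, hL p ⟨le_rfl, by linarith⟩] at hs
  simp only [Set.mem_Ico] at *
  by_cases htu : t < u
  · left
    intro q hq
    obtain ⟨q, hqI, rfl⟩ := exists_coe_eq p q
    rw [hA q hqI] at hq
    rw [hL q hqI]
    grind
  · right
    rw [Set.eq_univ_iff_forall]
    intro q
    obtain ⟨q, hqI, rfl⟩ := exists_coe_eq p q
    rw [Set.mem_union, hA q hqI, hL q hqI]
    simp only [Set.mem_Ico] at *
    grind

/-- `L` is connected and avoids `A.t`, so it contains the stretch from `v` to `A.s` outside `A`;
symmetrically `R` contains the stretch from `A.t` to `v`. -/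
theorem cover_of_meet_outside {A L R : CircArc} {v : UnitAddCircle} (hLs : A.s ∈ L.points)
    (hLt : A.t ∉ L.points) (hRt : A.t ∈ R.points) (hRs : A.s ∉ R.points) (hvA : v ∉ A.points)
    (hvL : v ∈ L.points) (hvR : v ∈ R.points) (q : UnitAddCircle) :
    q ∈ A.points ∨ q ∈ L.points ∨ q ∈ R.points := by
  obtain ⟨p, t, h1, h2, hp, ht', hA⟩ := A.exists_coords_self
  obtain ⟨s, hs, u, hu, hsu, -, -, hL⟩ := L.exists_coords p
  obtain ⟨s', hs', u', hu', hsu', -, -, hR⟩ := R.exists_coords p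
  have hpp : p ∈ Set.Ico p (p + 1) := ⟨le_rfl, by linarith⟩
  have htt : t ∈ Set.Ico p (p + 1) := ⟨h1.le, h2⟩
  obtain ⟨v, hvI, rfl⟩ := exists_coe_eq p v
  obtain ⟨q, hqI, rfl⟩ := exists_coe_eq p q
  rw [← ht', hL t htt] at hLt
  rw [← ht', hR t htt] at hRt
  rw [← hp, hL p hpp] at hLs
  rw [← hp, hR p hpp] at hRs
  rw [hA v hvI] at hvA
  rw [hL v hvI] at hvL
  rw [hR v hvI] at hvR
  rw [hA q hqI, hL q hqI, hR q hqI]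
  simp only [Set.mem_Ico] at *
  clear hL hA hR
  grind

/-- As in `cover_of_meet_outside`, with `v` now splitting `A` itself between `L` and `R`. -/
theorem subset_union_of_meet_inside {A L R : CircArc} {v : UnitAddCircle} (hLs : A.s ∈ L.points)
    (hLt : A.t ∉ L.points) (hRt : A.t ∈ R.points) (hRs : A.s ∉ R.points) (hvA : v ∈ A.points)
    (hvL : v ∈ L.points) (hvR : v ∈ R.points) : A.points ⊆ L.points ∪ R.points := by
  intro q
  obtain ⟨p, t, h1, h2, hp, ht', hA⟩ := A.exists_coords_self
  obtain ⟨s, hs, u, hu, hsu, -, -, hL⟩ := L.exists_coords p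
  obtain ⟨s', hs', u', hu', hsu', -, -, hR⟩ := R.exists_coords p
  have hpp : p ∈ Set.Ico p (p + 1) := ⟨le_rfl, by linarith⟩
  have htt : t ∈ Set.Ico p (p + 1) := ⟨h1.le, h2⟩
  obtain ⟨v, hvI, rfl⟩ := exists_coe_eq p v
  obtain ⟨q, hqI, rfl⟩ := exists_coe_eq p q
  rw [← ht', hL t htt] at hLt
  rw [← ht', hR t htt] at hRt
  rw [← hp, hL p hpp] at hLs
  rw [← hp, hR p hpp] at hRs
  rw [hA v hvI] at hvA
  rw [hL v hvI] at hvL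
  rw [hR v hvI] at hvR
  rw [Set.mem_union, hA q hqI, hL q hqI, hR q hqI]
  simp only [Set.mem_Ico] at *
  clear hL hA hR
  grind

end CircArc

end Circle

/-! ### Walks in vertex sets, induced paths and holes -/

namespace SimpleGraph

section Reach

variable {V : Type*} (G : SimpleGraph V)

/-- The vertices different from `z` and not adjacent to `z`. -/
def coNbrs (z : V) : Set V := {v | v ≠ z ∧ ¬ G.Adj z v}

/-- An edge inside `S`. -/
def StepIn (S : Set V) (a b : V) : Prop := a ∈ S ∧ b ∈ S ∧ G.Adj a b

/-- `u` and `v` are equal or joined by a walk inside `S`. -/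
def ReachIn (S : Set V) (u v : V) : Prop := Relation.ReflTransGen (G.StepIn S) u v

/-- `q 0, …, q k` is an induced path. -/
def IsIndPath (k : ℕ) (q : ℕ → V) : Prop :=
  ∀ i j, i < j → j ≤ k → q i ≠ q j ∧ (G.Adj (q i) (q j) ↔ j = i + 1)

/-- `c` is an induced cycle of length `n ≥ 4`. -/
def IsHole (n : ℕ) (c : ZMod n → V) : Prop :=
  4 ≤ n ∧ Function.Injective c ∧ ∀ i j, G.Adj (c i) (c j) ↔ j = i + 1 ∨ i = j + 1

def HoleFree : Prop := ∀ n c, ¬ G.IsHole n c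

variable {G}

theorem mem_coNbrs {z v : V} : v ∈ G.coNbrs z ↔ v ≠ z ∧ ¬ G.Adj z v := Iff.rfl

theorem coNbrs_comm {z v : V} : v ∈ G.coNbrs z ↔ z ∈ G.coNbrs v := by
  rw [mem_coNbrs, mem_coNbrs, G.adj_comm, ne_comm]

theorem notMem_coNbrs {z v : V} : v ∉ G.coNbrs z ↔ v = z ∨ G.Adj z v := by
  rw [mem_coNbrs]
  tauto

theorem StepIn.mono {S T : Set V} (h : S ⊆ T) {a b : V} (hab : G.StepIn S a b) : G.StepIn T a b :=
  ⟨h hab.1, h hab.2.1, hab.2.2⟩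

theorem ReachIn.mono {S T : Set V} (h : S ⊆ T) {a b : V} (hab : G.ReachIn S a b) :
    G.ReachIn T a b :=
  Relation.ReflTransGen.mono (fun _ _ h' => StepIn.mono h h') _ _ hab

theorem ReachIn.refl {S : Set V} (a : V) : G.ReachIn S a a := Relation.ReflTransGen.refl

theorem ReachIn.trans {S : Set V} {a b c : V} (h : G.ReachIn S a b) (h' : G.ReachIn S b c) :
    G.ReachIn S a c :=
  Relation.ReflTransGen.trans h h'

theorem ReachIn.symm {S : Set V} {a b : V} (h : G.ReachIn S a b) : G.ReachIn S b a := by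
  induction h with
  | refl => exact .refl _
  | tail _ h ih => exact (Relation.ReflTransGen.single ⟨h.2.1, h.1, h.2.2.symm⟩).trans ih

theorem ReachIn.of_adj {S : Set V} {a b : V} (ha : a ∈ S) (hb : b ∈ S) (h : G.Adj a b) :
    G.ReachIn S a b :=
  Relation.ReflTransGen.single ⟨ha, hb, h⟩

theorem ReachIn.mem {S : Set V} {a b : V} (h : G.ReachIn S a b) (ha : a ∈ S) : b ∈ S := by
  induction h with
  | refl => exact ha
  | tail _ h _ => exact h.2.1

/-- A property kept by every edge inside `S` is kept along walks inside `S`. -/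
theorem ReachIn.invariant {S : Set V} {a b : V} (h : G.ReachIn S a b) (P : V → Prop) (ha : P a)
    (hP : ∀ x y, P x → x ∈ S → y ∈ S → G.Adj x y → P y) : P b := by
  induction h with
  | refl => exact ha
  | tail _ h ih => exact hP _ _ ih h.1 h.2.1 h.2.2

theorem ReachIn.inter_of_invariant {S T : Set V} {a b : V} (h : G.ReachIn S a b) (ha : a ∈ T)
    (hT : ∀ x y, x ∈ T → x ∈ S → y ∈ S → G.Adj x y → y ∈ T) : G.ReachIn (S ∩ T) a b := by
  have : G.ReachIn (S ∩ T) a b ∧ b ∈ T := by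
    induction h with
    | refl => exact ⟨.refl a, ha⟩
    | tail _ h ih =>
      have := hT _ _ ih.2 h.1 h.2.1 h.2.2
      exact ⟨ih.1.trans (.of_adj ⟨h.1, ih.2⟩ ⟨h.2.1, this⟩ h.2.2), this⟩
  exact this.1

/-- A walk in `P` that cannot be taken inside `P ∩ Q` leaves `Q`. -/
theorem ReachIn.exists_exit {P Q : Set V} {a u : V} (h : G.ReachIn P a u) (ha : a ∈ Q)
    (hn : ¬ G.ReachIn (P ∩ Q) a u) :
    ∃ e v, G.ReachIn (P ∩ Q) a e ∧ e ∈ P ∩ Q ∧ v ∈ P ∧ v ∉ Q ∧ G.Adj e v := by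
  by_contra hcon
  push Not at hcon
  exact hn (h.invariant (fun b => G.ReachIn (P ∩ Q) a b ∧ b ∈ Q) ⟨.refl a, ha⟩
    fun x y hx hxP hyP hxy => by
      have := hcon x y hx.1 ⟨hxP, hx.2⟩ hyP
      have hyQ : y ∈ Q := by
        by_contra hyQ
        exact this hyQ hxy
      exact ⟨hx.1.trans (.of_adj ⟨hxP, hx.2⟩ ⟨hyP, hyQ⟩ hxy), hyQ⟩).1

/-- A shortest walk inside `S` is induced: a repeated vertex or a chord would shorten it. -/
theorem ReachIn.exists_indPath {S : Set V} {u v : V} (h : G.ReachIn S u v) (hu : u ∈ S) :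
    ∃ k q, G.IsIndPath k q ∧ q 0 = u ∧ q k = v ∧ ∀ i ≤ k, q i ∈ S := by
  classical
  have hex : ∃ k, ∃ q : ℕ → V, q 0 = u ∧ q k = v ∧ (∀ i ≤ k, q i ∈ S) ∧
      ∀ i < k, G.Adj (q i) (q (i + 1)) := by
    induction h with
    | refl => exact ⟨0, fun _ => u, rfl, rfl, fun _ _ => hu, fun _ h => absurd h (by omega)⟩
    | @tail b c _ h ih =>
      obtain ⟨k, q, h0, hk, hS, hadj⟩ := ih
      refine ⟨k + 1, fun i => if i ≤ k then q i else c, by simp [h0], by simp, ?_, ?_⟩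
      · intro i hi
        dsimp only
        split_ifs with h'
        · exact hS i h'
        · exact h.2.1
      · intro i hi
        dsimp only
        rw [if_pos (by omega)]
        split_ifs with h'
        · exact hadj i (by omega)
        · have : i = k := by omega
          rw [this, hk]
          exact h.2.2
  obtain ⟨q, h0, hk, hS, hadj⟩ := Nat.find_spec hex
  refine ⟨Nat.find hex, q, ?_, h0, hk, hS⟩
  generalize hK : Nat.find hex = k at *
  have hmin : ∀ m < k, ¬ ∃ q : ℕ → V, q 0 = u ∧ q m = v ∧ (∀ i ≤ m, q i ∈ S) ∧
      ∀ i < m, G.Adj (q i) (q (i + 1)) := fun m hm => Nat.find_min hex (by omega)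
  -- replacing the part strictly between two positions gives a shorter walk
  have short : ∀ i j, i < j → j ≤ k → j ≠ i + 1 → ¬ G.Adj (q i) (q j) := by
    intro i j hij hj hne had
    apply hmin (k - (j - i - 1)) (by omega)
    refine ⟨fun m => if m ≤ i then q m else q (m + (j - i - 1)), by simp [h0], ?_, ?_, ?_⟩
    · dsimp only
      rw [if_neg (by omega), ← hk]
      congr 1
      omega
    · intro m hm
      dsimp only
      split_ifs
      · exact hS _ (by omega)
      · exact hS _ (by omega)
    · intro m hm
      dsimp only
      split_ifs with h1 h2 h2
      · exact hadj m (by omega)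
      · have : m = i := by omega
        subst this
        have : m + 1 + (j - m - 1) = j := by omega
        rw [this]
        exact had
      · omega
      · have : m + 1 + (j - i - 1) = (m + (j - i - 1)) + 1 := by omega
        rw [this]
        exact hadj _ (by omega)
  intro i j hij hj
  refine ⟨fun heq => ?_, fun had => ?_, fun h => h ▸ hadj i (by omega)⟩
  · rcases hj.lt_or_eq with hj | rfl
    · refine short i (j + 1) (by omega) (by omega) (by omega) ?_
      rw [heq]
      exact hadj j hj
    · apply hmin i (by omega)
      exact ⟨q, h0, heq.trans hk, fun m hm => hS m (by omega), fun m hm => hadj m (by omega)⟩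
  · by_contra hne
    exact short i j hij hj hne had

end Reach

section Path

variable {V : Type*} {G : SimpleGraph V}

theorem IsIndPath.ne {k : ℕ} {q : ℕ → V} (h : G.IsIndPath k q) {i j : ℕ} (hi : i ≤ k) (hj : j ≤ k)
    (hij : i ≠ j) : q i ≠ q j := by
  rcases lt_or_gt_of_ne hij with h1 | h1
  · exact (h i j h1 hj).1
  · exact (h j i h1 hi).1.symm

theorem IsIndPath.adj_iff {k : ℕ} {q : ℕ → V} (h : G.IsIndPath k q) {i j : ℕ} (hi : i ≤ k)
    (hj : j ≤ k) : G.Adj (q i) (q j) ↔ j = i + 1 ∨ i = j + 1 := by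
  rcases lt_trichotomy i j with h1 | rfl | h1
  · rw [(h i j h1 hj).2]
    omega
  · simp
  · rw [G.adj_comm, (h j i h1 hi).2]
    omega

theorem IsIndPath.adj {k : ℕ} {q : ℕ → V} (h : G.IsIndPath k q) {i : ℕ} (hi : i < k) :
    G.Adj (q i) (q (i + 1)) :=
  (h.adj_iff hi.le hi).2 (Or.inl rfl)

theorem IsIndPath.sub {k : ℕ} {q : ℕ → V} (h : G.IsIndPath k q) {i l : ℕ} (hl : i + l ≤ k) :
    G.IsIndPath l (fun m => q (i + m)) := by
  intro a b hab hb
  have := h (i + a) (i + b) (by omega) (by omega)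
  refine ⟨this.1, this.2.trans ?_⟩
  omega

theorem IsIndPath.reachIn {k : ℕ} {q : ℕ → V} (h : G.IsIndPath k q) {S : Set V} {i j : ℕ}
    (hij : i ≤ j) (hj : j ≤ k) (hS : ∀ m, i ≤ m → m ≤ j → q m ∈ S) : G.ReachIn S (q i) (q j) := by
  induction j, hij using Nat.le_induction with
  | base => exact .refl _
  | succ j hij ih =>
    exact (ih (by omega) fun m h1 h2 => hS m h1 (by omega)).trans
      (.of_adj (hS _ hij (by omega)) (hS _ (by omega) le_rfl) (h.adj hj))

theorem zmod_eq_add_one_iff {m : ℕ} (i j : ZMod (m + 1)) :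
    j = i + 1 ↔ j.val = i.val + 1 ∨ (i.val = m ∧ j.val = 0) := by
  have hi := i.val_lt
  have hj := j.val_lt
  rw [← ZMod.val_injective (m + 1) |>.eq_iff, ZMod.val_add]
  rcases Nat.eq_zero_or_pos m with rfl | hm
  · omega
  have h1 : (1 : ZMod (m + 1)).val = 1 := by
    have : Fact (1 < m + 1) := ⟨by omega⟩
    exact ZMod.val_one _
  rw [h1]
  rcases (show i.val < m ∨ i.val = m by omega) with h | h
  · rw [Nat.mod_eq_of_lt (by omega)]
    omega
  · rw [h, Nat.mod_self]
    omega

/-- An induced path closed by a vertex adjacent to its ends only. -/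
theorem IsIndPath.exists_isHole {k : ℕ} {q : ℕ → V} (h : G.IsIndPath k q) (hk : 2 ≤ k) {a : V}
    (h0 : G.Adj a (q 0)) (h1 : G.Adj a (q k)) (hn : ∀ i, 0 < i → i < k → q i ∈ G.coNbrs a) :
    ∃ c : ZMod (k + 2) → V, G.IsHole (k + 2) c ∧ (∀ i ≤ k, c (i : ℕ) = q i) ∧
      c ((k + 1 : ℕ)) = a := by
  have hne : ∀ i ≤ k, a ≠ q i := by
    intro i hi
    rcases Nat.eq_zero_or_pos i with rfl | hi0
    · exact h0.ne
    rcases hi.lt_or_eq with hi | rfl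
    · exact (hn i hi0 hi).1.symm
    · exact h1.ne
  have hadj : ∀ i ≤ k, G.Adj a (q i) ↔ i = 0 ∨ i = k := by
    intro i hi
    rcases Nat.eq_zero_or_pos i with rfl | hi0
    · simp [h0]
    rcases hi.lt_or_eq with hi | rfl
    · have := (hn i hi0 hi).2
      simp only [this, false_iff]
      omega
    · simp [h1]
  refine ⟨fun i => if i.val ≤ k then q i.val else a, ⟨by omega, ?_, ?_⟩, ?_, ?_⟩
  · intro i j hij
    apply ZMod.val_injective
    have hi := i.val_lt
    have hj := j.val_lt
    dsimp only at hij
    split_ifs at hij with h2 h3 h3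
    · by_contra hc
      exact h.ne h2 h3 hc hij
    · exact absurd hij.symm (hne _ h2)
    · exact absurd hij (hne _ h3)
    · omega
  · intro i j
    have hi := i.val_lt
    have hj := j.val_lt
    rw [zmod_eq_add_one_iff (m := k + 1), zmod_eq_add_one_iff (m := k + 1)]
    dsimp only
    split_ifs with h2 h3 h3
    · rw [h.adj_iff h2 h3]
      omega
    · rw [G.adj_comm, hadj _ h2]
      omega
    · rw [hadj _ h3]
      omega
    · simp only [SimpleGraph.irrefl, false_iff]
      omega
  · intro i hi
    have : ((i : ℕ) : ZMod (k + 2)).val = i := ZMod.val_cast_of_lt (by omega)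
    simp only [this, if_pos hi]
  · have : (((k + 1 : ℕ)) : ZMod (k + 2)).val = k + 1 := ZMod.val_cast_of_lt (by omega)
    simp only [this]
    rw [if_neg (by omega)]

/-- If `s` and `s'` were not adjacent, a shortest path between them through the non-neighbours of
`a` would be closed to a hole by `a`. This is the form in which hole-freeness is mostly used. -/
theorem HoleFree.chord (hG : G.HoleFree) {a s s' d d' : V} (hs : G.Adj a s) (hs' : G.Adj a s')
    (hne : s ≠ s') (hd : G.Adj s d) (hd' : G.Adj s' d') (hda : d ∈ G.coNbrs a)
    (hr : G.ReachIn (G.coNbrs a) d d') : G.Adj s s' := by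
  by_contra hss
  have hda' := hr.mem hda
  set S : Set V := G.coNbrs a ∪ {s, s'} with hS
  have hr' : G.ReachIn S s s' := by
    have h1 : G.ReachIn S s d := .of_adj (by simp [hS]) (by simp [hS, hda]) hd
    have h2 : G.ReachIn S d' s' := .of_adj (by simp [hS, hda']) (by simp [hS]) hd'.symm
    exact (h1.trans (hr.mono Set.subset_union_left)).trans h2
  obtain ⟨k, q, hq, h0, hk, hqS⟩ := hr'.exists_indPath (by simp [hS])
  have hk2 : 2 ≤ k := by
    by_contra hk2
    have : k = 0 ∨ k = 1 := by omega
    rcases this with rfl | rfl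
    · exact hne (h0.symm.trans hk)
    · exact hss (h0 ▸ hk ▸ hq.adj (i := 0) (by omega))
  obtain ⟨c, hc, -⟩ := hq.exists_isHole hk2 (h0 ▸ hs) (hk ▸ hs') fun i hi hik => by
    rcases hqS i hik.le with h | h | h
    · exact h
    · exact absurd (h.trans h0.symm) (hq.ne hik.le (by omega) (by omega))
    · exact absurd (h.trans hk.symm) (hq.ne hik.le (by omega) (by omega))
  exact hG _ _ hc

/-- In a hole-free graph the neighbours of a vertex on an induced path are consecutive. -/
theorem HoleFree.adj_of_between (hG : G.HoleFree) {k : ℕ} {q : ℕ → V} (hq : G.IsIndPath k q)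
    {a : V} (ha : ∀ i ≤ k, a ≠ q i) {i j l : ℕ} (hi : G.Adj a (q i)) (hj : G.Adj a (q j))
    (hil : i ≤ l) (hlj : l ≤ j) (hjk : j ≤ k) : G.Adj a (q l) := by
  by_contra hl
  have h1 : ∃ i, i < l ∧ G.Adj a (q i) ∧ ∀ m, i < m → m ≤ l → ¬ G.Adj a (q m) := by
    clear hj hlj
    induction l, hil using Nat.le_induction with
    | base => exact absurd hi hl
    | succ l hil ih =>
      by_cases h : G.Adj a (q l)
      · refine ⟨l, by omega, h, fun m h1 h2 => ?_⟩
        have : m = l + 1 := by omega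
        exact this ▸ hl
      · obtain ⟨i, h1, h2, h3⟩ := ih h
        refine ⟨i, by omega, h2, fun m h4 h5 => ?_⟩
        rcases (show m ≤ l ∨ m = l + 1 by omega) with h6 | rfl
        · exact h3 m h4 h6
        · exact hl
  obtain ⟨i', hi'l, hi', hi'n⟩ := h1
  classical
  have h2 : ∃ j, l ≤ j ∧ G.Adj a (q j) := ⟨j, hlj, hj⟩
  have hjm : Nat.find h2 ≤ j := Nat.find_min' h2 ⟨hlj, hj⟩
  obtain ⟨hj1, hj2⟩ := Nat.find_spec h2
  have hj3 : ∀ m, m < Nat.find h2 → l ≤ m → ¬ G.Adj a (q m) :=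
    fun m hm hlm had => Nat.find_min h2 hm ⟨hlm, had⟩
  generalize Nat.find h2 = j' at *
  have hne : j' ≠ l := fun h => hl (h ▸ hj2)
  obtain ⟨c, hc, -⟩ := (hq.sub (i := i') (l := j' - i') (by omega)).exists_isHole (a := a) (by omega)
    hi' (by rwa [show i' + (j' - i') = j' by omega]) fun m hm hm' => by
      refine ⟨(ha _ (by omega)).symm, ?_⟩
      rcases le_total (i' + m) l with h | h
      · exact hi'n _ (by omega) h
      · exact hj3 _ (by omega) h
  exact hG _ _ hc

end Path

end SimpleGraph

/-! ### Good roots -/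

namespace SimpleGraph

section IntervalOrder

variable {V : Type*} (G : SimpleGraph V)

/-- `x, y, z` is an asteroidal triple with witnessing paths inside `C`. -/
def IsAT (C : Set V) (x y z : V) : Prop :=
  y ∈ G.coNbrs x ∧ z ∈ G.coNbrs y ∧ x ∈ G.coNbrs z ∧ G.ReachIn (G.coNbrs z ∩ C) x y ∧
    G.ReachIn (G.coNbrs x ∩ C) y z ∧ G.ReachIn (G.coNbrs y ∩ C) z x

/-- Allowing every `C` is no stronger than `C = Set.univ`. The set matters only for locating a
dominating clique. -/
def ATFree : Prop := ∀ C x y z, ¬ G.IsAT C x y z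

/-- `a` is simplicial in `S`, and no two nonadjacent vertices of `S` can both reach `a` avoiding the
neighbourhood of the other one. -/
def IsGoodRoot (S : Finset V) (a : V) : Prop :=
  a ∈ S ∧ (∀ u ∈ S, ∀ v ∈ S, G.Adj a u → G.Adj a v → u ≠ v → G.Adj u v) ∧
    ∀ x ∈ S, ∀ y ∈ S, x ∈ G.coNbrs a → y ∈ G.coNbrs a → x ∈ G.coNbrs y →
      G.ReachIn (S ∩ G.coNbrs y) x a → ¬ G.ReachIn (S ∩ G.coNbrs x) y a

/-- In the order of the ranks `r`, a vertex of `S` is adjacent to all vertices between it and a later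
neighbour. -/
def IsLeftOrder (S : Finset V) (r : V → ℕ) : Prop :=
  Set.InjOn r S ∧ ∀ u ∈ S, ∀ v ∈ S, ∀ w ∈ S, r u < r v → r v < r w → G.Adj u w → G.Adj u v

variable {G}

/-- Among all components left by deleting a closed neighbourhood, a largest one `D` is taken. The
vertices outside `D` without neighbours in `D` form a smaller set `W`, and everything else separates
`D` from `W` and is completely joined to `W`. A good root of `W` is then good in `S`. -/
theorem exists_isGoodRoot (hG : G.HoleFree) (hAT : G.ATFree) (S : Finset V) (hS : S.Nonempty) :
    ∃ a, G.IsGoodRoot S a := by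
  classical
  induction S using Finset.strongInduction with
  | H S ih =>
  by_cases hcl : ∀ u ∈ S, ∀ v ∈ S, u ≠ v → G.Adj u v
  · obtain ⟨a, ha⟩ := hS
    exact ⟨a, ha, fun u hu v hv _ _ h => hcl u hu v hv h, fun x hx y _ hxa _ _ _ _ =>
      hxa.2 (hcl a ha x hx hxa.1.symm)⟩
  push Not at hcl
  set comp : V → V → Finset V := fun v d =>
    S.filter fun u => u ∈ G.coNbrs v ∧ G.ReachIn (S ∩ G.coNbrs v) d u with hcomp
  have hP : ((S ×ˢ S).filter fun p => p.2 ∈ G.coNbrs p.1).Nonempty := by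
    obtain ⟨u, hu, v, hv, hne, h⟩ := hcl
    exact ⟨(u, v), by simp [hu, hv, mem_coNbrs, hne.symm, h]⟩
  obtain ⟨⟨v, d⟩, hvd, hmax⟩ := Finset.exists_max_image _ (fun p => (comp p.1 p.2).card) hP
  simp only [Finset.mem_filter, Finset.mem_product] at hvd hmax
  obtain ⟨⟨hvS, hdS⟩, hdv⟩ := hvd
  set D := comp v d with hD
  have memD : ∀ u, u ∈ D ↔ u ∈ S ∧ u ∈ G.coNbrs v ∧ G.ReachIn (S ∩ G.coNbrs v) d u := by
    intro u
    simp [hD, hcomp]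
  have hdD : d ∈ D := (memD d).2 ⟨hdS, hdv, .refl d⟩
  have hDconn : ∀ u ∈ D, G.ReachIn (D : Set V) d u := by
    intro u hu
    refine (((memD u).1 hu).2.2.inter_of_invariant (T := (D : Set V)) hdD ?_).mono
      Set.inter_subset_right
    intro x y hx hxS hyS hxy
    exact (memD y).2 ⟨hyS.1, hyS.2, ((memD x).1 hx).2.2.trans (.of_adj hxS hyS hxy)⟩
  set W := S.filter fun w => w ∉ D ∧ ∀ e ∈ D, ¬ G.Adj e w with hW
  have memW : ∀ w, w ∈ W ↔ w ∈ S ∧ w ∉ D ∧ ∀ e ∈ D, ¬ G.Adj e w := by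
    intro w
    simp [hW]
  have hDW : ∀ w ∈ W, (D : Set V) ⊆ G.coNbrs w := by
    intro w hw u hu
    obtain ⟨-, h1, h2⟩ := (memW w).1 hw
    exact ⟨fun h => h1 (h ▸ hu), fun h => h2 u hu h.symm⟩
  have hvW : v ∈ W := by
    refine (memW v).2 ⟨hvS, fun h => ((memD v).1 h).2.1.1 rfl, fun e he h => ?_⟩
    exact ((memD e).1 he).2.1.2 h.symm
  -- By maximality `D` is still a full component after deleting the closed neighbourhood of `w`; a
  -- separator vertex not adjacent to `w` would enlarge it.
  have hcompl : ∀ w ∈ W, ∀ s ∈ S, s ∉ D → s ∉ W → G.Adj w s := by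
    intro w hw s hs hsD hsW
    by_contra hws
    have hsub : D ⊆ comp w d := by
      intro u hu
      simp only [hcomp, Finset.mem_filter]
      refine ⟨((memD u).1 hu).1, hDW w hw hu, (hDconn u hu).mono fun z hz => ?_⟩
      exact ⟨((memD z).1 hz).1, hDW w hw hz⟩
    have heq : D = comp w d := Finset.eq_of_subset_of_card_le hsub
      (hmax (w, d) ⟨⟨((memW w).1 hw).1, hdS⟩, hDW w hw hdD⟩)
    have : ∃ e ∈ D, G.Adj e s := by
      by_contra hc
      push Not at hc
      exact hsW ((memW s).2 ⟨hs, hsD, hc⟩)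
    obtain ⟨e, he, hes⟩ := this
    apply hsD
    have hsw : s ∈ G.coNbrs w := ⟨fun h => hsW (h ▸ hw), hws⟩
    have he' := he
    rw [heq] at he' ⊢
    simp only [hcomp, Finset.mem_filter] at he' ⊢
    exact ⟨hs, hsw, he'.2.2.trans (.of_adj ⟨he'.1, he'.2.1⟩ ⟨hs, hsw⟩ hes)⟩
  have hss : W ⊂ S := by
    refine ⟨Finset.filter_subset _ _, fun h => ?_⟩
    exact ((memW d).1 (h hdS)).2.1 hdD
  obtain ⟨a, haW, hasimp, haroot⟩ := ih W hss ⟨v, hvW⟩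
  have haS := ((memW a).1 haW).1
  have haD := ((memW a).1 haW).2.1
  have hDnbr : ∀ s ∈ S, s ∉ D → s ∉ W → ∃ e ∈ D, G.Adj e s := by
    intro s hs hsD hsW
    by_contra hc
    push Not at hc
    exact hsW ((memW s).2 ⟨hs, hsD, hc⟩)
  -- walks avoiding the neighbourhood of a vertex of `W` do not pass from `D` to `W`
  have hstay : ∀ y ∈ W, ∀ x ∈ D, ∀ b ∈ W, ¬ G.ReachIn (S ∩ G.coNbrs y) x b := by
    intro y hy x hx b hb h
    have := h.invariant (fun z => z ∈ D) hx fun z z' hz _ hz' hzz' => by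
      by_contra hzD
      by_cases hzW : z' ∈ W
      · exact ((memW z').1 hzW).2.2 z hz hzz'
      · exact hz'.2.2 (hcompl y hy z' hz'.1 hzD hzW)
    exact ((memW b).1 hb).2.1 this
  have hstay' : ∀ y ∈ W, ∀ x ∈ W, ∀ b, G.ReachIn (S ∩ G.coNbrs y) x b →
      G.ReachIn (W ∩ G.coNbrs y) x b := by
    intro y hy x hx b h
    have hsub : ((S : Set V) ∩ G.coNbrs y) ∩ (W : Set V) ⊆ (W : Set V) ∩ G.coNbrs y :=
      fun z hz => ⟨hz.2, hz.1.2⟩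
    refine (h.inter_of_invariant (T := (W : Set V)) hx fun z z' hz _ hz' hzz' => ?_).mono hsub
    by_contra hzW
    by_cases hzD : z' ∈ D
    · exact ((memW z).1 hz).2.2 z' hzD hzz'.symm
    · exact hz'.2.2 (hcompl y hy z' hz'.1 hzD hzW)
  refine ⟨a, haS, ?_, ?_⟩
  · intro u hu u' hu' hau hau' hne
    have huD : u ∉ D := fun h => ((memW a).1 haW).2.2 u h hau.symm
    have huD' : u' ∉ D := fun h => ((memW a).1 haW).2.2 u' h hau'.symm
    by_cases huW : u ∈ W
    · by_cases huW' : u' ∈ W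
      · exact hasimp u huW u' huW' hau hau' hne
      · exact hcompl u huW u' hu' huD' huW'
    · by_cases huW' : u' ∈ W
      · exact (hcompl u' huW' u hu huD huW).symm
      · obtain ⟨e, he, heu⟩ := hDnbr u hu huD huW
        obtain ⟨e', he', heu'⟩ := hDnbr u' hu' huD' huW'
        exact hG.chord hau hau' hne heu.symm heu'.symm (hDW a haW he)
          (((hDconn e he).symm.trans (hDconn e' he')).mono (hDW a haW))
  · intro x hx y hy hxa hya hxy hx' hy'
    have notSep : ∀ z ∈ S, z ∈ G.coNbrs a → z ∈ D ∨ z ∈ W := by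
      intro z hz hza
      by_contra hc
      push Not at hc
      exact hza.2 (hcompl a haW z hz hc.1 hc.2)
    -- Both in `D`: `x, y, a` is asteroidal. One in `D`, the other in `W`: the separator blocks the
    -- walk to `a`. Both in `W`: the root of `W` is good.
    rcases notSep x hx hxa with hxD | hxW <;> rcases notSep y hy hya with hyD | hyW
    · refine hAT Set.univ x y a ⟨coNbrs_comm.1 hxy, coNbrs_comm.1 hya, hxa, ?_, ?_, ?_⟩ <;>
        rw [Set.inter_univ]
      · exact ((hDconn x hxD).symm.trans (hDconn y hyD)).mono
          (hDW a haW)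
      · exact hy'.mono Set.inter_subset_right
      · exact hx'.symm.mono Set.inter_subset_right
    · exact hstay y hyW x hxD a haW hx'
    · exact hstay x hxW y hyD a haW hy'
    · exact haroot x hxW y hyW hxa hya hxy (hstay' y hyW x hxW a hx') (hstay' x hxW y hyW a hy')

end IntervalOrder

end SimpleGraph

/-! ### Left orders as interval representations; the components of a root -/

namespace SimpleGraph

section IntervalOrder

variable {V : Type*} {G : SimpleGraph V}

theorem lex_lt_iff {N x y b b' : ℕ} (hb : b < N) (hb' : b' < N) :
    x * N + b < y * N + b' ↔ x < y ∨ (x = y ∧ b < b') := by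
  rcases lt_trichotomy x y with h | rfl | h
  · have : (x + 1) * N ≤ y * N := Nat.mul_le_mul_right N h
    rw [add_mul] at this
    simp only [h, true_or, iff_true]
    omega
  · simp
  · have : (y + 1) * N ≤ x * N := Nat.mul_le_mul_right N h
    rw [add_mul] at this
    simp only [show ¬ x < y by omega, show x ≠ y by omega, false_and, or_false, iff_false]
    omega

theorem lex_eq_iff {N x y b b' : ℕ} (hb : b < N) (hb' : b' < N) :
    x * N + b = y * N + b' ↔ x = y ∧ b = b' := by
  have h1 := lex_lt_iff (x := x) (y := y) hb hb'
  have h2 := lex_lt_iff (x := y) (y := x) hb' hb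
  constructor
  · intro h
    omega
  · rintro ⟨rfl, rfl⟩
    rfl

/-- The rank of the last neighbour. -/
noncomputable def lastRank (G : SimpleGraph V) (S : Finset V) (r : V → ℕ) (v : V) : ℕ :=
  haveI := Classical.decPred fun w => w = v ∨ G.Adj v w
  (S.filter fun w => w = v ∨ G.Adj v w).sup r

theorem le_lastRank {S : Finset V} {r : V → ℕ} {v w : V} (hw : w ∈ S) (h : w = v ∨ G.Adj v w) :
    r w ≤ lastRank G S r v := by
  classical
  unfold lastRank
  exact Finset.le_sup (f := r) (by simp [hw, h])

theorem exists_eq_lastRank {S : Finset V} (r : V → ℕ) {v : V} (hv : v ∈ S) :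
    ∃ w ∈ S, (w = v ∨ G.Adj v w) ∧ lastRank G S r v = r w := by
  classical
  unfold lastRank
  obtain ⟨w, hw, h⟩ := Finset.exists_mem_eq_sup (S.filter fun w => w = v ∨ G.Adj v w)
    ⟨v, by simp [hv]⟩ r
  rw [Finset.mem_filter] at hw
  refine ⟨w, hw.1, hw.2, ?_⟩
  convert h

theorem IsLeftOrder.adj_iff {S : Finset V} {r : V → ℕ} (h : G.IsLeftOrder S r) {u v : V}
    (hu : u ∈ S) (hv : v ∈ S) (huv : r u < r v) : G.Adj u v ↔ r v ≤ lastRank G S r u := by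
  refine ⟨fun had => le_lastRank hv (Or.inr had), fun hle => ?_⟩
  obtain ⟨w, hw, hw', heq⟩ := exists_eq_lastRank (G := G) r hu
  rw [heq] at hle
  rcases hw' with rfl | hw'
  · omega
  · rcases hle.lt_or_eq with h1 | h1
    · exact h.2 u hu v hv w hw huv h1 hw'
    · exact h.1 hv hw h1 ▸ hw'

/-- With `v` represented by the interval from `r v` to `lastRank G S r v`, adjacency is
intersection. This form is symmetric, so the representation can be reflected. -/
theorem IsLeftOrder.adj_iff' {S : Finset V} {r : V → ℕ} (h : G.IsLeftOrder S r) {u v : V}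
    (hu : u ∈ S) (hv : v ∈ S) (huv : u ≠ v) :
    G.Adj u v ↔ r v ≤ lastRank G S r u ∧ r u ≤ lastRank G S r v := by
  have h1 := le_lastRank (G := G) (r := r) hu (Or.inl rfl)
  have h2 := le_lastRank (G := G) (r := r) hv (Or.inl rfl)
  rcases lt_trichotomy (r u) (r v) with hlt | heq | hlt
  · rw [h.adj_iff hu hv hlt]
    omega
  · exact absurd (h.1 hu hv heq) huv
  · rw [G.adj_comm, h.adj_iff hv hu hlt]
    omega

/-- The mirror image of an order whose first vertex is simplicial. -/
theorem IsLeftOrder.exists_reflect {S : Finset V} {r : V → ℕ} (h : G.IsLeftOrder S r) {a : V}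
    (ha : a ∈ S) (hfirst : ∀ v ∈ S, v ≠ a → r a < r v)
    (hsimp : ∀ u ∈ S, ∀ v ∈ S, G.Adj a u → G.Adj a v → u ≠ v → G.Adj u v) :
    ∃ r', G.IsLeftOrder S r' ∧ ∀ v ∈ S, v ≠ a → r' v < r' a := by
  set R := lastRank G S r with hR
  set N := S.sup r + 1 with hN
  have hrN : ∀ v ∈ S, r v < N := fun v hv => Nat.lt_succ_of_le (Finset.le_sup hv)
  have hRN : ∀ v ∈ S, R v < N := by
    intro v hv
    obtain ⟨w, hw, -, heq⟩ := exists_eq_lastRank (G := G) r hv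
    rw [hR, heq]
    exact hrN w hw
  have hb : ∀ v, N - 1 - r v < N := fun v => by omega
  have hle : ∀ v ∈ S, r v ≤ R v := fun v hv => le_lastRank hv (Or.inl rfl)
  -- Vertices are sorted by decreasing right end `R v`, ties by decreasing left end `r v`.
  refine ⟨fun v => (N - R v) * N + (N - 1 - r v), ⟨?_, ?_⟩, ?_⟩
  · intro u hu v hv huv
    have := (lex_eq_iff (hb u) (hb v)).1 huv
    have h1 := hrN u hu
    have h2 := hrN v hv
    exact h.1 hu hv (by omega)
  · intro u hu v hv w hw huv hvw huw
    have h1 := (lex_lt_iff (hb u) (hb v)).1 huv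
    have h2 := (lex_lt_iff (hb v) (hb w)).1 hvw
    have hne : u ≠ v := by
      rintro rfl
      exact lt_irrefl _ huv
    rw [h.adj_iff' hu hv hne, ← hR]
    rw [h.adj_iff' hu hw huw.ne, ← hR] at huw
    have h3 := hRN u hu
    have h4 := hRN v hv
    have h5 := hRN w hw
    have h6 := hle v hv
    constructor <;> omega
  · intro v hv hva
    refine (lex_lt_iff (hb v) (hb a)).2 ?_
    have h1 := hfirst v hv hva
    have h3 := hRN v hv
    have h4 := hRN a ha
    have h6 := hle v hv
    have h7 := hrN v hv
    -- The interval of `a` ends first: a neighbour `v` of `a` equals or is adjacent to the last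
    -- neighbour of `a`, as `a` is simplicial, and a non-neighbour starts after `R a`.
    have : R a ≤ R v := by
      obtain ⟨w, hw, hw', heq⟩ := exists_eq_lastRank (G := G) r ha
      rw [← hR] at heq
      by_cases hav : G.Adj a v
      · rcases hw' with rfl | hw'
        · omega
        · rw [heq]
          refine le_lastRank hw ?_
          by_cases hvw : w = v
          · exact Or.inl hvw
          · exact Or.inr (hsimp v hv w hw hav hw' (Ne.symm hvw))
      · rw [h.adj_iff ha hv h1, ← hR] at hav
        omega
    omega

/-- The component of `a` in `S` minus the closed neighbourhood of `x`; empty if `a` is in this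
neighbourhood. -/
noncomputable def rootComp (G : SimpleGraph V) (S : Finset V) (a x : V) : Finset V :=
  haveI := Classical.decPred fun u => a ∈ G.coNbrs x ∧ u ∈ G.coNbrs x ∧
    G.ReachIn (S ∩ G.coNbrs x) a u
  S.filter fun u => a ∈ G.coNbrs x ∧ u ∈ G.coNbrs x ∧ G.ReachIn (S ∩ G.coNbrs x) a u

theorem mem_rootComp {S : Finset V} {a x u : V} : u ∈ rootComp G S a x ↔
    u ∈ S ∧ a ∈ G.coNbrs x ∧ u ∈ G.coNbrs x ∧ G.ReachIn (S ∩ G.coNbrs x) a u := by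
  simp [rootComp]

theorem rootComp_extend {S : Finset V} {a x u v : V} (hu : u ∈ rootComp G S a x) (hv : v ∈ S)
    (hvx : v ∈ G.coNbrs x) (huv : G.Adj u v) : v ∈ rootComp G S a x := by
  rw [mem_rootComp] at *
  exact ⟨hv, hu.2.1, hvx, hu.2.2.2.trans (.of_adj ⟨hu.1, hu.2.2.1⟩ ⟨hv, hvx⟩ huv)⟩

/-- If the component of the root avoiding `v` is not contained in the one avoiding `u`, it has a
vertex adjacent to `u`. -/
theorem exists_rootComp_exit {S : Finset V} {a u v : V} (haS : a ∈ S) (hau : a ∈ G.coNbrs u)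
    (h : ¬ rootComp G S a v ⊆ rootComp G S a u) :
    ∃ e s, e ∈ rootComp G S a u ∧ G.ReachIn (S ∩ G.coNbrs v ∩ G.coNbrs u) a e ∧
      e ∈ rootComp G S a v ∧ s ∈ rootComp G S a v ∧ G.Adj u s ∧ G.Adj e s := by
  obtain ⟨b, hbv, hbu⟩ := Finset.not_subset.1 h
  have hbv' := mem_rootComp.1 hbv
  have hsub : (S : Set V) ∩ G.coNbrs v ∩ G.coNbrs u ⊆ (S : Set V) ∩ G.coNbrs u :=
    fun z hz => ⟨hz.1.1, hz.2⟩
  obtain ⟨e, s, he, heP, hsP, hsQ, hes⟩ := hbv'.2.2.2.exists_exit (Q := G.coNbrs u) hau (by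
    intro hr
    have hb := hr.mem ⟨⟨haS, hbv'.2.1⟩, hau⟩
    exact hbu (mem_rootComp.2 ⟨hbv'.1, hau, hb.2, hr.mono hsub⟩))
  have hev : e ∈ rootComp G S a v :=
    mem_rootComp.2 ⟨heP.1.1, hbv'.2.1, heP.1.2, he.mono Set.inter_subset_left⟩
  refine ⟨e, s, mem_rootComp.2 ⟨heP.1.1, hau, heP.2, he.mono hsub⟩, he, hev,
    rootComp_extend hev hsP.1 hsP.2 hes, ?_, hes⟩
  rcases notMem_coNbrs.1 hsQ with rfl | hus
  · exact absurd hes.symm heP.2.2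
  · exact hus

/-- If neither component contained the other, `x` would have a neighbour in that of `y` and `y` one
in that of `x`. For adjacent `x, y` this creates a forbidden chord; for nonadjacent ones both reach
`a` while avoiding each other, against the choice of the root. The components thus grade the
vertices into levels. -/
theorem rootComp_nested (hG : G.HoleFree) {S : Finset V} {a : V} (ha : G.IsGoodRoot S a) {x y : V}
    (hx : x ∈ S) (hy : y ∈ S) :
    rootComp G S a x ⊆ rootComp G S a y ∨ rootComp G S a y ⊆ rootComp G S a x := by
  by_contra hcon
  push Not at hcon
  obtain ⟨hxy, hyx⟩ := hcon
  have hax : a ∈ G.coNbrs x := by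
    obtain ⟨b, hb, -⟩ := Finset.not_subset.1 hxy
    exact (mem_rootComp.1 hb).2.1
  have hay : a ∈ G.coNbrs y := by
    obtain ⟨b, hb, -⟩ := Finset.not_subset.1 hyx
    exact (mem_rootComp.1 hb).2.1
  obtain ⟨e, u, -, hae, -, hu, hyu, heu⟩ := exists_rootComp_exit ha.1 hay hxy
  obtain ⟨f, v, -, haf, -, hv, hxv, hfv⟩ := exists_rootComp_exit ha.1 hax hyx
  rw [mem_rootComp] at hu hv
  by_cases hadj : G.Adj x y
  · have hr : G.ReachIn (G.coNbrs x) e f := by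
      refine ReachIn.trans (hae.symm.mono fun z hz => hz.1.2) (haf.mono fun z hz => hz.2)
    have hex : e ∈ G.coNbrs x := (hae.mem ⟨⟨ha.1, hax⟩, hay⟩).1.2
    have hyv : y ≠ v := fun h => hv.2.2.1.1 h.symm
    exact hv.2.2.1.2 (hG.chord hadj hxv hyv hyu hfv.symm hu.2.2.1
      ((ReachIn.of_adj hu.2.2.1 hex heu.symm).trans hr))
  · have hne : x ≠ y := by
      rintro rfl
      exact hxy (le_refl _)
    have h1 : x ∈ G.coNbrs y := ⟨hne, fun h => hadj h.symm⟩
    have h2 : y ∈ G.coNbrs x := coNbrs_comm.1 h1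
    refine ha.2.2 x hx y hy (coNbrs_comm.1 hax) (coNbrs_comm.1 hay) h1 ?_ ?_
    · exact ReachIn.trans (.of_adj ⟨hx, h1⟩ ⟨hv.1, hv.2.2.1⟩ hxv) hv.2.2.2.symm
    · exact ReachIn.trans (.of_adj ⟨hy, h2⟩ ⟨hu.1, hu.2.2.1⟩ hyu) hu.2.2.2.symm

/-- If `u` missed `v`, it would be attached to the component for `v`, hence lie in the component for
`w`, all of whose vertices miss `w`. So ordering by level already has the required property between
different levels. -/
theorem adj_of_rootComp_lt {S : Finset V} {a u v w : V} (haS : a ∈ S) (hu : u ∈ S)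
    (huv : ¬ rootComp G S a v ⊆ rootComp G S a u) (hvw : rootComp G S a v ⊆ rootComp G S a w)
    (hadj : G.Adj u w) : G.Adj u v := by
  by_contra hn
  have hne : u ≠ v := by
    rintro rfl
    exact huv (le_refl _)
  have huv' : u ∈ G.coNbrs v := ⟨hne, fun h => hn h.symm⟩
  have hav : a ∈ G.coNbrs v := by
    obtain ⟨b, hb, -⟩ := Finset.not_subset.1 huv
    exact (mem_rootComp.1 hb).2.1
  have haa : a ∈ rootComp G S a v := mem_rootComp.2 ⟨haS, hav, hav, .refl a⟩
  have hmem : u ∈ rootComp G S a v := by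
    by_cases hau : a ∈ G.coNbrs u
    · obtain ⟨e, s, -, -, -, hs, hus, -⟩ := exists_rootComp_exit haS hau huv
      exact rootComp_extend hs hu huv' hus.symm
    · rcases notMem_coNbrs.1 hau with rfl | h
      · exact haa
      · exact rootComp_extend haa hu huv' h.symm
  exact (mem_rootComp.1 (hvw hmem)).2.2.1.2 hadj.symm

/-- Two vertices of the same level have a common neighbour in the root component of any vertex of a
higher level. -/
theorem exists_common_nbr {S : Finset V} {a u v w : V} (haS : a ∈ S) (hau : a ∈ G.coNbrs u)
    (huv : rootComp G S a u = rootComp G S a v)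
    (huw : ¬ rootComp G S a w ⊆ rootComp G S a u) :
    ∃ s ∈ rootComp G S a w, G.Adj u s ∧ G.Adj v s := by
  obtain ⟨e, s, heu, -, -, hs, hus, hes⟩ := exists_rootComp_exit haS hau huw
  refine ⟨s, hs, hus, ?_⟩
  by_contra hvs
  have hev := mem_rootComp.1 (huv ▸ heu)
  have hne : s ≠ v := by
    rintro rfl
    exact hev.2.2.1.2 hes.symm
  have : s ∈ rootComp G S a u :=
    huv ▸ rootComp_extend (huv ▸ heu) (mem_rootComp.1 hs).1 ⟨hne, hvs⟩ hes
  exact (mem_rootComp.1 this).2.2.1.2 hus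

end IntervalOrder

end SimpleGraph

/-! ### Ordering the levels: hole-free graphs without asteroidal triples are interval graphs -/

namespace SimpleGraph

section IntervalOrder

variable {V : Type*} {G : SimpleGraph V}

theorem exists_injOn_nat (S : Finset V) : ∃ f : V → ℕ, Set.InjOn f S := by
  classical
  refine ⟨fun v => if h : v ∈ S then (S.equivFin ⟨v, h⟩).val else 0, fun u hu v hv huv => ?_⟩
  have hu' : u ∈ S := hu
  have hv' : v ∈ S := hv
  simp only [hu', hv', dif_pos] at huv
  exact congrArg Subtype.val (S.equivFin.injective (Fin.ext huv))

theorem mem_rootComp_self {S : Finset V} {a u : V} (haS : a ∈ S) (hau : a ∈ G.coNbrs u) :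
    a ∈ rootComp G S a u :=
  mem_rootComp.2 ⟨haS, hau, hau, .refl a⟩

/-- The vertices of one level together with the lowest vertex above having a neighbour there. -/
theorem IsGoodRoot.exists_level_order (hG : G.HoleFree) (hAT : G.ATFree) {S : Finset V} {a : V}
    (ha : G.IsGoodRoot S a)
    (ih : ∀ T ⊂ S, ∀ b, G.IsGoodRoot T b →
      ∃ r, G.IsLeftOrder T r ∧ ∀ v ∈ T, v ≠ b → r b < r v) (L : Finset V) :
    ∃ r : V → ℕ, Set.InjOn r {x | x ∈ S ∧ rootComp G S a x = L} ∧
      (∀ u ∈ S, ∀ v ∈ S, ∀ w ∈ S, rootComp G S a u = L → rootComp G S a v = L → r u < r v →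
        G.Adj u w → (rootComp G S a w = L ∧ r v < r w ∨ ¬ rootComp G S a w ⊆ L) → G.Adj u v) ∧
      (rootComp G S a a = L → ∀ v ∈ S, rootComp G S a v = L → v ≠ a → r a < r v) := by
  classical
  have haa : a ∉ G.coNbrs a := fun h => h.1 rfl
  have hA0 : rootComp G S a a = ∅ := by
    rw [Finset.eq_empty_iff_forall_notMem]
    intro u hu
    exact haa (mem_rootComp.1 hu).2.1
  -- The bottom level is the closed neighbourhood of `a`, a clique because `a` is simplicial, so any
  -- order starting with `a` will do.
  by_cases hL : L = ∅
  · obtain ⟨f, hf⟩ := exists_injOn_nat S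
    have hnb : ∀ u ∈ S, rootComp G S a u = L → u ≠ a → G.Adj a u := by
      intro u hu h hne
      by_contra hn
      have := mem_rootComp_self ha.1 (coNbrs_comm.1 ⟨hne, hn⟩ : a ∈ G.coNbrs u)
      rw [h, hL] at this
      simp at this
    refine ⟨fun v => if v = a then 0 else f v + 1, ?_, ?_, ?_⟩
    · rintro u ⟨hu, -⟩ v ⟨hv, -⟩ huv
      dsimp only at huv
      split_ifs at huv with h1 h2 h2
      · rw [h1, h2]
      · exact hf hu hv (by omega)
    · intro u hu v hv w hw hLu hLv huv _ _
      dsimp only at huv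
      split_ifs at huv with h1 h2 h2
      · omega
      · rw [h1]
        exact hnb v hv hLv h2
      · omega
      · refine ha.2.1 u hu v hv (hnb u hu hLu h1) (hnb v hv hLv h2) ?_
        rintro rfl
        omega
    · intro _ v _ _ hva
      simp [hva]
  have haL : rootComp G S a a ≠ L := fun h => hL (h.symm.trans hA0)
  have hco : ∀ u, rootComp G S a u = L → a ∈ G.coNbrs u := by
    intro u h
    obtain ⟨b, hb⟩ := Finset.nonempty_iff_ne_empty.2 hL
    rw [← h] at hb
    exact (mem_rootComp.1 hb).2.1
  set Λ := S.filter fun x => rootComp G S a x = L with hΛ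
  have memΛ : ∀ x, x ∈ Λ ↔ x ∈ S ∧ rootComp G S a x = L := by simp [hΛ]
  have haΛ : a ∉ Λ := fun h => haL ((memΛ a).1 h).2
  rcases Λ.eq_empty_or_nonempty with hΛe | hΛne
  · refine ⟨fun _ => 0, ?_, fun u _ v _ w _ _ _ h => absurd h (lt_irrefl _),
      fun h => absurd h haL⟩
    intro u hu
    have := (memΛ u).2 hu
    simp [hΛe] at this
  set W := S.filter fun w => ¬ rootComp G S a w ⊆ L ∧ ∃ u ∈ Λ, G.Adj u w with hW
  have memW : ∀ w, w ∈ W ↔ w ∈ S ∧ ¬ rootComp G S a w ⊆ L ∧ ∃ u ∈ Λ, G.Adj u w := by simp [hW]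
  rcases W.eq_empty_or_nonempty with hWe | hWne
  · obtain ⟨b, hb⟩ := exists_isGoodRoot hG hAT Λ hΛne
    obtain ⟨r, hr, -⟩ := ih Λ ⟨Finset.filter_subset _ _, fun h => haΛ (h ha.1)⟩ b hb
    refine ⟨r, fun u hu v hv => hr.1 ((memΛ u).2 hu) ((memΛ v).2 hv), ?_, fun h => absurd h haL⟩
    intro u hu v hv w hw hLu hLv huv huw hcase
    rcases hcase with ⟨hLw, hvw⟩ | hLw
    · exact hr.2 u ((memΛ u).2 ⟨hu, hLu⟩) v ((memΛ v).2 ⟨hv, hLv⟩) w ((memΛ w).2 ⟨hw, hLw⟩)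
        huv hvw huw
    · have := (memW w).2 ⟨hw, hLw, u, (memΛ u).2 ⟨hu, hLu⟩, huw⟩
      simp [hWe] at this
  obtain ⟨w, hw, hwmin⟩ := Finset.exists_min_image W (fun w => (rootComp G S a w).card) hWne
  obtain ⟨hwS, hwL, u₀, hu₀, hu₀w⟩ := (memW w).1 hw
  have hwΛ : w ∉ Λ := fun h => hwL ((memΛ w).1 h).2.le
  have hwa : w ≠ a := by
    rintro rfl
    exact hwL (by simp [hA0])
  have common : ∀ u ∈ Λ, ∀ v ∈ Λ, ∃ s ∈ rootComp G S a w, G.Adj u s ∧ G.Adj v s := by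
    intro u hu v hv
    have h1 := ((memΛ u).1 hu).2
    have h2 := ((memΛ v).1 hv).2
    exact exists_common_nbr ha.1 (hco u h1) (h1.trans h2.symm) (h1.symm ▸ hwL)
  -- The component of the lowest vertex `w` lies in that of `w'`. If `v` missed `w` it would join
  -- this component, and so miss `w'`. Hence `w` can stand for all higher neighbours.
  have hadjw : ∀ v ∈ Λ, ∀ w' ∈ W, G.Adj v w' → G.Adj v w := by
    intro v hv w' hw' hvw'
    obtain ⟨hvS, hvL⟩ := (memΛ v).1 hv
    have hsub : rootComp G S a w ⊆ rootComp G S a w' := by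
      rcases rootComp_nested hG ha hwS ((memW w').1 hw').1 with h | h
      · exact h
      · exact (Finset.eq_of_subset_of_card_le h (hwmin w' hw')).ge
    by_contra hn
    obtain ⟨s, hs, hvs, -⟩ := common v hv v hv
    have hvw : v ∈ G.coNbrs w := ⟨fun h => hwΛ (h ▸ hv), fun h => hn h.symm⟩
    have := hsub (rootComp_extend hs hvS hvw hvs.symm)
    exact (mem_rootComp.1 this).2.2.1.2 hvw'.symm
  have hclique : ∀ u ∈ Λ, ∀ v ∈ Λ, G.Adj w u → G.Adj w v → u ≠ v → G.Adj u v := by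
    intro u hu v hv hwu hwv hne
    obtain ⟨s, hs, hus, hvs⟩ := common u hu v hv
    exact hG.chord hwu hwv hne hus hvs (mem_rootComp.1 hs).2.2.1 (.refl s)
  set H := insert w Λ with hH
  -- A common neighbour in the component for `w` provides the missing path: for adjacency to `w` it
  -- forces a chord, for the second condition it completes an asteroidal triple.
  have hroot : G.IsGoodRoot H w := by
    refine ⟨Finset.mem_insert_self _ _, ?_, ?_⟩
    · intro u hu v hv hwu hwv
      exact hclique u (Finset.mem_of_mem_insert_of_ne hu hwu.ne') v
        (Finset.mem_of_mem_insert_of_ne hv hwv.ne') hwu hwv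
    · intro x hx y hy hxw hyw hxy hrx hry
      obtain ⟨s, hs, hxs, hys⟩ := common x (Finset.mem_of_mem_insert_of_ne hx hxw.1) y
        (Finset.mem_of_mem_insert_of_ne hy hyw.1)
      have hsw := (mem_rootComp.1 hs).2.2.1
      refine hAT Set.univ x y w ⟨coNbrs_comm.1 hxy, coNbrs_comm.1 hyw, hxw, ?_, ?_, ?_⟩ <;>
        rw [Set.inter_univ]
      · exact (ReachIn.of_adj hxw hsw hxs).trans (.of_adj hsw hyw hys.symm)
      · exact hry.mono Set.inter_subset_right
      · exact hrx.symm.mono Set.inter_subset_right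
  have hHS : H ⊂ S := by
    refine ⟨Finset.insert_subset hwS (Finset.filter_subset _ _), fun h => ?_⟩
    rcases Finset.mem_insert.1 (h ha.1) with h | h
    · exact hwa h.symm
    · exact haΛ h
  obtain ⟨r, hr, hrw⟩ := ih H hHS w hroot
  -- The induction puts `w` first; it has to come last, since it represents the vertices above the
  -- level.
  obtain ⟨r, hr, hrw⟩ := hr.exists_reflect hroot.1 hrw hroot.2.1
  have hΛH : ∀ x ∈ Λ, x ∈ H := fun x hx => Finset.mem_insert_of_mem hx
  refine ⟨r, fun u hu v hv => hr.1 (hΛH u ((memΛ u).2 hu)) (hΛH v ((memΛ v).2 hv)), ?_,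
    fun h => absurd h haL⟩
  intro u hu v hv x hx hLu hLv huv hux hcase
  have hu' := (memΛ u).2 ⟨hu, hLu⟩
  have hv' := (memΛ v).2 ⟨hv, hLv⟩
  rcases hcase with ⟨hLx, hvx⟩ | hLx
  · exact hr.2 u (hΛH u hu') v (hΛH v hv') x (hΛH x ((memΛ x).2 ⟨hx, hLx⟩)) huv hvx hux
  · have huw := hadjw u hu' x ((memW x).2 ⟨hx, hLx, u, hu', hux⟩) hux
    exact hr.2 u (hΛH u hu') v (hΛH v hv') w hroot.1 huv
      (hrw v (hΛH v hv') fun h => hwΛ (h ▸ hv')) huw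

/-- The vertices are ordered lexicographically, by the size of the root component and then by the
order within the level. As the components are nested, equal size means equal level. -/
theorem IsGoodRoot.exists_isLeftOrder (hG : G.HoleFree) (hAT : G.ATFree) (S : Finset V) (a : V)
    (ha : G.IsGoodRoot S a) : ∃ r, G.IsLeftOrder S r ∧ ∀ v ∈ S, v ≠ a → r a < r v := by
  classical
  induction S using Finset.strongInduction generalizing a with
  | H S ih =>
  choose ρ hinj hord hfirst using ha.exists_level_order hG hAT ih
  set A := rootComp G S a with hA
  set N := (S.sup fun v => ρ (A v) v) + 1 with hN
  have hb : ∀ v ∈ S, ρ (A v) v < N := fun v hv =>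
    Nat.lt_succ_of_le (Finset.le_sup (f := fun v => ρ (A v) v) hv)
  have hcard : ∀ u ∈ S, ∀ v ∈ S, (A u).card ≤ (A v).card → A u ⊆ A v := by
    intro u hu v hv h
    rcases rootComp_nested hG ha hu hv with h' | h'
    · exact h'
    · exact (Finset.eq_of_subset_of_card_le h' h).ge
  have hcard' : ∀ u ∈ S, ∀ v ∈ S, (A u).card = (A v).card → A u = A v := fun u hu v hv h =>
    (hcard u hu v hv h.le).antisymm (hcard v hv u hu h.ge)
  have hA0 : A a = ∅ := by
    rw [Finset.eq_empty_iff_forall_notMem]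
    intro u hu
    exact (mem_rootComp.1 hu).2.1.1 rfl
  refine ⟨fun v => (A v).card * N + ρ (A v) v, ⟨?_, ?_⟩, ?_⟩
  · intro u hu v hv huv
    obtain ⟨h1, h2⟩ := (lex_eq_iff (hb u hu) (hb v hv)).1 huv
    have h3 := hcard' u hu v hv h1
    rw [← h3] at h2
    exact hinj (A u) ⟨hu, rfl⟩ ⟨hv, h3.symm⟩ h2
  · intro u hu v hv w hw huv hvw huw
    rcases (lex_lt_iff (hb u hu) (hb v hv)).1 huv with h1 | ⟨h1, h2⟩
    · refine adj_of_rootComp_lt ha.1 hu (fun h => ?_) (hcard v hv w hw ?_) huw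
      · exact absurd (Finset.card_le_card h) (Nat.not_le.2 h1)
      · rcases (lex_lt_iff (hb v hv) (hb w hw)).1 hvw with h | h <;> omega
    · have h3 := hcard' u hu v hv h1
      rw [← h3] at h2
      refine hord (A u) u hu v hv w hw rfl h3.symm h2 huw ?_
      rcases (lex_lt_iff (hb v hv) (hb w hw)).1 hvw with h | ⟨h, h'⟩
      · right
        intro hsub
        exact absurd (Finset.card_le_card hsub) (Nat.not_le.2 (h1 ▸ h))
      · left
        have h4 := hcard' v hv w hw h
        rw [← h4, ← h3] at h'
        exact ⟨(h3.trans h4).symm, h'⟩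
  · intro v hv hva
    refine (lex_lt_iff (hb a ha.1) (hb v hv)).2 ?_
    rcases Nat.eq_zero_or_pos (A v).card with h | h
    · right
      have h' := Finset.card_eq_zero.1 h
      refine ⟨by rw [hA0, h'], ?_⟩
      rw [hA0, h']
      exact hfirst ∅ hA0 v hv h' hva
    · left
      rwa [hA0]

/-- Lekkerkerker and Boland: a finite graph without holes and asteroidal triples has an order
representing it as an interval graph. -/
theorem exists_isLeftOrder [Fintype V] (hG : G.HoleFree) (hAT : G.ATFree) :
    ∃ r, G.IsLeftOrder Finset.univ r := by
  rcases (Finset.univ : Finset V).eq_empty_or_nonempty with h | h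
  · exact ⟨fun _ => 0, by simp [IsLeftOrder, h]⟩
  · obtain ⟨a, ha⟩ := exists_isGoodRoot hG hAT Finset.univ h
    obtain ⟨r, hr, -⟩ := ha.exists_isLeftOrder hG hAT
    exact ⟨r, hr⟩

end IntervalOrder

end SimpleGraph

/-! ### Covers of the circle by holes and asteroidal triples -/

open SimpleGraph

section ReachAux

variable {V : Type*} {G : SimpleGraph V}

theorem SimpleGraph.ReachIn.mem_of_ne {S : Set V} {a b : V} (h : G.ReachIn S a b) (hne : a ≠ b) :
    a ∈ S ∧ b ∈ S := by
  rcases Relation.ReflTransGen.cases_head h with rfl | ⟨c, hc, h'⟩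
  · exact absurd rfl hne
  · exact ⟨hc.1, ReachIn.mem h' hc.2.1⟩

theorem SimpleGraph.IsAT.mem {C : Set V} {x y z : V} (h : G.IsAT C x y z) :
    x ∈ C ∧ y ∈ C ∧ z ∈ C := by
  obtain ⟨h1, h2, -, h4, h5, -⟩ := h
  exact ⟨(h4.mem_of_ne h1.1.symm).1.2, (h4.mem_of_ne h1.1.symm).2.2, (h5.mem_of_ne h2.1.symm).2.2⟩

theorem SimpleGraph.IsHole.cast_ne_zero {n : ℕ} {c : ZMod n → V} (h : G.IsHole n c) {k : ℕ}
    (hk : 0 < k) (hk' : k < 4) : (k : ZMod n) ≠ 0 := by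
  rw [Ne, ZMod.natCast_eq_zero_iff]
  intro hd
  have := Nat.le_of_dvd hk hd
  have := h.1
  omega

theorem SimpleGraph.IsHole.mem_coNbrs_add_two {n : ℕ} {c : ZMod n → V} (h : G.IsHole n c)
    (i : ZMod n) : c (i + 2) ∈ G.coNbrs (c i) := by
  have h1 : (1 : ZMod n) ≠ 0 := by exact_mod_cast h.cast_ne_zero (k := 1) (by omega) (by omega)
  have h2 : (2 : ZMod n) ≠ 0 := by exact_mod_cast h.cast_ne_zero (k := 2) (by omega) (by omega)
  have h3 : (3 : ZMod n) ≠ 0 := by exact_mod_cast h.cast_ne_zero (k := 3) (by omega) (by omega)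
  refine ⟨fun heq => h2 (by simpa using h.2.1 heq), fun had => ?_⟩
  rcases (h.2.2 _ _).1 had with heq | heq
  · exact h1 (by linear_combination heq)
  · exact h3 (by linear_combination -heq)

end ReachAux

namespace CircularArcModel

variable (M : CircularArcModel)

/-- No three arcs cover the circle. -/
def NoTripleCover : Prop :=
  ∀ A ∈ M.arcs, ∀ B ∈ M.arcs, ∀ C ∈ M.arcs, ∃ q, q ∉ A.points ∧ q ∉ B.points ∧ q ∉ C.points

variable {M}

theorem notMem_coNbrs_iff {A B : {A : CircArc // A ∈ M.arcs}} :
    B ∉ M.graph.coNbrs A ↔ (A.1.points ∩ B.1.points).Nonempty := by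
  rw [notMem_coNbrs]
  constructor
  · rintro (rfl | h)
    · simpa using B.1.points_nonempty
    · exact h.2
  · intro h
    by_cases hAB : B = A
    · exact Or.inl hAB
    · exact Or.inr ⟨fun h => hAB h.symm, h⟩

theorem adj_of_mem {A B : {A : CircArc // A ∈ M.arcs}} (hne : A ≠ B) {q : UnitAddCircle}
    (hA : q ∈ A.1.points) (hB : q ∈ B.1.points) : M.graph.Adj A B :=
  ⟨hne, q, hA, hB⟩

theorem IsNormal.exists_notMem (hM : M.IsNormal) {A B : CircArc} (hA : A ∈ M.arcs)
    (hB : B ∈ M.arcs) : ∃ q, q ∉ A.points ∧ q ∉ B.points := by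
  by_cases h : A = B
  · exact ⟨A.s, A.s_notMem, h ▸ A.s_notMem⟩
  · have := hM A hA B hB h
    rw [Set.ne_univ_iff_exists_notMem] at this
    obtain ⟨q, hq⟩ := this
    exact ⟨q, fun h => hq (Or.inl h), fun h => hq (Or.inr h)⟩

theorem IsNormal.subset_of_extremes_mem (hM : M.IsNormal) {A B : CircArc} (hA : A ∈ M.arcs)
    (hB : B ∈ M.arcs) (hs : A.s ∈ B.points) (ht : A.t ∈ B.points) : A.points ⊆ B.points := by
  rcases CircArc.subset_or_cover_of_extremes_mem hs ht with h | h
  · exact h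
  · obtain ⟨q, h1, h2⟩ := hM.exists_notMem hA hB
    have : q ∈ A.points ∪ B.points := h ▸ Set.mem_univ q
    exact absurd this (by simp [h1, h2])

/-- A point missed by all arcs of `C` allows the circle to be cut there, turning `C` into a family
of intervals of the line with the same intersections. -/
theorem interval_coords (C : Set {A : CircArc // A ∈ M.arcs}) {p : UnitAddCircle}
    (hp : ∀ B ∈ C, p ∉ B.1.points) : ∃ s t : {A : CircArc // A ∈ M.arcs} → ℝ,
      (∀ B ∈ C, s B < t B) ∧
      ∀ B ∈ C, ∀ B' ∈ C, B' ∉ M.graph.coNbrs B ↔ s B < t B' ∧ s B' < t B := by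
  obtain ⟨p, -, rfl⟩ := exists_coe_eq 0 p
  have : ∀ B, B ∈ C → ∃ s t : ℝ, p ≤ s ∧ s < t ∧ t ≤ p + 1 ∧ ∀ q ∈ Set.Ico p (p + 1),
      ((q : UnitAddCircle) ∈ B.1.points ↔ s < q ∧ q < t) :=
    fun B hB => B.1.exists_coords_of_notMem (hp B hB)
  choose! s t h1 h2 h3 h4 using this
  refine ⟨s, t, h2, fun B hB B' hB' => ?_⟩
  rw [notMem_coNbrs_iff]
  have a1 := h1 B hB
  have a2 := h2 B hB
  have a3 := h3 B hB
  have b1 := h1 B' hB'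
  have b2 := h2 B' hB'
  have b3 := h3 B' hB'
  constructor
  · rintro ⟨q, hq, hq'⟩
    obtain ⟨q, hqI, rfl⟩ := exists_coe_eq p q
    rw [h4 B hB q hqI] at hq
    rw [h4 B' hB' q hqI] at hq'
    exact ⟨hq.1.trans hq'.2, hq'.1.trans hq.2⟩
  · rintro ⟨h5, h6⟩
    have hlt : max (s B) (s B') < min (t B) (t B') := max_lt (lt_min a2 h5) (lt_min h6 b2)
    obtain ⟨q, hq1, hq2⟩ := exists_between hlt
    rw [max_lt_iff] at hq1
    rw [lt_min_iff] at hq2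
    have hqI : q ∈ Set.Ico p (p + 1) := ⟨by linarith, by linarith⟩
    exact ⟨q, (h4 B hB q hqI).2 ⟨hq1.1, hq2.1⟩, (h4 B' hB' q hqI).2 ⟨hq1.2, hq2.2⟩⟩

/-- The arcs of an asteroidal triple and its paths cover the circle. -/
theorem cover_of_isAT {C : Set {A : CircArc // A ∈ M.arcs}} {x y z : {A : CircArc // A ∈ M.arcs}}
    (h : M.graph.IsAT C x y z) (q : UnitAddCircle) : ∃ B ∈ C, q ∈ B.1.points := by
  by_contra hcon
  push Not at hcon
  obtain ⟨s, t, hst, hadj⟩ := interval_coords C hcon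
  -- On a line, a walk avoiding everything that meets `y` cannot pass from the left of `y` to its
  -- right.
  have key : ∀ x y z, x ∈ C → y ∈ C → z ∈ C → t x ≤ s y → t y ≤ s z →
      M.graph.ReachIn (M.graph.coNbrs y ∩ C) x z → False := by
    intro x y z hx hy hz hxy hyz hr
    have := hr.invariant (fun b => b ∈ C ∧ t b ≤ s y) ⟨hx, hxy⟩ fun b b' hb hbS hb'S hbb' => by
      refine ⟨hb'S.2, ?_⟩
      by_contra hn
      have h1 : ¬ (b' ∉ M.graph.coNbrs y) := fun h => h hb'S.1
      rw [hadj y hy b' hb'S.2] at h1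
      have h2 : b' ∉ M.graph.coNbrs b := fun h => h.2 hbb'
      rw [hadj b hb.1 b' hb'S.2] at h2
      have h3 := hb.2
      have h4 := hst y hy
      push Not at h1 hn
      have := h1 hn
      linarith [h2.2]
    have h1 := hst z hz
    have h2 := hst y hy
    linarith [this.2]
  obtain ⟨hx, hy, hz⟩ := h.mem
  obtain ⟨hxy, hyz, hzx, h1, h2, h3⟩ := h
  have d1 : ¬ (y ∉ M.graph.coNbrs x) := fun h => h hxy
  have d2 : ¬ (z ∉ M.graph.coNbrs y) := fun h => h hyz
  have d3 : ¬ (x ∉ M.graph.coNbrs z) := fun h => h hzx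
  rw [hadj x hx y hy] at d1
  rw [hadj y hy z hz] at d2
  rw [hadj z hz x hx] at d3
  have e1 := hst x hx
  have e2 := hst y hy
  have e3 := hst z hz
  have k1 := key x y z hx hy hz
  have k2 := key z y x hz hy hx
  have k3 := key y z x hy hz hx
  have k4 := key x z y hx hz hy
  have k5 := key z x y hz hx hy
  have k6 := key y x z hy hx hz
  have f1 : t x ≤ s y ∨ t y ≤ s x := by grind
  have f2 : t y ≤ s z ∨ t z ≤ s y := by grind
  have f3 : t z ≤ s x ∨ t x ≤ s z := by grind
  -- Two of the eight combinations are cyclic and impossible. In the other six one of the three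
  -- intervals lies in the middle and separates the other two.
  rcases f1 with f1 | f1 <;> rcases f2 with f2 | f2 <;> rcases f3 with f3 | f3
  · linarith
  · exact k1 f1 f2 h3.symm
  · exact k5 f3 f1 h2.symm
  · exact k4 f3 f2 h1
  · exact k3 f2 f3 h1.symm
  · exact k6 f1 f3 h2
  · exact k2 f2 f1 h3
  · linarith

/-- On a line, the two neighbours of the interval with the least right end would meet each other
near that end. -/
theorem cover_of_isHole {n : ℕ} {c : ZMod n → {A : CircArc // A ∈ M.arcs}}
    (h : M.graph.IsHole n c) (q : UnitAddCircle) : ∃ i, q ∈ (c i).1.points := by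
  by_contra hcon
  push Not at hcon
  obtain ⟨s, t, hst, hadj⟩ := interval_coords (Set.range c) (p := q) (by simpa using hcon)
  have : NeZero n := ⟨by have := h.1; omega⟩
  obtain ⟨i, -, hi⟩ := Finset.exists_min_image Finset.univ (fun i => t (c i)) ⟨0, by simp⟩
  have h1 : c (i + 1) ∉ M.graph.coNbrs (c i) := fun h' => h'.2 ((h.2.2 _ _).2 (Or.inl rfl))
  have h2 : c (i - 1) ∉ M.graph.coNbrs (c i) := fun h' => h'.2 ((h.2.2 _ _).2 (Or.inr (by ring)))
  rw [hadj _ ⟨_, rfl⟩ _ ⟨_, rfl⟩] at h1 h2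
  have h3 : c (i + 1) ∉ M.graph.coNbrs (c (i - 1)) := by
    rw [hadj _ ⟨_, rfl⟩ _ ⟨_, rfl⟩]
    have h4 := hi (i + 1) (by simp)
    have h5 := hi (i - 1) (by simp)
    constructor <;> linarith [h1.2, h2.2]
  have := h.mem_coNbrs_add_two (i - 1)
  rw [show i - 1 + 2 = i + 1 by ring] at this
  exact h3 this

/-- A cover of the circle by arcs of a normal model without holes contains three pairwise
intersecting arcs that cover the circle. -/
theorem exists_triple_cover (hM : M.IsNormal) (hG : M.graph.HoleFree)
    {C : Set {A : CircArc // A ∈ M.arcs}} (hC : ∀ q, ∃ B ∈ C, q ∈ B.1.points) :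
    ∃ A ∈ C, ∃ L ∈ C, ∃ R ∈ C, M.graph.Adj A L ∧ M.graph.Adj A R ∧ M.graph.Adj L R ∧
      ∀ q, q ∈ A.1.points ∨ q ∈ L.1.points ∨ q ∈ R.1.points := by
  classical
  -- A subcover of least size has no redundant arc, in particular no inclusions. Fixing an arc `A`
  -- in it, every other arc meeting `A` contains exactly one extreme of `A`.
  obtain ⟨F, hF, hFmin⟩ := Finset.exists_min_image
    (Finset.univ.filter fun F : Finset {A : CircArc // A ∈ M.arcs} =>
      (F : Set _) ⊆ C ∧ ∀ q, ∃ B ∈ F, q ∈ B.1.points) Finset.card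
    ⟨C.toFinset, by simpa using hC⟩
  simp only [Finset.mem_filter, Finset.mem_univ, true_and] at hF hFmin
  obtain ⟨hFC, hFcov⟩ := hF
  have hmin : ∀ A ∈ F, ∃ q ∈ A.1.points, ∀ B ∈ F, B ≠ A → q ∉ B.1.points := by
    intro A hA
    by_contra hcon
    push Not at hcon
    have := hFmin (F.erase A) ⟨fun B hB => hFC (Finset.mem_of_mem_erase hB), fun q => by
      obtain ⟨B, hB, hqB⟩ := hFcov q
      by_cases hBA : B = A
      · subst hBA
        obtain ⟨B', hB', hne, hq'⟩ := hcon q hqB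
        exact ⟨B', Finset.mem_erase.2 ⟨hne, hB'⟩, hq'⟩
      · exact ⟨B, Finset.mem_erase.2 ⟨hBA, hB⟩, hqB⟩⟩
    have := Finset.card_erase_lt_of_mem hA
    omega
  have hnsub : ∀ A ∈ F, ∀ B ∈ F, B ≠ A → ¬ A.1.points ⊆ B.1.points := by
    intro A hA B hB hne hsub
    obtain ⟨q, hq, hq'⟩ := hmin A hA
    exact hq' B hB hne (hsub hq)
  obtain ⟨A, hA, -⟩ := hFcov 0
  by_contra hcon
  have hboth : ∀ B ∈ F, A.1.s ∈ B.1.points → A.1.t ∈ B.1.points → False := by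
    intro B hB h1 h2
    refine hnsub A hA B hB ?_ (hM.subset_of_extremes_mem A.2 B.2 h1 h2)
    rintro rfl
    exact B.1.s_notMem h1
  have hneA : ∀ B, A.1.s ∈ B.1.points ∨ A.1.t ∈ B.1.points → B ≠ A := by
    rintro B h rfl
    rcases h with h | h
    · exact B.1.s_notMem h
    · exact B.1.t_notMem h
  -- If `L` and `R` meet inside `A`, they make `A` redundant; if outside, the three arcs are the
  -- covering triple sought.
  have hLR : ∀ L ∈ F, ∀ R ∈ F, A.1.s ∈ L.1.points → A.1.t ∈ R.1.points → ¬ M.graph.Adj L R := by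
    intro L hL R hR hs ht hLR
    have hLA := hneA L (Or.inl hs)
    have hRA := hneA R (Or.inr ht)
    obtain ⟨-, v, hvL, hvR⟩ := id hLR
    by_cases hvA : v ∈ A.1.points
    · have := CircArc.subset_union_of_meet_inside hs (hboth L hL hs) ht
        (fun h => hboth R hR h ht) hvA hvL hvR
      obtain ⟨q, hq, hq'⟩ := hmin A hA
      rcases this hq with h | h
      · exact hq' L hL hLA h
      · exact hq' R hR hRA h
    · exact hcon ⟨A, hFC hA, L, hFC hL, R, hFC hR,
        ⟨hLA.symm, CircArc.inter_nonempty_of_s_mem hs⟩,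
        ⟨hRA.symm, CircArc.inter_nonempty_of_t_mem ht⟩, hLR,
        CircArc.cover_of_meet_outside hs (hboth L hL hs) ht (fun h => hboth R hR h ht) hvA hvL hvR⟩
  have htype : ∀ B ∈ F, B ≠ A → B ∉ M.graph.coNbrs A → A.1.s ∈ B.1.points ∨ A.1.t ∈ B.1.points := by
    intro B hB hne h
    by_contra hn
    push Not at hn
    exact hnsub B hB A hA hne.symm
      (CircArc.subset_of_extremes_notMem (notMem_coNbrs_iff.1 h) hn.1 hn.2)
  -- `Q` collects the arcs on the side of `A.s`: those containing `A.s`, or reached from one of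
  -- these through arcs disjoint from `A`. By `hLR` and the chord property, `Q` never passes to an
  -- arc containing `A.t`; but the complement of `A` is connected, so some arc in `Q` must meet one
  -- outside.
  set Q : {A : CircArc // A ∈ M.arcs} → Prop := fun B => A.1.s ∈ B.1.points ∨
    (B ∈ M.graph.coNbrs A ∧ ∃ L ∈ F, A.1.s ∈ L.1.points ∧ ∃ d ∈ M.graph.coNbrs A,
      M.graph.Adj L d ∧ M.graph.ReachIn (M.graph.coNbrs A) d B) with hQ
  have hQstep : ∀ B ∈ F, ∀ B' ∈ F, B ≠ A → B' ≠ A → Q B → M.graph.Adj B B' → Q B' := by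
    intro B hB B' hB' hBA hBA' hQB hadj
    by_cases hs' : A.1.s ∈ B'.1.points
    · exact Or.inl hs'
    by_cases hco : B' ∈ M.graph.coNbrs A
    · refine Or.inr ⟨hco, ?_⟩
      rcases hQB with hs | ⟨hBco, L, hL, hLs, d, hd, hLd, hr⟩
      · exact ⟨B, hB, hs, B', hco, hadj, .refl _⟩
      · exact ⟨L, hL, hLs, d, hd, hLd, hr.trans (.of_adj hBco hco hadj)⟩
    · exfalso
      have ht' := (htype B' hB' hBA' hco).resolve_left hs'
      rcases hQB with hs | ⟨hBco, L, hL, hLs, d, hd, hLd, hr⟩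
      · exact hLR B hB B' hB' hs ht' hadj
      · refine hLR L hL B' hB' hLs ht' (hG.chord (a := A) ?_ ?_ ?_ hLd hadj.symm hd hr)
        · exact ⟨(hneA L (Or.inl hLs)).symm, CircArc.inter_nonempty_of_s_mem hLs⟩
        · exact ⟨hBA'.symm, CircArc.inter_nonempty_of_t_mem ht'⟩
        · rintro rfl
          exact hs' hLs
  obtain ⟨v, hvA, ⟨_, ⟨B, ⟨hB, hQB⟩, rfl⟩, hvB⟩, ⟨_, ⟨B', ⟨hB', hQB'⟩, rfl⟩, hvB'⟩⟩ :=
    A.1.exists_mem_of_cover_compl (Subtype.val '' {B | B ∈ F ∧ Q B})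
      (Subtype.val '' {B | B ∈ F ∧ ¬ Q B})
      (by
        intro q _
        obtain ⟨B, hB, hqB⟩ := hFcov q
        by_cases hQB : Q B
        · exact Or.inl ⟨B.1, ⟨B, ⟨hB, hQB⟩, rfl⟩, hqB⟩
        · exact Or.inr ⟨B.1, ⟨B, ⟨hB, hQB⟩, rfl⟩, hqB⟩)
      (by
        obtain ⟨B, hB, hqB⟩ := hFcov A.1.s
        exact ⟨B.1, ⟨B, ⟨hB, Or.inl hqB⟩, rfl⟩, hqB⟩)
      (by
        obtain ⟨B, hB, hqB⟩ := hFcov A.1.t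
        refine ⟨B.1, ⟨B, ⟨hB, ?_⟩, rfl⟩, hqB⟩
        rintro (h | h)
        · exact hboth B hB h hqB
        · exact notMem_coNbrs_iff.2 (CircArc.inter_nonempty_of_t_mem hqB) h.1)
  refine hQB' (hQstep B hB B' hB' ?_ ?_ hQB (adj_of_mem ?_ hvB hvB'))
  · rintro rfl
    exact hvA hvB
  · rintro rfl
    exact hvA hvB'
  · rintro rfl
    exact hQB' hQB

/-- The arcs of an asteroidal triple and its paths contain three pairwise intersecting arcs covering
the circle. -/
theorem exists_triple_cover_of_isAT (hM : M.IsNormal) (hG : M.graph.HoleFree)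
    {C : Set {A : CircArc // A ∈ M.arcs}} {x y z : {A : CircArc // A ∈ M.arcs}}
    (h : M.graph.IsAT C x y z) :
    ∃ A ∈ C, ∃ L ∈ C, ∃ R ∈ C, M.graph.Adj A L ∧ M.graph.Adj A R ∧ M.graph.Adj L R ∧
      ∀ q, q ∈ A.1.points ∨ q ∈ L.1.points ∨ q ∈ R.1.points :=
  exists_triple_cover hM hG (cover_of_isAT h)

end CircularArcModel

/-! ### The Helly property and covering triples -/

namespace CircArc

/-- The trace on `A` of an arc that contains the beginning point of `A` only. -/
theorem exists_trace_of_s_mem {A B : CircArc} {p t : ℝ} (hpt : p < t) (htp : t < p + 1)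
    (hp : (p : UnitAddCircle) = A.s) (ht : (t : UnitAddCircle) = A.t)
    (hs : A.s ∈ B.points) (ht' : A.t ∉ B.points) :
    ∃ b, p < b ∧ b ≤ t ∧ ∀ q, p < q → q < t → ((q : UnitAddCircle) ∈ B.points ↔ q < b) := by
  obtain ⟨s, hsI, u, huI, hsu, -, -, hB⟩ := B.exists_coords p
  rw [← hp, hB p ⟨le_rfl, by linarith⟩] at hs
  rw [← ht, hB t ⟨hpt.le, htp⟩] at ht'
  simp only [Set.mem_Ico] at *
  refine ⟨u, by grind, by grind, fun q h1 h2 => ?_⟩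
  rw [hB q ⟨h1.le, by linarith⟩]
  grind

/-- The trace on `A` of an arc that contains the ending point of `A` only. -/
theorem exists_trace_of_t_mem {A B : CircArc} {p t : ℝ} (hpt : p < t) (htp : t < p + 1)
    (hp : (p : UnitAddCircle) = A.s) (ht : (t : UnitAddCircle) = A.t)
    (hs : A.s ∉ B.points) (ht' : A.t ∈ B.points) :
    ∃ b, p ≤ b ∧ b < t ∧ ∀ q, p < q → q < t → ((q : UnitAddCircle) ∈ B.points ↔ b < q) := by
  obtain ⟨s, hsI, u, huI, hsu, -, -, hB⟩ := B.exists_coords p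
  rw [← hp, hB p ⟨le_rfl, by linarith⟩] at hs
  rw [← ht, hB t ⟨hpt.le, htp⟩] at ht'
  simp only [Set.mem_Ico] at *
  refine ⟨s, by grind, by grind, fun q h1 h2 => ?_⟩
  rw [hB q ⟨h1.le, by linarith⟩]
  grind

end CircArc

namespace CircularArcModel

variable {M : CircularArcModel}

/-- On an inclusion-minimal arc `A` the other arcs trace an initial piece, a final piece or all of
`A`. An initial and a final piece overlap, since otherwise their arcs meet outside `A` and cover the
circle together with `A`. The Helly property of intervals on a line finishes the proof. -/
theorem IsNormal.isHelly (hM : M.IsNormal) (hT : M.NoTripleCover) : M.IsHelly := by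
  intro F hF hFint
  rcases F.eq_empty_or_nonempty with rfl | hne
  · exact ⟨0, by simp⟩
  obtain ⟨A, hA, hAmin⟩ := Finset.exists_minimalFor (fun A => A.points) F hne
  obtain ⟨p, t, hpt, htp, hp, ht, hAc⟩ := A.exists_coords_self
  have hAmem : ∀ q, p < q → q < t → (q : UnitAddCircle) ∈ A.points :=
    fun q h1 h2 => (hAc q ⟨h1.le, by linarith⟩).2 ⟨h1, h2⟩
  have htrace : ∀ B, B ∈ F → ∃ a b : ℝ, p ≤ a ∧ a < t ∧ p < b ∧ b ≤ t ∧
      (∀ q, p < q → q < t → a < q → q < b → (q : UnitAddCircle) ∈ B.points) ∧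
      (a = p ∨ A.s ∉ B.points ∧ A.t ∈ B.points ∧
        ∀ q, p < q → q < t → (q : UnitAddCircle) ∈ B.points → a < q) ∧
      (b = t ∨ A.s ∈ B.points ∧ A.t ∉ B.points ∧
        ∀ q, p < q → q < t → (q : UnitAddCircle) ∈ B.points → q < b) := by
    intro B hB
    by_cases hs : A.s ∈ B.points <;> by_cases ht' : A.t ∈ B.points
    · have := hM.subset_of_extremes_mem (hF hA) (hF hB) hs ht'
      exact ⟨p, t, le_rfl, hpt, hpt, le_rfl, fun q h1 h2 _ _ => this (hAmem q h1 h2),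
        Or.inl rfl, Or.inl rfl⟩
    · obtain ⟨b, h1, h2, h3⟩ := CircArc.exists_trace_of_s_mem hpt htp hp ht hs ht'
      exact ⟨p, b, le_rfl, hpt, h1, h2, fun q h4 h5 _ h6 => (h3 q h4 h5).2 h6, Or.inl rfl,
        Or.inr ⟨hs, ht', fun q h4 h5 => (h3 q h4 h5).1⟩⟩
    · obtain ⟨a, h1, h2, h3⟩ := CircArc.exists_trace_of_t_mem hpt htp hp ht hs ht'
      exact ⟨a, t, h1, h2, hpt, le_rfl, fun q h4 h5 h6 _ => (h3 q h4 h5).2 h6,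
        Or.inr ⟨hs, ht', fun q h4 h5 => (h3 q h4 h5).1⟩, Or.inl rfl⟩
    -- Here `B` lies in `A`, so by minimality it also contains `A`.
    · have hsub := CircArc.subset_of_extremes_notMem (hFint A hA B hB) hs ht'
      have hsub' : A.points ⊆ B.points := hAmin hB hsub
      exact ⟨p, t, le_rfl, hpt, hpt, le_rfl, fun q h1 h2 _ _ => hsub' (hAmem q h1 h2),
        Or.inl rfl, Or.inl rfl⟩
  choose! a b h1 h2 h3 h4 h5 h6 h7 using htrace
  have hlt : ∀ B ∈ F, ∀ B' ∈ F, a B < b B' := by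
    intro B hB B' hB'
    rcases h6 B hB with h | ⟨hs, ht', hq⟩
    · rw [h]
      exact h3 B' hB'
    rcases h7 B' hB' with h | ⟨hs', ht'', hq'⟩
    · rw [h]
      exact h2 B hB
    by_contra hn
    push Not at hn
    obtain ⟨v, hv, hv'⟩ := hFint B hB B' hB'
    by_cases hvA : v ∈ A.points
    · obtain ⟨v, hvI, rfl⟩ := exists_coe_eq p v
      rw [hAc v hvI] at hvA
      have := hq v hvA.1 hvA.2 hv
      have := hq' v hvA.1 hvA.2 hv'
      linarith
    · obtain ⟨q, hqA, hqB, hqB'⟩ := hT A (hF hA) B' (hF hB') B (hF hB)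
      rcases CircArc.cover_of_meet_outside hs' ht'' ht' hs hvA hv' hv q with h | h | h
      · exact hqA h
      · exact hqB h
      · exact hqB' h
  obtain ⟨L, hL, hLmax⟩ := Finset.exists_max_image F a hne
  obtain ⟨R, hR, hRmin⟩ := Finset.exists_min_image F b hne
  obtain ⟨q, hq1, hq2⟩ := exists_between (hlt L hL R hR)
  refine ⟨(q : UnitAddCircle), fun B hB => h5 B hB q ?_ ?_ ?_ ?_⟩
  · linarith [h1 L hL]
  · linarith [h4 R hR]
  · linarith [hLmax B hB]
  · linarith [hRmin B hB]

/-- `A` and `B` cover the connected complement of `C`. If one of them contained both extremes of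
`C`, it would contain `C`, and two arcs would cover the circle. -/
theorem IsNormal.inter_nonempty_of_cover (hM : M.IsNormal) {A B C : CircArc} (hA : A ∈ M.arcs)
    (hB : B ∈ M.arcs) (hC : C ∈ M.arcs)
    (h : ∀ q, q ∈ A.points ∨ q ∈ B.points ∨ q ∈ C.points) : (A.points ∩ B.points).Nonempty := by
  have hs := (h C.s).imp_right fun h => h.resolve_right C.s_notMem
  have ht := (h C.t).imp_right fun h => h.resolve_right C.t_notMem
  have hcov : ∀ q ∉ C.points, q ∈ A.points ∨ q ∈ B.points := fun q hq => by
    have := h q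
    tauto
  have both : ∀ X ∈ M.arcs, ∀ Y ∈ M.arcs, (∀ q ∉ C.points, q ∈ X.points ∨ q ∈ Y.points) →
      C.s ∈ X.points → C.t ∈ X.points → False := by
    intro X hX Y hY hcov hs ht
    have hsub := hM.subset_of_extremes_mem hC hX hs ht
    obtain ⟨q, h1, h2⟩ := hM.exists_notMem hX hY
    rcases hcov q fun h => h1 (hsub h) with h | h
    · exact h1 h
    · exact h2 h
  have conn : ∀ X Y : CircArc, (∀ q ∉ C.points, q ∈ X.points ∨ q ∈ Y.points) →
      C.s ∈ X.points → C.t ∈ Y.points → (X.points ∩ Y.points).Nonempty := by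
    intro X Y hcov hs ht
    obtain ⟨v, -, ⟨_, rfl, hv⟩, ⟨_, rfl, hv'⟩⟩ := C.exists_mem_of_cover_compl {X} {Y}
      (by simpa using hcov) (by simpa using hs) (by simpa using ht)
    exact ⟨v, hv, hv'⟩
  rcases hs with hs | hs <;> rcases ht with ht | ht
  · exact (both A hA B hB hcov hs ht).elim
  · exact conn A B hcov hs ht
  · rw [Set.inter_comm]
    exact conn B A (fun q hq => (hcov q hq).symm) hs ht
  · exact (both B hB A hA (fun q hq => (hcov q hq).symm) hs ht).elim

/-- Three covering arcs meet pairwise and so have a common point. Cutting there, their complements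
become closed intervals, which meet pairwise by normality; hence all three complements share a
point, which is left uncovered. -/
theorem IsNormal.noTripleCover (hM : M.IsNormal) (hH : M.IsHelly) : M.NoTripleCover := by
  classical
  intro A hA B hB C hC
  by_contra hcon
  push Not at hcon
  have h : ∀ q, q ∈ A.points ∨ q ∈ B.points ∨ q ∈ C.points := fun q => by
    have := hcon q
    tauto
  have hAB := hM.inter_nonempty_of_cover hA hB hC h
  have hAC := hM.inter_nonempty_of_cover hA hC hB fun q => by have := h q; tauto
  have hBC := hM.inter_nonempty_of_cover hB hC hA fun q => by have := h q; tauto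
  obtain ⟨v, hv⟩ := hH {A, B, C} (by
    intro X hX
    simp only [Finset.mem_insert, Finset.mem_singleton] at hX
    rcases hX with rfl | rfl | rfl <;> assumption) (by
    intro X hX Y hY
    simp only [Finset.mem_insert, Finset.mem_singleton] at hX hY
    rcases hX with rfl | rfl | rfl <;> rcases hY with rfl | rfl | rfl <;>
      first
      | assumption
      | (rw [Set.inter_comm]; assumption)
      | (rw [Set.inter_self]; exact CircArc.points_nonempty _))
  obtain ⟨p, -, rfl⟩ := exists_coe_eq 0 v
  have hpp : p ∈ Set.Ico p (p + 1) := ⟨le_rfl, by linarith⟩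
  have coords : ∀ X : CircArc, (p : UnitAddCircle) ∈ X.points → ∃ s t : ℝ, s < p + 1 ∧ p < t ∧ t < s ∧
      ∀ q ∈ Set.Ico p (p + 1), ((q : UnitAddCircle) ∈ X.points ↔ q < t ∨ s < q) := by
    intro X hX
    obtain ⟨s, hs, t, ht, hst, -, -, h⟩ := X.exists_coords p
    rw [h p hpp] at hX
    simp only [Set.mem_Ico] at *
    refine ⟨s, t, hs.2, by grind, by grind, fun q hq => ?_⟩
    rw [h q hq]
    grind
  obtain ⟨s₁, t₁, a1, a2, a3, a4⟩ := coords A (hv A (by simp))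
  obtain ⟨s₂, t₂, b1, b2, b3, b4⟩ := coords B (hv B (by simp))
  obtain ⟨s₃, t₃, c1, c2, c3, c4⟩ := coords C (hv C (by simp))
  obtain ⟨x, hx, hx'⟩ := hM.exists_notMem hA hB
  obtain ⟨y, hy, hy'⟩ := hM.exists_notMem hA hC
  obtain ⟨z, hz, hz'⟩ := hM.exists_notMem hB hC
  obtain ⟨x, hxI, rfl⟩ := exists_coe_eq p x
  obtain ⟨y, hyI, rfl⟩ := exists_coe_eq p y
  obtain ⟨z, hzI, rfl⟩ := exists_coe_eq p z
  rw [a4 x hxI] at hx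
  rw [b4 x hxI] at hx'
  rw [a4 y hyI] at hy
  rw [c4 y hyI] at hy'
  rw [b4 z hzI] at hz
  rw [c4 z hzI] at hz'
  push Not at hx hx' hy hy' hz hz'
  have hm1 := le_max_left t₁ (max t₂ t₃)
  have hm2 := (le_max_left t₂ t₃).trans (le_max_right t₁ _)
  have hm3 := (le_max_right t₂ t₃).trans (le_max_right t₁ _)
  -- The point common to the three closed intervals is their greatest left end.
  have hm4 : max t₁ (max t₂ t₃) ≤ s₁ := by
    simp only [max_le_iff]
    refine ⟨?_, ?_, ?_⟩ <;> linarith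
  have hm5 : max t₁ (max t₂ t₃) ≤ s₂ := by
    simp only [max_le_iff]
    refine ⟨?_, ?_, ?_⟩ <;> linarith
  have hm6 : max t₁ (max t₂ t₃) ≤ s₃ := by
    simp only [max_le_iff]
    refine ⟨?_, ?_, ?_⟩ <;> linarith
  generalize max t₁ (max t₂ t₃) = m at *
  have hmI : m ∈ Set.Ico p (p + 1) := ⟨by linarith, by linarith⟩
  rcases h m with h | h | h
  · rw [a4 m hmI] at h
    rcases h with h | h <;> linarith
  · rw [b4 m hmI] at h
    rcases h with h | h <;> linarith
  · rw [c4 m hmI] at h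
    rcases h with h | h <;> linarith

/-- In a normal model without covering triples no arc meets all the arcs of a hole. -/
theorem IsNormal.not_universal (hM : M.IsNormal) (hT : M.NoTripleCover) {n : ℕ}
    {c : ZMod n → {A : CircArc // A ∈ M.arcs}} (hc : M.graph.IsHole n c)
    {h : {A : CircArc // A ∈ M.arcs}} : ¬ ∀ i, M.graph.Adj h (c i) := by
  intro hadj
  have hcov := cover_of_isHole hc
  -- An arc `c i` containing both extremes of `h` would contain `h`, and then meet `c (i + 2)`.
  have hboth : ∀ i, h.1.s ∈ (c i).1.points → h.1.t ∈ (c i).1.points → False := by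
    intro i h1 h2
    have hsub := hM.subset_of_extremes_mem h.2 (c i).2 h1 h2
    obtain ⟨-, q, hq, hq'⟩ := hadj (i + 2)
    exact notMem_coNbrs_iff.2 ⟨q, hsub hq, hq'⟩ (hc.mem_coNbrs_add_two i)
  obtain ⟨v, hvA, ⟨_, ⟨L, hL, rfl⟩, hvL⟩, ⟨_, ⟨R, hR, rfl⟩, hvR⟩⟩ :=
    h.1.exists_mem_of_cover_compl ((fun i => (c i).1) '' {i | h.1.s ∈ (c i).1.points})
      ((fun i => (c i).1) '' {i | h.1.t ∈ (c i).1.points})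
      (by
        intro q hq
        obtain ⟨i, hi⟩ := hcov q
        by_cases hs : h.1.s ∈ (c i).1.points
        · exact Or.inl ⟨_, ⟨i, hs, rfl⟩, hi⟩
        by_cases ht : h.1.t ∈ (c i).1.points
        · exact Or.inr ⟨_, ⟨i, ht, rfl⟩, hi⟩
        exact absurd (CircArc.subset_of_extremes_notMem (hadj i).2 hs ht hi) hq)
      (by
        obtain ⟨i, hi⟩ := hcov h.1.s
        exact ⟨_, ⟨i, hi, rfl⟩, hi⟩)
      (by
        obtain ⟨i, hi⟩ := hcov h.1.t
        exact ⟨_, ⟨i, hi, rfl⟩, hi⟩)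
  obtain ⟨q, h1, h2, h3⟩ := hT h.1 h.2 (c L).1 (c L).2 (c R).1 (c R).2
  rcases CircArc.cover_of_meet_outside hL (hboth L hL) hR (fun h => hboth R h hR) hvA hvL hvR q with
    h | h | h
  · exact h1 h
  · exact h2 h
  · exact h3 h

end CircularArcModel

/-! ### Recognising the forbidden induced subgraphs -/

namespace SimpleGraph

section Forbidden

variable {V : Type*} {G : SimpleGraph V}

/-- Injectivity of `f` is automatic, because membership in `coNbrs` includes being distinct. -/
theorem isIndContained_of_map {W : Type*} {F : SimpleGraph W} (f : W → V)
    (h1 : ∀ a b, F.Adj a b → G.Adj (f a) (f b))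
    (h2 : ∀ a b, a ≠ b → ¬ F.Adj a b → f b ∈ G.coNbrs (f a)) : F.IsIndContained G := by
  refine ⟨⟨⟨f, fun a b hab => ?_⟩, fun {a b} => ⟨fun h => ?_, h1 a b⟩⟩⟩
  · by_contra hne
    by_cases had : F.Adj a b
    · exact (h1 a b had).ne hab
    · exact (h2 a b hne had).1 hab.symm
  · by_contra had
    have hne : a ≠ b := by
      rintro rfl
      exact G.irrefl h
    exact (h2 a b hne had).2 h

theorem isIndContained_of_lt {W : Type*} [LinearOrder W] {F : SimpleGraph W} (f : W → V)
    (h : ∀ a b, a < b → (F.Adj a b ∧ G.Adj (f a) (f b)) ∨ (¬ F.Adj a b ∧ f b ∈ G.coNbrs (f a))) :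
    F.IsIndContained G := by
  refine isIndContained_of_map f (fun a b hab => ?_) (fun a b hne hab => ?_)
  · rcases lt_or_gt_of_ne hab.ne with hlt | hlt
    · exact ((h a b hlt).resolve_right fun h => h.1 hab).2
    · exact ((h b a hlt).resolve_right fun h => h.1 hab.symm).2.symm
  · rcases lt_or_gt_of_ne hne with hlt | hlt
    · exact ((h a b hlt).resolve_left fun h => hab h.1).2
    · exact coNbrs_comm.1 ((h b a hlt).resolve_left fun h => hab h.1.symm).2

theorem threeSun_isIndContained {v₀ v₁ v₂ w₀ w₁ w₂ : V} (h01 : G.Adj v₀ v₁) (h12 : G.Adj v₁ v₂)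
    (h02 : G.Adj v₀ v₂) (h00 : G.Adj v₀ w₀) (h10 : G.Adj v₁ w₀) (h11 : G.Adj v₁ w₁)
    (h21 : G.Adj v₂ w₁) (h22 : G.Adj v₂ w₂) (h20 : G.Adj v₀ w₂) (n20 : w₀ ∈ G.coNbrs v₂)
    (n01 : w₁ ∈ G.coNbrs v₀) (n12 : w₂ ∈ G.coNbrs v₁) (m01 : w₁ ∈ G.coNbrs w₀)
    (m02 : w₂ ∈ G.coNbrs w₀) (m12 : w₂ ∈ G.coNbrs w₁) : threeSun.IsIndContained G := by
  have e1 := h01.symm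
  have e2 := h12.symm
  have e3 := h02.symm
  have e4 := h00.symm
  have e5 := h10.symm
  have e6 := h11.symm
  have e7 := h21.symm
  have e8 := h22.symm
  have e9 := h20.symm
  have f1 := coNbrs_comm.1 n20
  have f2 := coNbrs_comm.1 n01
  have f3 := coNbrs_comm.1 n12
  have f4 := coNbrs_comm.1 m01
  have f5 := coNbrs_comm.1 m02
  have f6 := coNbrs_comm.1 m12
  refine isIndContained_of_map (Sum.elim ![v₀, v₁, v₂] ![w₀, w₁, w₂]) ?_ ?_
  · rintro (a | a) (b | b) <;> fin_cases a <;> fin_cases b <;> simp [threeSun, *]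
  · rintro (a | a) (b | b) <;> fin_cases a <;> fin_cases b <;> simp [threeSun, *]

theorem tent_isIndContained {a b c x y z : V} (hab : G.Adj a b) (hbc : G.Adj b c)
    (hac : G.Adj a c) (hax : G.Adj a x) (hby : G.Adj b y) (hcz : G.Adj c z)
    (nay : y ∈ G.coNbrs a) (naz : z ∈ G.coNbrs a) (nbx : x ∈ G.coNbrs b) (nbz : z ∈ G.coNbrs b)
    (ncx : x ∈ G.coNbrs c) (ncy : y ∈ G.coNbrs c) (mxy : y ∈ G.coNbrs x) (myz : z ∈ G.coNbrs y)
    (mxz : z ∈ G.coNbrs x) : tent.IsIndContained G := by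
  have e1 := hab.symm
  have e2 := hbc.symm
  have e3 := hac.symm
  have e4 := hax.symm
  have e5 := hby.symm
  have e6 := hcz.symm
  have f1 := coNbrs_comm.1 nay
  have f2 := coNbrs_comm.1 naz
  have f3 := coNbrs_comm.1 nbx
  have f4 := coNbrs_comm.1 nbz
  have f5 := coNbrs_comm.1 ncx
  have f6 := coNbrs_comm.1 ncy
  have f7 := coNbrs_comm.1 mxy
  have f8 := coNbrs_comm.1 myz
  have f9 := coNbrs_comm.1 mxz
  refine isIndContained_of_map (Sum.elim ![x, y, z] ![c, a, b]) ?_ ?_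
  · rintro (a | a) (b | b) <;> fin_cases a <;> fin_cases b <;> simp [tent, threeSun, *]
  · rintro (a | a) (b | b) <;> fin_cases a <;> fin_cases b <;> simp [tent, threeSun, *]

theorem umbrella_isIndContained {p₀ p₁ p₂ p₃ p₄ u x : V} (h01 : G.Adj p₀ p₁) (h12 : G.Adj p₁ p₂)
    (h23 : G.Adj p₂ p₃) (h34 : G.Adj p₃ p₄) (n02 : p₂ ∈ G.coNbrs p₀) (n03 : p₃ ∈ G.coNbrs p₀)
    (n04 : p₄ ∈ G.coNbrs p₀) (n13 : p₃ ∈ G.coNbrs p₁) (n14 : p₄ ∈ G.coNbrs p₁)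
    (n24 : p₄ ∈ G.coNbrs p₂) (hu0 : G.Adj u p₀) (hu1 : G.Adj u p₁) (hu2 : G.Adj u p₂)
    (hu3 : G.Adj u p₃) (hu4 : G.Adj u p₄) (hx : G.Adj x p₂) (nx0 : x ∈ G.coNbrs p₀)
    (nx1 : x ∈ G.coNbrs p₁) (nx3 : x ∈ G.coNbrs p₃) (nx4 : x ∈ G.coNbrs p₄)
    (nxu : x ∈ G.coNbrs u) : umbrella.IsIndContained G := by
  refine isIndContained_of_lt ![p₀, p₁, p₂, p₃, p₄, u, x] ?_
  have e1 := hu0.symm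
  have e2 := hu1.symm
  have e3 := hu2.symm
  have e4 := hu3.symm
  have e5 := hu4.symm
  have e6 := hx.symm
  intro a b hab
  fin_cases a <;> fin_cases b <;> first
    | exact absurd hab (by decide)
    | exact Or.inl ⟨by simp [umbrella], by assumption⟩
    | exact Or.inr ⟨by simp [umbrella], by assumption⟩

theorem cycleGraph_adj_iff_val {n : ℕ} {i j : Fin n} (hn : 2 ≤ n) : (cycleGraph n).Adj i j ↔
    (j.val = i.val + 1 ∨ (i.val + 1 = n ∧ j.val = 0)) ∨
      (i.val = j.val + 1 ∨ (j.val + 1 = n ∧ i.val = 0)) := by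
  have hi := i.isLt
  have hj := j.isLt
  rw [cycleGraph_adj']
  rcases lt_trichotomy i j with h | rfl | h
  · have h' : i.val < j.val := h
    rw [Fin.coe_sub_iff_lt.2 h, Fin.coe_sub_iff_le.2 h.le]
    omega
  · obtain ⟨m, rfl⟩ : ∃ m, n = m + 1 := ⟨n - 1, by omega⟩
    rw [sub_self, Fin.val_zero]
    omega
  · have h' : j.val < i.val := h
    rw [Fin.coe_sub_iff_lt.2 h, Fin.coe_sub_iff_le.2 h.le]
    omega

theorem isHole_of_embedding {n : ℕ} (hn : 4 ≤ n) (f : cycleGraph n ↪g G) :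
    ∃ c : ZMod n → V, G.IsHole n c ∧ ∀ i, ∃ j, c i = f j := by
  obtain ⟨m, rfl⟩ : ∃ m, n = m + 1 := ⟨n - 1, by omega⟩
  refine ⟨fun i => f ⟨i.val, i.val_lt⟩, ⟨hn, ?_, ?_⟩, fun i => ⟨_, rfl⟩⟩
  · intro i j hij
    have := f.injective hij
    exact ZMod.val_injective _ (by simpa using this)
  · intro i j
    rw [f.map_adj_iff, cycleGraph_adj_iff_val (by omega), zmod_eq_add_one_iff, zmod_eq_add_one_iff]
    simp only
    omega

theorem IsHole.exists_embedding {n : ℕ} {c : ZMod n → V} (hc : G.IsHole n c) :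
    ∃ f : cycleGraph n ↪g G, ∀ i, ∃ j, f i = c j := by
  have hn := hc.1
  obtain ⟨m, rfl⟩ : ∃ m, n = m + 1 := ⟨n - 1, by omega⟩
  have hval : ∀ i : Fin (m + 1), ((i.val : ℕ) : ZMod (m + 1)).val = i.val := fun i =>
    ZMod.val_cast_of_lt i.isLt
  refine ⟨⟨⟨fun i => c (i.val : ℕ), ?_⟩, ?_⟩, fun i => ⟨_, rfl⟩⟩
  · intro i j hij
    have := congrArg ZMod.val (hc.2.1 hij)
    rw [hval, hval] at this
    exact Fin.ext this
  · intro i j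
    have hi := i.isLt
    have hj := j.isLt
    change G.Adj (c _) (c _) ↔ _
    rw [hc.2.2, cycleGraph_adj_iff_val (by omega), zmod_eq_add_one_iff, zmod_eq_add_one_iff, hval,
      hval]
    omega

theorem IsHole.wheel_isIndContained {n : ℕ} {c : ZMod n → V} (hc : G.IsHole n c) {h : V}
    (hh : ∀ i, G.Adj h (c i)) : (wheel n).IsIndContained G := by
  obtain ⟨f, hf⟩ := hc.exists_embedding
  have hf' : ∀ i, G.Adj h (f i) := fun i => by
    obtain ⟨j, hj⟩ := hf i
    exact hj ▸ hh j
  refine isIndContained_of_map (fun x => x.elim h f) ?_ ?_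
  · rintro (_ | i) (_ | j)
    · simp [wheel]
    · simp [hf']
    · simp [(hf' i).symm]
    · simp [wheel, (cycleGraph n).adj_comm j i]
  · rintro (_ | i) (_ | j)
    · simp
    · simp [wheel]
    · simp [wheel]
    · intro hne had
      have hne' : i ≠ j := fun h => hne (h ▸ rfl)
      have had' : ¬ (cycleGraph n).Adj i j := fun h => had (by simp [wheel, hne', h])
      exact ⟨fun h => hne' (f.injective h).symm, fun h => had' (f.map_adj_iff.1 h)⟩

theorem IsIndPath.mem_coNbrs {k : ℕ} {q : ℕ → V} (h : G.IsIndPath k q) {i j : ℕ} (hi : i ≤ k)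
    (hj : j ≤ k) (h1 : i ≠ j) (h2 : j ≠ i + 1) (h3 : i ≠ j + 1) : q j ∈ G.coNbrs (q i) := by
  refine ⟨h.ne hj hi h1.symm, ?_⟩
  rw [h.adj_iff hi hj]
  omega

/-- An induced path whose interior is adjacent to both `u` and `v`, the first vertex to `u` and the
last one to `v` only, and a further vertex adjacent to `u` and `v` only. -/
theorem IsIndPath.risingSun_isIndContained {b : ℕ} {q : ℕ → V} (hq : G.IsIndPath (b + 1) q)
    (hb : 2 ≤ b) {u v x : V} (huv : G.Adj u v) (hxu : G.Adj x u) (hxv : G.Adj x v)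
    (hu : ∀ i ≤ b, G.Adj u (q i)) (hv : ∀ i, 1 ≤ i → i ≤ b + 1 → G.Adj v (q i))
    (nu : q (b + 1) ∈ G.coNbrs u) (nv : q 0 ∈ G.coNbrs v) (nx : ∀ i ≤ b + 1, q i ∈ G.coNbrs x) :
    (risingSun (b + 2)).IsIndContained G := by
  -- `u` and `v` are the two vertices joined to the whole path, `q 1, …, q b` is that path, and `q
  -- 0`, `q (b + 1)`, `x` are the three outer vertices.
  set f : Fin (b + 2) ⊕ Fin 3 → V := Sum.elim
    (fun i : Fin (b + 2) => if i.val = 0 then u else if i.val = b + 1 then v else q i.val)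
    ![q 0, q (b + 1), x] with hf
  have key : ∀ a c, a ≠ c → ((risingSun (b + 2)).Adj a c ∧ G.Adj (f a) (f c)) ∨
      (¬ (risingSun (b + 2)).Adj a c ∧ f c ∈ G.coNbrs (f a)) := by
    have hlr : ∀ (i : Fin (b + 2)) (k : Fin 3),
        ((risingSun (b + 2)).Adj (.inl i) (.inr k) ∧ G.Adj (f (.inl i)) (f (.inr k))) ∨
        (¬ (risingSun (b + 2)).Adj (.inl i) (.inr k) ∧
          f (.inr k) ∈ G.coNbrs (f (.inl i))) := by
      intro i k
      have hi := i.isLt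
      fin_cases k
      · have hr : (risingSun (b + 2)).Adj (.inl i) (.inr 0) ↔ i.val = 0 ∨ i.val = 1 := by
          simp [risingSun]
        change ((risingSun (b + 2)).Adj (.inl i) (.inr 0) ∧ G.Adj (ite _ _ _) (q 0)) ∨
          (¬ (risingSun (b + 2)).Adj (.inl i) (.inr 0) ∧ q 0 ∈ G.coNbrs (ite _ _ _))
        rw [hr]
        split_ifs with h1 h2
        · exact Or.inl ⟨Or.inl h1, hu 0 (by omega)⟩
        · exact Or.inr ⟨by omega, nv⟩
        · by_cases h3 : i.val = 1
          · rw [h3]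
            exact Or.inl ⟨Or.inr rfl, (hq.adj (by omega)).symm⟩
          · exact Or.inr ⟨by omega, hq.mem_coNbrs (by omega) (by omega) h1 (by omega) (by omega)⟩
      · have hr : (risingSun (b + 2)).Adj (.inl i) (.inr 1) ↔ i.val = b ∨ i.val = b + 1 := by
          simp [risingSun]
        change ((risingSun (b + 2)).Adj (.inl i) (.inr 1) ∧ G.Adj (ite _ _ _) (q (b + 1))) ∨
          (¬ (risingSun (b + 2)).Adj (.inl i) (.inr 1) ∧ q (b + 1) ∈ G.coNbrs (ite _ _ _))
        rw [hr]
        split_ifs with h1 h2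
        · exact Or.inr ⟨by omega, nu⟩
        · exact Or.inl ⟨Or.inr h2, hv _ (by omega) le_rfl⟩
        · by_cases h3 : i.val = b
          · rw [h3]
            exact Or.inl ⟨Or.inl rfl, hq.adj (by omega)⟩
          · exact Or.inr ⟨by omega,
              hq.mem_coNbrs (by omega) (by omega) (by omega) (by omega) (by omega)⟩
      · have hr : (risingSun (b + 2)).Adj (.inl i) (.inr 2) ↔ i.val = b + 1 ∨ i.val = 0 := by
          simp [risingSun]
        change ((risingSun (b + 2)).Adj (.inl i) (.inr 2) ∧ G.Adj (ite _ _ _) x) ∨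
          (¬ (risingSun (b + 2)).Adj (.inl i) (.inr 2) ∧ x ∈ G.coNbrs (ite _ _ _))
        rw [hr]
        split_ifs with h1 h2
        · exact Or.inl ⟨Or.inr h1, hxu.symm⟩
        · exact Or.inl ⟨Or.inl h2, hxv.symm⟩
        · exact Or.inr ⟨by omega, coNbrs_comm.1 (nx _ (by omega))⟩
    rintro (i | i) (j | j) hij
    · have hi := i.isLt
      have hj := j.isLt
      have hij' : i.val ≠ j.val := fun h => hij (congrArg Sum.inl (Fin.ext h))
      have hr : (risingSun (b + 2)).Adj (.inl i) (.inl j) ↔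
          (i.val + 1 = j.val ∨ i.val = 0 ∨ i.val = b + 1) ∨
            (j.val + 1 = i.val ∨ j.val = 0 ∨ j.val = b + 1) := by
        rw [risingSun, SimpleGraph.fromRel_adj, ne_eq, Sum.inl.injEq, Fin.ext_iff]
        dsimp only
        omega
      change ((risingSun (b + 2)).Adj (.inl i) (.inl j) ∧ G.Adj (ite _ _ _) (ite _ _ _)) ∨
        (¬ (risingSun (b + 2)).Adj (.inl i) (.inl j) ∧ (ite _ _ _) ∈ G.coNbrs (ite _ _ _))
      rw [hr]
      split_ifs with h1 h2 h3 h4 h5 h6 h7 h8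
      · omega
      · exact Or.inl ⟨by omega, huv⟩
      · exact Or.inl ⟨by omega, hu _ (by omega)⟩
      · exact Or.inl ⟨by omega, huv.symm⟩
      · omega
      · exact Or.inl ⟨by omega, hv _ (by omega) (by omega)⟩
      · exact Or.inl ⟨by omega, (hu _ (by omega)).symm⟩
      · exact Or.inl ⟨by omega, (hv _ (by omega) (by omega)).symm⟩
      · by_cases h9 : i.val + 1 = j.val ∨ j.val + 1 = i.val
        · exact Or.inl ⟨by omega, (hq.adj_iff (by omega) (by omega)).2 (by omega)⟩
        · exact Or.inr ⟨by omega,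
            hq.mem_coNbrs (by omega) (by omega) hij' (by omega) (by omega)⟩
    · exact hlr i j
    · rcases hlr j i with h | h
      · exact Or.inl ⟨h.1.symm, h.2.symm⟩
      · exact Or.inr ⟨fun h' => h.1 h'.symm, coNbrs_comm.1 h.2⟩
    · have h01 := hq.mem_coNbrs (i := 0) (j := b + 1) (by omega) le_rfl (by omega) (by omega)
        (by omega)
      have h10 := coNbrs_comm.1 h01
      have h02 := nx 0 (by omega)
      have h12 := nx (b + 1) le_rfl
      have h20 := coNbrs_comm.1 h02
      have h21 := coNbrs_comm.1 h12
      right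
      constructor
      · simp [risingSun]
      · fin_cases i <;> fin_cases j <;> first
          | exact absurd rfl hij
          | assumption
  refine isIndContained_of_map f (fun a c h => ?_) (fun a c hne h => ?_)
  · exact ((key a c h.ne).resolve_right fun h' => h'.1 h).2
  · exact ((key a c hne).resolve_left fun h' => h h'.1).2

end Forbidden

end SimpleGraph

/-! ### Shortest holes -/

namespace SimpleGraph

section ShortHole

variable {V : Type*} {G : SimpleGraph V}

theorem IsHole.small_ne_zero {n : ℕ} {c : ZMod n → V} (h : G.IsHole n c) :
    (1 : ZMod n) ≠ 0 ∧ (2 : ZMod n) ≠ 0 ∧ (3 : ZMod n) ≠ 0 := by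
  refine ⟨?_, ?_, ?_⟩
  · exact_mod_cast h.cast_ne_zero (k := 1) (by omega) (by omega)
  · exact_mod_cast h.cast_ne_zero (k := 2) (by omega) (by omega)
  · exact_mod_cast h.cast_ne_zero (k := 3) (by omega) (by omega)

theorem IsHole.isIndPath {n : ℕ} {c : ZMod n → V} (h : G.IsHole n c) (i : ZMod n) :
    G.IsIndPath (n - 2) (fun l => c (i + (l : ℕ))) := by
  have hn := h.1
  intro a b hab hb
  have hkey : ∀ d : ℕ, 0 < d → d < n → a + d ≠ b → i + (b : ℕ) ≠ i + (a : ℕ) + d := by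
    intro d hd hdn hne heq
    have h1 : ((b - a : ℕ) : ZMod n) = (d : ℕ) := by
      rw [Nat.cast_sub hab.le]
      linear_combination heq
    rw [ZMod.natCast_eq_natCast_iff', Nat.mod_eq_of_lt (by omega), Nat.mod_eq_of_lt hdn] at h1
    omega
  have hne : c (i + (a : ℕ)) ≠ c (i + (b : ℕ)) := by
    intro heq
    have h1 := h.2.1 heq
    have h2 : ((b - a : ℕ) : ZMod n) = 0 := by
      rw [Nat.cast_sub hab.le]
      linear_combination -h1
    rw [ZMod.natCast_eq_zero_iff] at h2
    exact absurd (Nat.le_of_dvd (by omega) h2) (by omega)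
  refine ⟨hne, ?_⟩
  dsimp only
  rw [h.2.2]
  constructor
  · rintro (h1 | h1)
    · by_contra hba
      exact hkey 1 (by omega) (by omega) (by omega) (by rw [h1]; push_cast; ring)
    · by_contra hba
      refine hkey (n - 1) (by omega) (by omega) (by omega) ?_
      rw [Nat.cast_sub (by omega), h1]
      simp
  · rintro rfl
    left
    push_cast
    ring

/-- A vertex that misses a vertex of a shortest hole meets at most three consecutive ones. -/
theorem IsHole.exists_hits {n : ℕ} {c : ZMod n → V} (h : G.IsHole n c)
    (hmin : ∀ m (d : ZMod m → V), G.IsHole m d → n ≤ m) {A : V} {m : ZMod n}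
    (hm : c m ∈ G.coNbrs A) :
    ∃ k, ∀ j, c j ∉ G.coNbrs A → j = k ∨ j = k + 1 ∨ j = k + 2 := by
  classical
  by_cases hA : ∃ l, A = c l
  · obtain ⟨l, rfl⟩ := hA
    refine ⟨l - 1, fun j hj => ?_⟩
    rcases notMem_coNbrs.1 hj with h1 | h1
    · right; left
      rw [h.2.1 h1]
      ring
    · rcases (h.2.2 _ _).1 h1 with h1 | h1
      · right; right
        rw [h1]
        ring
      · left
        rw [h1]
        ring
  have hn := h.1
  by_cases hit : ∃ i, c i ∉ G.coNbrs A
  swap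
  · exact ⟨0, fun j hj => absurd ⟨j, hj⟩ hit⟩
  -- `i` is a hit followed by a miss; `g` below is the distance from `i` to the next hit.
  obtain ⟨i, hi, hi1⟩ : ∃ i, c i ∉ G.coNbrs A ∧ c (i + 1) ∈ G.coNbrs A := by
    by_contra hcon
    push Not at hcon
    obtain ⟨i, hi⟩ := hit
    have : ∀ l : ℕ, c (i + (l : ℕ)) ∉ G.coNbrs A := by
      intro l
      induction l with
      | zero => simpa using hi
      | succ l ih =>
        have := hcon _ ih
        rwa [show i + ((l + 1 : ℕ) : ZMod n) = i + (l : ℕ) + 1 by push_cast; ring]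
    have hz : NeZero n := ⟨by omega⟩
    exact this (m - i).val (by simpa using hm)
  have hex : ∃ g : ℕ, 1 ≤ g ∧ c (i + (g : ℕ)) ∉ G.coNbrs A := ⟨n, by omega, by simpa using hi⟩
  obtain ⟨hg1, hg⟩ := Nat.find_spec hex
  have hgm : ∀ l : ℕ, 1 ≤ l → l < Nat.find hex → c (i + (l : ℕ)) ∈ G.coNbrs A := fun l h1 h2 => by
    by_contra h3
    exact Nat.find_min hex h2 ⟨h1, h3⟩
  generalize Nat.find hex = g at *
  have hg2 : 2 ≤ g := by
    by_contra h2
    have : g = 1 := by omega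
    exact hg (by simpa [this] using hi1)
  have hadj : ∀ {j}, c j ∉ G.coNbrs A → G.Adj A (c j) := fun hj =>
    (notMem_coNbrs.1 hj).resolve_left fun h' => hA ⟨_, h'.symm⟩
  -- A shorter gap would be closed by `A` to a hole of length `g + 2 < n`. So every hit is at `i -
  -- 2`, `i - 1` or `i`.
  have hgn : n - 2 ≤ g := by
    by_contra hlt
    obtain ⟨d, hd, -⟩ := ((h.isIndPath i).sub (i := 0) (l := g) (by omega)).exists_isHole hg2
      (a := A) (by simpa using hadj hi) (by simpa using hadj hg)
      (fun l h1 h2 => by simpa using hgm l h1 h2)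
    have := hmin _ _ hd
    omega
  refine ⟨i - 2, fun j hj => ?_⟩
  have : NeZero n := ⟨by omega⟩
  have hv := (j - i).val_lt
  have hji : j = i + ((j - i).val : ℕ) := by simp
  rcases Nat.eq_zero_or_pos (j - i).val with h0 | h0
  · right; right
    rw [h0] at hji
    rw [hji]
    push_cast
    ring
  · have hge : g ≤ (j - i).val := by
      by_contra hlt
      exact (hji ▸ hj) (hgm _ h0 (by omega))
    have : (j - i).val = n - 2 ∨ (j - i).val = n - 1 := by omega
    rcases this with h2 | h2
    · left
      rw [hji, h2, Nat.cast_sub (by omega)]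
      simp
      ring
    · right; left
      rw [hji, h2, Nat.cast_sub (by omega)]
      simp
      ring

/-- Replacing the middle one of three consecutive vertices of a hole. -/
theorem IsHole.update {n : ℕ} {c : ZMod n → V} (h : G.IsHole n c) {A : V} {k : ZMod n}
    (hk : ∀ j, c j ∉ G.coNbrs A → j = k ∨ j = k + 1 ∨ j = k + 2) (h0 : c k ∉ G.coNbrs A)
    (h2 : c (k + 2) ∉ G.coNbrs A) : G.IsHole n (Function.update c (k + 1) A) := by
  obtain ⟨z1, z2, z3⟩ := h.small_ne_zero
  have hne : ∀ l, l ≠ k + 1 → A ≠ c l := by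
    intro l hl heq
    rcases hk l (notMem_coNbrs.2 (Or.inl heq.symm)) with rfl | rfl | rfl
    · exact h2 (heq ▸ h.mem_coNbrs_add_two l)
    · exact hl rfl
    · exact h0 (heq ▸ coNbrs_comm.1 (h.mem_coNbrs_add_two k))
  have hadj : ∀ l, l ≠ k + 1 → (G.Adj A (c l) ↔ l = k ∨ l = k + 2) := by
    intro l hl
    constructor
    · intro had
      have := hk l (notMem_coNbrs.2 (Or.inr had))
      tauto
    · rintro (rfl | rfl)
      · exact (notMem_coNbrs.1 h0).resolve_left (hne _ hl).symm
      · exact (notMem_coNbrs.1 h2).resolve_left (hne _ hl).symm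
  refine ⟨h.1, ?_, ?_⟩
  · intro i j hij
    by_cases hi : i = k + 1 <;> by_cases hj : j = k + 1
    · rw [hi, hj]
    · subst hi
      rw [Function.update_self, Function.update_of_ne hj] at hij
      exact absurd hij (hne j hj)
    · subst hj
      rw [Function.update_self, Function.update_of_ne hi] at hij
      exact absurd hij.symm (hne i hi)
    · rw [Function.update_of_ne hi, Function.update_of_ne hj] at hij
      exact h.2.1 hij
  · intro i j
    by_cases hi : i = k + 1 <;> by_cases hj : j = k + 1
    · subst hi hj
      simp [z1]
    · subst hi
      rw [Function.update_self, Function.update_of_ne hj, hadj j hj]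
      grind
    · subst hj
      rw [Function.update_self, Function.update_of_ne hi, G.adj_comm, hadj i hi]
      grind
    · rw [Function.update_of_ne hi, Function.update_of_ne hj]
      exact h.2.2 i j

end ShortHole

end SimpleGraph

/-! ### Covering triples and wheels -/

namespace CircularArcModel

variable {M : CircularArcModel}

/-- A pairwise intersecting triple of arcs that covers the circle. -/
def IsCoveringTriple (A B C : {A : CircArc // A ∈ M.arcs}) : Prop :=
  B ∉ M.graph.coNbrs A ∧ C ∉ M.graph.coNbrs A ∧ C ∉ M.graph.coNbrs B ∧
    ∀ q, q ∈ A.1.points ∨ q ∈ B.1.points ∨ q ∈ C.1.points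

theorem IsCoveringTriple.rotate {A B C : {A : CircArc // A ∈ M.arcs}}
    (h : M.IsCoveringTriple A B C) : M.IsCoveringTriple B C A := by
  obtain ⟨h1, h2, h3, h4⟩ := h
  refine ⟨h3, fun h => h1 (coNbrs_comm.1 h), fun h => h2 (coNbrs_comm.1 h), fun q => ?_⟩
  have := h4 q
  tauto

theorem IsCoveringTriple.swap {A B C : {A : CircArc // A ∈ M.arcs}}
    (h : M.IsCoveringTriple A B C) : M.IsCoveringTriple A C B := by
  obtain ⟨h1, h2, h3, h4⟩ := h
  refine ⟨h2, h1, fun h => h3 (coNbrs_comm.1 h), fun q => ?_⟩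
  have := h4 q
  tauto

/-- A common point of `u` and `v` is covered by one of the three arcs. With `u = v` this is
domination. -/
theorem IsCoveringTriple.hit {A B C : {A : CircArc // A ∈ M.arcs}} (h : M.IsCoveringTriple A B C)
    {u v : {A : CircArc // A ∈ M.arcs}} (huv : v ∉ M.graph.coNbrs u) :
    (u ∉ M.graph.coNbrs A ∧ v ∉ M.graph.coNbrs A) ∨
      (u ∉ M.graph.coNbrs B ∧ v ∉ M.graph.coNbrs B) ∨
      (u ∉ M.graph.coNbrs C ∧ v ∉ M.graph.coNbrs C) := by
  obtain ⟨q, hu, hv⟩ := notMem_coNbrs_iff.1 huv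
  simp only [notMem_coNbrs_iff]
  rcases h.2.2.2 q with h | h | h
  · exact Or.inl ⟨⟨q, h, hu⟩, ⟨q, h, hv⟩⟩
  · exact Or.inr (Or.inl ⟨⟨q, h, hu⟩, ⟨q, h, hv⟩⟩)
  · exact Or.inr (Or.inr ⟨⟨q, h, hu⟩, ⟨q, h, hv⟩⟩)

theorem exists_common_hit {n : ℕ} {c : ZMod n → {A : CircArc // A ∈ M.arcs}}
    (hc : M.graph.IsHole n c) {A B : {A : CircArc // A ∈ M.arcs}} (h : B ∉ M.graph.coNbrs A) :
    ∃ i, c i ∉ M.graph.coNbrs A ∧ c i ∉ M.graph.coNbrs B := by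
  obtain ⟨q, hA, hB⟩ := notMem_coNbrs_iff.1 h
  obtain ⟨i, hi⟩ := cover_of_isHole hc q
  exact ⟨i, notMem_coNbrs_iff.2 ⟨q, hA, hi⟩, notMem_coNbrs_iff.2 ⟨q, hB, hi⟩⟩

/-- The remaining arc of a covering triple with two consecutive arcs on a hole meets all arcs of
the hole. -/
theorem IsCoveringTriple.hits_all {n : ℕ} {c : ZMod n → {A : CircArc // A ∈ M.arcs}}
    (hc : M.graph.IsHole n c) {C : {A : CircArc // A ∈ M.arcs}} {j : ZMod n}
    (h : M.IsCoveringTriple (c j) (c (j + 1)) C) (m : ZMod n) : c m ∉ M.graph.coNbrs C := by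
  have hco : ∀ i l, l ≠ i → l ≠ i + 1 → i ≠ l + 1 → c l ∈ M.graph.coNbrs (c i) := by
    intro i l h1 h2 h3
    refine ⟨fun h => h1 (hc.2.1 h), fun h => ?_⟩
    rcases (hc.2.2 _ _).1 h with h | h
    · exact h2 h
    · exact h3 h
  have hself : ∀ u, u ∉ M.graph.coNbrs u := fun u h => h.1 rfl
  obtain ⟨z1, z2, z3⟩ := hc.small_ne_zero
  by_cases e0 : m = j
  · subst e0
    exact fun h' => h.2.1 (coNbrs_comm.1 h')
  by_cases e1 : m = j + 1
  · subst e1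
    exact fun h' => h.2.2.1 (coNbrs_comm.1 h')
  by_cases e2 : m = j + 2
  -- `c (j + 1)` meets `c m`, so the vertex alone says nothing. Of the three arcs only `C` can meet
  -- both `c m` and the next arc `c (m + 1)`.
  · have hadj : c (m + 1) ∉ M.graph.coNbrs (c m) :=
      notMem_coNbrs.2 (Or.inr ((hc.2.2 _ _).2 (Or.inl rfl)))
    rcases h.hit hadj with h' | h' | h'
    · exact absurd (hco _ _ (by grind) (by grind) (by grind)) h'.1
    · exact absurd (hco _ _ (by grind) (by grind) (by grind)) h'.2
    · exact h'.1
  by_cases e3 : j = m + 1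
  · have hadj : c (m - 1) ∉ M.graph.coNbrs (c m) :=
      notMem_coNbrs.2 (Or.inr ((hc.2.2 _ _).2 (Or.inr (by ring))))
    rcases h.hit hadj with h' | h' | h'
    · exact absurd (hco _ _ (by grind) (by grind) (by grind)) h'.2
    · exact absurd (hco _ _ (by grind) (by grind) (by grind)) h'.1
    · exact h'.1
  rcases h.hit (hself (c m)) with h' | h' | h'
  · exact absurd (hco _ _ e0 e1 e3) h'.1
  · exact absurd (hco _ _ e1 (by grind) (by grind)) h'.1
  · exact h'.1

/-- A hole and a covering triple yield a wheel. -/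
theorem exists_wheel_of_isCoveringTriple {A B C : {A : CircArc // A ∈ M.arcs}}
    (hT : M.IsCoveringTriple A B C) (hH : ¬ M.graph.HoleFree) :
    ∃ n, 4 ≤ n ∧ (wheel n).IsIndContained M.graph := by
  classical
  by_contra hW
  push Not at hW
  have hex : ∃ n, ∃ c : ZMod n → {A : CircArc // A ∈ M.arcs}, M.graph.IsHole n c := by
    by_contra hcon
    push Not at hcon
    exact hH hcon
  obtain ⟨c, hc⟩ := Nat.find_spec hex
  have hmin : ∀ m (d : ZMod m → {A : CircArc // A ∈ M.arcs}), M.graph.IsHole m d →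
      Nat.find hex ≤ m := fun m d hd => Nat.find_min' hex ⟨d, hd⟩
  generalize Nat.find hex = n at *
  obtain ⟨z1, z2, z3⟩ := hc.small_ne_zero
  have hits : ∀ (c : ZMod n → {A : CircArc // A ∈ M.arcs}), M.graph.IsHole n c → ∀ A,
      ∃ k, ∀ j, c j ∉ M.graph.coNbrs A → j = k ∨ j = k + 1 ∨ j = k + 2 := by
    intro c hc A
    by_cases hA : ∃ m, c m ∈ M.graph.coNbrs A
    · obtain ⟨m, hm⟩ := hA
      exact hc.exists_hits hmin hm
    · push Not at hA
      exfalso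
      refine hW n hc.1 (hc.wheel_isIndContained (h := A) fun i => ?_)
      refine (notMem_coNbrs.1 (hA i)).resolve_left ?_
      rintro rfl
      exact hA _ (hc.mem_coNbrs_add_two i)
  have hself : ∀ u, u ∉ M.graph.coNbrs u := fun u h => h.1 rfl
  -- The third arc would meet the whole hole, whereas without wheels an arc meets at most three
  -- consecutive arcs of a shortest hole.
  have no_consecutive : ∀ (c : ZMod n → {A : CircArc // A ∈ M.arcs}), M.graph.IsHole n c → ∀ j D,
      M.IsCoveringTriple (c j) (c (j + 1)) D → False := by
    intro c hc j D hT
    obtain ⟨k, hk⟩ := hits c hc D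
    have := hk (k + 3) (hT.hits_all hc _)
    obtain ⟨z1, z2, z3⟩ := hc.small_ne_zero
    clear * - z1 z2 z3 this
    simp only [← two_add_one_eq_three, ← one_add_one_eq_two] at *
    generalize (1 : ZMod n) = o at *
    grind
  -- `E` meets `c j` and `c (j + 2)`, so it can replace the arc between them. The new hole is as
  -- short and has two consecutive arcs of the triple.
  have no_arc_and_second : ∀ (c : ZMod n → {A : CircArc // A ∈ M.arcs}), M.graph.IsHole n c → ∀ j E D,
      M.IsCoveringTriple (c j) E D → c (j + 2) ∉ M.graph.coNbrs E → False := by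
    intro c hc j E D hT hE
    obtain ⟨k, hk⟩ := hits c hc E
    have hE' : c j ∉ M.graph.coNbrs E := fun h => hT.1 (coNbrs_comm.1 h)
    have hcase : (j = k) ∨ (j = k + 2 ∧ j + 2 = k) := by
      have h1 := hk _ hE
      have h2 := hk _ hE'
      clear * - z1 z2 z3 h1 h2
      simp only [← two_add_one_eq_three, ← one_add_one_eq_two] at *
      generalize (1 : ZMod n) = o at *
      grind
    rcases hcase with rfl | ⟨h1, h2⟩
    · have hc' := hc.update hk hE' hE
      refine no_consecutive _ hc' j D ?_
      rwa [Function.update_self, Function.update_of_ne (by simpa using z1)]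
    · subst h1
      rw [h2] at hE
      have hc' := hc.update hk hE hE'
      refine no_consecutive _ hc' (k + 1) D ?_
      have hk2 : k + 1 + 1 ≠ k + 1 := by simpa using z1
      rw [Function.update_self, Function.update_of_ne hk2,
        show k + 1 + 1 = k + 2 by ring]
      exact hT.rotate.swap
  have no_arc_on_hole : ∀ (c : ZMod n → {A : CircArc // A ∈ M.arcs}), M.graph.IsHole n c → ∀ j E D,
      M.IsCoveringTriple (c j) E D → False := by
    intro c hc j E D hT
    rcases hT.hit (hself (c (j + 2))) with h | h | h
    · exact h.1 (hc.mem_coNbrs_add_two j)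
    · exact no_arc_and_second c hc j E D hT h.1
    · exact no_arc_and_second c hc j D E hT.swap h.1
  -- An arc of the triple meeting both ends of three consecutive arcs could replace the middle one,
  -- placing an arc of the triple on a hole.
  have narrow : ∀ A B C, M.IsCoveringTriple A B C →
      ∃ k, ∀ j, c j ∉ M.graph.coNbrs A → j = k ∨ j = k + 1 := by
    intro A B C hT
    obtain ⟨k, hk⟩ := hits c hc A
    by_cases h0 : c k ∈ M.graph.coNbrs A
    · refine ⟨k + 1, fun j hj => ?_⟩
      rcases hk j hj with rfl | h | h
      · exact absurd h0 hj
      · exact Or.inl h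
      · exact Or.inr (by rw [h]; ring)
    by_cases h2 : c (k + 2) ∈ M.graph.coNbrs A
    · refine ⟨k, fun j hj => ?_⟩
      rcases hk j hj with h | h | rfl
      · exact Or.inl h
      · exact Or.inr h
      · exact absurd h2 hj
    · exfalso
      refine no_arc_on_hole _ (hc.update hk h0 h2) (k + 1) B C ?_
      rwa [Function.update_self]
  -- Each arc of the triple now meets at most two consecutive arcs of the hole. If `A` is confined
  -- to `k, k + 1`, then `B` is confined to `k + 1, k + 2`. Meeting `C` on the hole as well, these
  -- leave no arc of the triple for `c (k + 3)`.
  have final : ∀ A B C, M.IsCoveringTriple A B C → ∀ k,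
      (∀ j, c j ∉ M.graph.coNbrs A → j = k ∨ j = k + 1) → c (k + 2) ∉ M.graph.coNbrs B →
      False := by
    intro A B C hT k hk hB
    obtain ⟨l, hl⟩ := narrow B C A hT.rotate
    obtain ⟨m, hm⟩ := narrow C A B hT.rotate.rotate
    obtain ⟨x, hx1, hx2⟩ := exists_common_hit hc hT.1
    obtain ⟨y, hy1, hy2⟩ := exists_common_hit hc hT.2.1
    obtain ⟨w, hw1, hw2⟩ := exists_common_hit hc hT.2.2.1
    have e1 := hl _ hB
    have e2 := hk _ hx1
    have e3 := hl _ hx2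
    have e4 : l = k + 1 := by
      clear * - z1 z2 z3 e1 e2 e3
      simp only [← two_add_one_eq_three, ← one_add_one_eq_two] at *
      generalize (1 : ZMod n) = o at *
      grind
    subst e4
    have e5 := hk _ hy1
    have e6 := hm _ hy2
    have e7 := hl _ hw1
    have e8 := hm _ hw2
    rcases hT.hit (hself (c (k + 3))) with h | h | h
    · have := hk _ h.1
      clear * - z1 z2 z3 e1 e2 e3 e5 e6 e7 e8 this
      simp only [← two_add_one_eq_three, ← one_add_one_eq_two] at *
      generalize (1 : ZMod n) = o at *
      grind
    · have := hl _ h.1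
      clear * - z1 z2 z3 e1 e2 e3 e5 e6 e7 e8 this
      simp only [← two_add_one_eq_three, ← one_add_one_eq_two] at *
      generalize (1 : ZMod n) = o at *
      grind
    · have := hm _ h.1
      clear * - z1 z2 z3 e1 e2 e3 e5 e6 e7 e8 this
      simp only [← two_add_one_eq_three, ← one_add_one_eq_two] at *
      generalize (1 : ZMod n) = o at *
      grind
  obtain ⟨k, hk⟩ := narrow A B C hT
  rcases hT.hit (hself (c (k + 2))) with h | h | h
  · have := hk _ h.1
    clear * - z1 z2 z3 this
    simp only [← two_add_one_eq_three, ← one_add_one_eq_two] at *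
    generalize (1 : ZMod n) = o at *
    grind
  · exact final A B C hT k hk h.1
  · exact final A C B hT.swap k hk h.1

end CircularArcModel

/-! ### Consequences of dominating cliques -/

namespace SimpleGraph

section Triples

variable {V : Type*} {G : SimpleGraph V}

/-- Every asteroidal triple has a dominating clique among the vertices that witness it. -/
def HasDominatingCliques (G : SimpleGraph V) : Prop :=
  ∀ C x y z, G.IsAT C x y z → ∃ T ⊆ C, G.IsClique T ∧ ∀ v, ∃ u ∈ T, v ∉ G.coNbrs u

/-- The graph contains a 3-sun, a tent, an umbrella or a rising sun. -/
def HasSunTentUmbrella (G : SimpleGraph V) : Prop :=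
  threeSun.IsIndContained G ∨ tent.IsIndContained G ∨ umbrella.IsIndContained G ∨
    ∃ n, 4 ≤ n ∧ (risingSun n).IsIndContained G

theorem HoleFree.exists_interval (hG : G.HoleFree) {k : ℕ} {q : ℕ → V} (hq : G.IsIndPath k q)
    {a : V} (ha : ∀ i ≤ k, a ≠ q i) (h : ∃ i ≤ k, G.Adj a (q i)) :
    ∃ e f, e ≤ f ∧ f ≤ k ∧ ∀ i ≤ k, G.Adj a (q i) ↔ e ≤ i ∧ i ≤ f := by
  classical
  obtain ⟨he, hea⟩ := Nat.find_spec h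
  obtain ⟨i, hi, hia⟩ := id h
  have h' : ∃ i, i ≤ k ∧ G.Adj a (q (k - i)) :=
    ⟨k - i, by omega, by rwa [show k - (k - i) = i by omega]⟩
  obtain ⟨hf, hfa⟩ := Nat.find_spec h'
  have h1 : ∀ i ≤ k, G.Adj a (q i) → Nat.find h ≤ i := fun i hi hia => Nat.find_min' h ⟨hi, hia⟩
  have h2 : ∀ i ≤ k, G.Adj a (q i) → i ≤ k - Nat.find h' := fun i hi hia => by
    have := Nat.find_min' h' (m := k - i) ⟨by omega, by rwa [show k - (k - i) = i by omega]⟩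
    omega
  refine ⟨Nat.find h, k - Nat.find h', h1 _ (by omega) hfa, by omega, fun i hi => ⟨fun hia =>
    ⟨h1 i hi hia, h2 i hi hia⟩, fun hi' =>
    hG.adj_of_between hq ha hea hfa hi'.1 hi'.2 (by omega)⟩⟩

/-- For `b = 1` the configuration is a 3-sun, the degenerate case of a rising sun. -/
theorem IsIndPath.exists_isSun {b : ℕ} {q : ℕ → V} (hq : G.IsIndPath (b + 1) q) (hb : 1 ≤ b)
    {u v x : V} (huv : G.Adj u v) (hxu : G.Adj x u) (hxv : G.Adj x v)
    (hu : ∀ i ≤ b, G.Adj u (q i)) (hv : ∀ i, 1 ≤ i → i ≤ b + 1 → G.Adj v (q i))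
    (nu : q (b + 1) ∈ G.coNbrs u) (nv : q 0 ∈ G.coNbrs v) (nx : ∀ i ≤ b + 1, q i ∈ G.coNbrs x) :
    G.HasSunTentUmbrella := by
  rcases hb.eq_or_lt with rfl | hb
  · exact Or.inl (threeSun_isIndContained (v₀ := u) (v₁ := q 1) (v₂ := v) (w₀ := q 0) (w₁ := q 2)
      (w₂ := x) (hu 1 le_rfl) (hv 1 le_rfl (by omega)).symm huv (hu 0 (by omega))
      (hq.adj (i := 0) (by omega)).symm (hq.adj (i := 1) (by omega)) (hv 2 (by omega) le_rfl)
      hxv.symm hxu.symm nv nu (coNbrs_comm.1 (nx 1 (by omega)))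
      (hq.mem_coNbrs (by omega) (by omega) (by omega) (by omega) (by omega))
      (coNbrs_comm.1 (nx 0 (by omega))) (coNbrs_comm.1 (nx 2 (by omega))))
  · exact Or.inr (Or.inr (Or.inr ⟨b + 2, by omega,
      hq.risingSun_isIndContained hb huv hxu hxv hu hv nu nv nx⟩))

/-- Two neighbours `u`, `v` of `x`, with the private neighbours `y` and `z` connected away from
`x`. -/
theorem HoleFree.exists_isSun (hG : G.HoleFree) {u v x y z : V} (hxu : G.Adj x u) (hxv : G.Adj x v)
    (hyx : y ∈ G.coNbrs x) (hyz : G.ReachIn (G.coNbrs x) y z) (huy : G.Adj u y) (hvz : G.Adj v z)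
    (huz : z ∈ G.coNbrs u) (hvy : y ∈ G.coNbrs v) : G.HasSunTentUmbrella := by
  have huv : G.Adj u v := by
    refine hG.chord hxu hxv ?_ huy hvz hyx hyz
    rintro rfl
    exact huz.2 hvz
  obtain ⟨k, q, hq, h0, hk, hqx⟩ := hyz.exists_indPath hyx
  have hne : ∀ w, G.Adj x w → ∀ i ≤ k, w ≠ q i := fun w hw i hi h => (hqx i hi).2 (h ▸ hw)
  obtain ⟨e, j, hej, hjk, hu⟩ := hG.exists_interval hq (hne u hxu) ⟨0, by omega, h0 ▸ huy⟩
  obtain ⟨i, f, hif, hfk, hv⟩ := hG.exists_interval hq (hne v hxv) ⟨k, le_rfl, hk ▸ hvz⟩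
  have he0 : e = 0 := by
    have := (hu 0 (by omega)).1 (h0 ▸ huy)
    omega
  have hfk' : f = k := by
    have := (hv k le_rfl).1 (hk ▸ hvz)
    omega
  subst he0 hfk'
  have hjk : j < f := by
    by_contra h
    exact huz.2 (hk ▸ (hu f le_rfl).2 (by omega))
  have hi0 : 0 < i := by
    by_contra h
    exact hvy.2 (h0 ▸ (hv 0 (by omega)).2 (by omega))
  have hco : ∀ l, j < l → l ≤ f → q l ∈ G.coNbrs u := fun l h1 h2 =>
    ⟨(hne u hxu l h2).symm, fun h => by have := (hu l h2).1 h; omega⟩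
  -- `u` sees `q 0, …, q j` and `v` sees `q i, …, q f`. If these stretches did not overlap, `q j`
  -- and `v` would violate the chord property at `u`.
  have hij : i ≤ j := by
    have := hG.chord (a := u) (s := q j) (s' := v) (d := q (j + 1)) (d' := z)
      ((hu j (by omega)).2 ⟨by omega, le_rfl⟩) huv (hne v hxv j (by omega)).symm
      (hq.adj hjk) hvz (hco _ (by omega) (by omega))
      (hk ▸ hq.reachIn (by omega) le_rfl fun l h1 h2 => hco l (by omega) h2)
    exact ((hv j (by omega)).1 this.symm).1
  have hco' : q (i - 1) ∈ G.coNbrs v :=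
    ⟨(hne v hxv _ (by omega)).symm, fun h => by have := (hv (i - 1) (by omega)).1 h; omega⟩
  -- The overlap, with one further vertex on each side, is the path of the sun.
  have hq' := hq.sub (i := i - 1) (l := (j - i + 1) + 1) (by omega)
  refine hq'.exists_isSun (by omega) huv hxu hxv ?_ ?_ ?_ ?_ ?_
  · intro l hl
    exact (hu _ (by omega)).2 (by omega)
  · intro l h1 h2
    exact (hv _ (by omega)).2 (by omega)
  · exact hco _ (by omega) (by omega)
  · simpa using hco'
  · intro l hl
    exact hqx _ (by omega)

/-- A vertex `c` adjacent to the interior of an induced path with a pendant neighbour `x`. -/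
theorem HasDominatingCliques.tent_of_net (hD : G.HasDominatingCliques) {k : ℕ} {q : ℕ → V}
    (hk : 2 ≤ k) (hq : G.IsIndPath (k + 1) q) {c x : V}
    (hc : ∀ i, 1 ≤ i → i ≤ k → G.Adj c (q i)) (h0 : q 0 ∈ G.coNbrs c)
    (hk1 : q (k + 1) ∈ G.coNbrs c) (hcx : G.Adj c x) (hx : ∀ i ≤ k + 1, q i ∈ G.coNbrs x) :
    tent.IsIndContained G := by
  have hco : ∀ i j, i ≤ k + 1 → j ≤ k + 1 → i + 2 ≤ j → q j ∈ G.coNbrs (q i) := fun i j h1 h2 h3 =>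
    hq.mem_coNbrs h1 h2 (by omega) (by omega) (by omega)
  rcases hk.eq_or_lt with rfl | hk3
  · exact tent_isIndContained (a := c) (b := q 1) (c := q 2) (x := x) (y := q 0) (z := q 3)
      (hc 1 le_rfl (by omega)) (hq.adj (by omega)) (hc 2 (by omega) le_rfl) hcx
      (hq.adj (i := 0) (by omega)).symm (hq.adj (i := 2) (by omega)) h0 hk1
      (coNbrs_comm.1 (hx 1 (by omega))) (hco 1 3 (by omega) (by omega) (by omega))
      (coNbrs_comm.1 (hx 2 (by omega))) (coNbrs_comm.1 (hco 0 2 (by omega) (by omega) (by omega)))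
      (hx 0 (by omega)) (hco 0 3 (by omega) (by omega) (by omega)) (hx 3 (by omega))
  -- For `k ≥ 3`, the clique dominating the asteroidal triple `x`, `q 0`, `q (k + 1)` would have to
  -- contain `c` and the nonadjacent vertices `q 1` and `q k`.
  exfalso
  set C : Set V := {v | v = c ∨ v = x ∨ ∃ i ≤ k + 1, v = q i} with hC
  have hcC : c ∈ C := Or.inl rfl
  have hxC : x ∈ C := Or.inr (Or.inl rfl)
  have hqC : ∀ i ≤ k + 1, q i ∈ C := fun i hi => Or.inr (Or.inr ⟨i, hi, rfl⟩)
  have hAT : G.IsAT C x (q 0) (q (k + 1)) := by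
    have c0 : c ∈ G.coNbrs (q 0) := coNbrs_comm.1 h0
    have ck : c ∈ G.coNbrs (q (k + 1)) := coNbrs_comm.1 hk1
    have x0 : x ∈ G.coNbrs (q 0) := coNbrs_comm.1 (hx 0 (by omega))
    have xk : x ∈ G.coNbrs (q (k + 1)) := coNbrs_comm.1 (hx (k + 1) le_rfl)
    have q10 : q 1 ∈ G.coNbrs (q (k + 1)) :=
      coNbrs_comm.1 (hco 1 (k + 1) (by omega) le_rfl (by omega))
    have q00 : q 0 ∈ G.coNbrs (q (k + 1)) :=
      coNbrs_comm.1 (hco 0 (k + 1) (by omega) le_rfl (by omega))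
    have qk0 : q k ∈ G.coNbrs (q 0) := hco 0 k (by omega) (by omega) (by omega)
    have qk1 : q (k + 1) ∈ G.coNbrs (q 0) := coNbrs_comm.1 q00
    refine ⟨hx 0 (by omega), qk1, xk, ?_, ?_, ?_⟩
    · have m1 : x ∈ G.coNbrs (q (k + 1)) ∩ C := ⟨xk, hxC⟩
      have m2 : c ∈ G.coNbrs (q (k + 1)) ∩ C := ⟨ck, hcC⟩
      have m3 : q 1 ∈ G.coNbrs (q (k + 1)) ∩ C := ⟨q10, hqC 1 (by omega)⟩
      have m4 : q 0 ∈ G.coNbrs (q (k + 1)) ∩ C := ⟨q00, hqC 0 (by omega)⟩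
      exact (ReachIn.of_adj m1 m2 hcx.symm).trans ((ReachIn.of_adj m2 m3 (hc 1 le_rfl
        (by omega))).trans (ReachIn.of_adj m3 m4 (hq.adj (i := 0) (by omega)).symm))
    · exact hq.reachIn (by omega) le_rfl fun l _ hl => ⟨hx l hl, hqC l hl⟩
    · have m1 : x ∈ G.coNbrs (q 0) ∩ C := ⟨x0, hxC⟩
      have m2 : c ∈ G.coNbrs (q 0) ∩ C := ⟨c0, hcC⟩
      have m3 : q k ∈ G.coNbrs (q 0) ∩ C := ⟨qk0, hqC k (by omega)⟩
      have m4 : q (k + 1) ∈ G.coNbrs (q 0) ∩ C := ⟨qk1, hqC _ le_rfl⟩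
      exact (ReachIn.of_adj m4 m3 (hq.adj (i := k) (by omega)).symm).trans
        ((ReachIn.of_adj m3 m2 (hc k (by omega) le_rfl).symm).trans (ReachIn.of_adj m2 m1 hcx))
  obtain ⟨T, hTC, hT, hdom⟩ := hD C x _ _ hAT
  have hclq : ∀ {u v}, u ∈ T → v ∈ T → v ∉ G.coNbrs u := fun {u v} hu hv h =>
    h.2 (hT hu hv h.1.symm)
  have hend : ∀ {i}, i ≤ k + 1 → q i ∈ G.coNbrs c → ∃ j ≤ k + 1, q j ∈ T ∧ j ≤ i + 1 ∧ i ≤ j + 1 := by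
    intro i hi hic
    obtain ⟨u, hu, hui⟩ := hdom (q i)
    rcases hTC hu with rfl | rfl | ⟨j, hj, rfl⟩
    · exact absurd hic hui
    · exact absurd (hx i hi) hui
    · refine ⟨j, hj, hu, ?_⟩
      by_contra hcon
      refine hui ?_
      rcases (show i + 2 ≤ j ∨ j + 2 ≤ i by omega) with h | h
      · exact coNbrs_comm.1 (hco i j hi hj h)
      · exact hco j i hj hi h
  obtain ⟨i, hi, hiT, hi1, -⟩ := hend (by omega) h0
  obtain ⟨j, hj, hjT, -, hj1⟩ := hend le_rfl hk1
  obtain ⟨u, hu, hux⟩ := hdom x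
  have hcT : c ∈ T := by
    rcases hTC hu with rfl | rfl | ⟨l, hl, rfl⟩
    · exact hu
    · exact absurd (hx i hi) (hclq hu hiT)
    · exact absurd (coNbrs_comm.1 (hx l hl)) hux
  have hi2 : i ≠ 0 := by
    rintro rfl
    exact hclq hcT hiT h0
  have hj2 : j ≠ k + 1 := by
    rintro rfl
    exact hclq hcT hjT hk1
  exact hclq hiT hjT (hco i j hi hj (by omega))

/-- No subdivided claws. -/
theorem HasDominatingCliques.no_biclaw (hD : G.HasDominatingCliques) {s a a' b b' c c' : V}
    (hsa : G.Adj s a) (hsb : G.Adj s b) (hsc : G.Adj s c) (ha : G.Adj a a') (hb : G.Adj b b')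
    (hc : G.Adj c c') (sa : s ∈ G.coNbrs a') (sb : s ∈ G.coNbrs b') (sc : s ∈ G.coNbrs c')
    (ab : b ∈ G.coNbrs a) (ab' : b' ∈ G.coNbrs a) (a'b : b ∈ G.coNbrs a') (a'b' : b' ∈ G.coNbrs a')
    (ac : c ∈ G.coNbrs a) (ac' : c' ∈ G.coNbrs a) (a'c : c ∈ G.coNbrs a') (a'c' : c' ∈ G.coNbrs a')
    (bc : c ∈ G.coNbrs b) (bc' : c' ∈ G.coNbrs b) (b'c : c ∈ G.coNbrs b') (b'c' : c' ∈ G.coNbrs b') :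
    False := by
  set C : Set V := {s, a, a', b, b', c, c'} with hC
  have key : ∀ {t u u' v v'}, G.Adj s u → G.Adj s v → G.Adj u u' → G.Adj v v' →
      s ∈ G.coNbrs t ∩ C → u ∈ G.coNbrs t ∩ C → u' ∈ G.coNbrs t ∩ C → v ∈ G.coNbrs t ∩ C →
      v' ∈ G.coNbrs t ∩ C → G.ReachIn (G.coNbrs t ∩ C) u' v' := by
    intro t u u' v v' h1 h2 h3 h4 k1 k2 k3 k4 k5
    exact (ReachIn.of_adj k3 k2 h3.symm).trans ((ReachIn.of_adj k2 k1 h1.symm).trans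
      ((ReachIn.of_adj k1 k4 h2).trans (ReachIn.of_adj k4 k5 h4)))
  have sC : s ∈ C := by simp [hC]
  have aC : a ∈ C := by simp [hC]
  have a'C : a' ∈ C := by simp [hC]
  have bC : b ∈ C := by simp [hC]
  have b'C : b' ∈ C := by simp [hC]
  have cC : c ∈ C := by simp [hC]
  have c'C : c' ∈ C := by simp [hC]
  have hAT : G.IsAT C a' b' c' := by
    refine ⟨a'b', b'c', coNbrs_comm.1 a'c', ?_, ?_, ?_⟩
    · exact key hsa hsb ha hb ⟨sc, sC⟩ ⟨coNbrs_comm.1 ac', aC⟩ ⟨coNbrs_comm.1 a'c', a'C⟩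
        ⟨coNbrs_comm.1 bc', bC⟩ ⟨coNbrs_comm.1 b'c', b'C⟩
    · exact key hsb hsc hb hc ⟨sa, sC⟩ ⟨a'b, bC⟩ ⟨a'b', b'C⟩ ⟨a'c, cC⟩ ⟨a'c', c'C⟩
    · exact key hsc hsa hc ha ⟨sb, sC⟩ ⟨b'c, cC⟩ ⟨b'c', c'C⟩ ⟨coNbrs_comm.1 ab', aC⟩
        ⟨coNbrs_comm.1 a'b', a'C⟩
  obtain ⟨T, hTC, hT, hdom⟩ := hD C _ _ _ hAT
  have hclq : ∀ {u v}, u ∈ T → v ∈ T → v ∉ G.coNbrs u := fun {u v} hu hv h =>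
    h.2 (hT hu hv h.1.symm)
  -- Only the leg of `a'` dominates `a'` and only that of `b'` dominates `b'`, but no vertex of one
  -- leg is adjacent to one of the other.
  obtain ⟨u, hu, hu'⟩ := hdom a'
  obtain ⟨v, hv, hv'⟩ := hdom b'
  have huA : u = a ∨ u = a' := by
    rcases hTC hu with rfl | rfl | rfl | rfl | rfl | rfl | rfl
    · exact absurd (coNbrs_comm.1 sa) hu'
    · exact Or.inl rfl
    · exact Or.inr rfl
    · exact absurd (coNbrs_comm.1 a'b) hu'
    · exact absurd (coNbrs_comm.1 a'b') hu'
    · exact absurd (coNbrs_comm.1 a'c) hu'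
    · exact absurd (coNbrs_comm.1 a'c') hu'
  have hvB : v = b ∨ v = b' := by
    rcases hTC hv with rfl | rfl | rfl | rfl | rfl | rfl | rfl
    · exact absurd (coNbrs_comm.1 sb) hv'
    · exact absurd ab' hv'
    · exact absurd a'b' hv'
    · exact Or.inl rfl
    · exact Or.inr rfl
    · exact absurd (coNbrs_comm.1 b'c) hv'
    · exact absurd (coNbrs_comm.1 b'c') hv'
  rcases huA with rfl | rfl <;> rcases hvB with rfl | rfl
  · exact hclq hu hv ab
  · exact hclq hu hv ab'
  · exact hclq hu hv a'b
  · exact hclq hu hv a'b'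

end Triples

end SimpleGraph

/-! ### From an asteroidal triple to a forbidden subgraph -/

namespace SimpleGraph

section Triples

variable {V : Type*} {G : SimpleGraph V}

/-- A path from `y` to `q` among the non-neighbours of `x` has both ends adjacent to `p`, so `p`
sees all of it. A shortest path to `z` is then taken among such vertices; it has length at least
three because no vertex missing `x` sees both `y` and `z`. -/
theorem HoleFree.exists_indPath_in_nbrs (hG : G.HoleFree) {p q x y z : V} (hpx : G.Adj p x)
    (hpy : G.Adj p y) (hpq : G.Adj p q) (hqz : G.Adj q z)
    (hyx : y ∈ G.coNbrs x) (hqx : q ∈ G.coNbrs x) (hzx : z ∈ G.coNbrs x) (hyz : z ∈ G.coNbrs y)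
    (hr : G.ReachIn (G.coNbrs x) y z) (hn : ∀ w ∈ G.coNbrs x, G.Adj w y → ¬ G.Adj w z) :
    ∃ m u, 2 ≤ m ∧ G.IsIndPath (m + 1) u ∧ u 0 = y ∧ u (m + 1) = z ∧
      (∀ i ≤ m + 1, u i ∈ G.coNbrs x) ∧ ∀ i ≤ m, G.Adj p (u i) := by
  obtain ⟨k, a, ha, ha0, hak, hax⟩ :=
    (hr.trans (ReachIn.of_adj hzx hqx hqz.symm)).exists_indPath hyx
  have hpa : ∀ i ≤ k, G.Adj p (a i) := fun i hi => by
    refine hG.adj_of_between ha (fun i hi h => ?_) (i := 0) (j := k) (ha0 ▸ hpy) (hak ▸ hpq)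
      (by omega) hi le_rfl
    exact (hax i hi).2 (h ▸ hpx.symm)
  set S : Set V := {v | v ∈ G.coNbrs x ∧ (v = z ∨ G.Adj p v)} with hS
  have hqS : q ∈ S := ⟨hqx, Or.inr hpq⟩
  have h1 : G.ReachIn S y z := by
    have := ha.reachIn (S := S) (Nat.zero_le k) le_rfl fun i _ hi => ⟨hax i hi, Or.inr (hpa i hi)⟩
    rw [ha0, hak] at this
    exact this.trans (ReachIn.of_adj hqS ⟨hzx, Or.inl rfl⟩ hqz)
  obtain ⟨m, u, hu, hu0, hum, huS⟩ := h1.exists_indPath ⟨hyx, Or.inr hpy⟩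
  have hm : 3 ≤ m := by
    by_contra hm
    rcases (show m = 0 ∨ m = 1 ∨ m = 2 by omega) with rfl | rfl | rfl
    · exact hyz.1 (hum.symm.trans hu0)
    · have := hu.adj (i := 0) (by omega)
      rw [zero_add, hu0, hum] at this
      exact hyz.2 this
    · have e1 := hu.adj (i := 0) (by omega)
      have e2 := hu.adj (i := 1) (by omega)
      rw [zero_add, hu0] at e1
      rw [show 1 + 1 = 2 from rfl, hum] at e2
      exact hn _ (huS 1 (by omega)).1 e1.symm e2
  obtain ⟨m, rfl⟩ : ∃ m', m = m' + 1 := ⟨m - 1, by omega⟩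
  refine ⟨m, u, by omega, hu, hu0, hum, fun i hi => (huS i hi).1, fun i hi => ?_⟩
  exact (huS i (by omega)).2.resolve_left fun h =>
    hu.ne (i := i) (j := m + 1) (by omega) le_rfl (by omega) (h.trans hum.symm)

/-- The first vertex `v j` that sees the path `u` sees an interval `u e, …, u f` of it. The position
and length of this interval decide which forbidden graph appears, with `v (j - 1)` as a vertex
missing the whole path `u`. -/
theorem HasDominatingCliques.hasSunTentUmbrella_of_paths (hG : G.HoleFree)
    (hD : G.HasDominatingCliques) {p z : V} (hpz : z ∈ G.coNbrs p) {m l : ℕ} {u v : ℕ → V}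
    (hm : 2 ≤ m) (hl : 2 ≤ l) (hu : G.IsIndPath (m + 1) u) (hv : G.IsIndPath (l + 1) v)
    (hum : u (m + 1) = z) (hvl : v (l + 1) = z) (hux : ∀ i ≤ m + 1, u i ∈ G.coNbrs (v 0))
    (hvy : ∀ i ≤ l + 1, v i ∈ G.coNbrs (u 0)) (hpu : ∀ i ≤ m, G.Adj p (u i))
    (hpv : ∀ i ≤ l, G.Adj p (v i)) : G.HasSunTentUmbrella := by
  classical
  have uco : ∀ i j, i ≤ m + 1 → j ≤ m + 1 → i + 2 ≤ j → u j ∈ G.coNbrs (u i) := fun i j h1 h2 h3 =>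
    hu.mem_coNbrs h1 h2 (by omega) (by omega) (by omega)
  have vco : ∀ i j, i ≤ l + 1 → j ≤ l + 1 → i + 2 ≤ j → v j ∈ G.coNbrs (v i) := fun i j h1 h2 h3 =>
    hv.mem_coNbrs h1 h2 (by omega) (by omega) (by omega)
  have hex : ∃ j, j ≤ l + 1 ∧ ∃ i ≤ m + 1, G.Adj (v j) (u i) :=
    ⟨l, by omega, m + 1, le_rfl, by rw [hum, ← hvl]; exact hv.adj (by omega)⟩
  obtain ⟨-, hjadj⟩ := Nat.find_spec hex
  have hjl : Nat.find hex ≤ l := Nat.find_min' hex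
    ⟨by omega, m + 1, le_rfl, by rw [hum, ← hvl]; exact hv.adj (by omega)⟩
  have hjmin : ∀ j' < Nat.find hex, ∀ i ≤ m + 1, ¬ G.Adj (v j') (u i) := fun j' hj' i hi had =>
    Nat.find_min hex hj' ⟨by omega, i, hi, had⟩
  generalize Nat.find hex = j at *
  have hj0 : 1 ≤ j := by
    by_contra h
    obtain ⟨i, hi, had⟩ := hjadj
    have : j = 0 := by omega
    subst this
    exact (hux i hi).2 had
  have hne : ∀ j' ≤ j, ∀ i ≤ m + 1, v j' ≠ u i := by
    intro j' hj' i hi heq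
    rcases Nat.eq_zero_or_pos j' with rfl | h0
    · exact (hux i hi).1 heq.symm
    · refine hjmin (j' - 1) (by omega) i hi ?_
      have := hv.adj (i := j' - 1) (by omega)
      rwa [show j' - 1 + 1 = j' by omega, heq] at this
  have hco : ∀ j' < j, ∀ i ≤ m + 1, u i ∈ G.coNbrs (v j') := fun j' hj' i hi =>
    ⟨(hne j' hj'.le i hi).symm, hjmin j' hj' i hi⟩
  obtain ⟨e, f, hef, hfm, hcu⟩ := hG.exists_interval hu (hne j le_rfl) hjadj
  have hcco : ∀ i ≤ m + 1, (i < e ∨ f < i) → u i ∈ G.coNbrs (v j) := fun i hi h =>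
    ⟨(hne j le_rfl i hi).symm, fun had => by have := (hcu i hi).1 had; omega⟩
  have he1 : 1 ≤ e := by
    by_contra he
    have : e = 0 := by omega
    subst this
    exact (hvy j (by omega)).2 ((hcu 0 (by omega)).2 (by omega)).symm
  have hcd : G.Adj (v j) (v (j - 1)) := by
    have := hv.adj (i := j - 1) (by omega)
    rw [show j - 1 + 1 = j by omega] at this
    exact this.symm
  have hd := hco (j - 1) (by omega)
  rcases (show f ≤ m ∨ f = m + 1 by omega) with hfm' | rfl
  · rcases hef.lt_or_eq with hlt | rfl
    -- Two or more neighbours before `z`: `v j` and its pendant neighbour `v (j - 1)` form a net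
    -- with the path.
    · have hq := hu.sub (i := e - 1) (l := (f - e + 1) + 1) (by omega)
      refine Or.inr (Or.inl (hD.tent_of_net (by omega) hq (c := v j) (x := v (j - 1)) ?_ ?_ ?_ hcd
        fun i hi => hd _ (by omega)))
      · intro i h1 h2
        exact (hcu _ (by omega)).2 (by omega)
      · exact hcco _ (by omega) (by omega)
      · exact hcco _ (by omega) (by omega)
    have hce := (hcu e (by omega)).2 ⟨le_rfl, le_rfl⟩
    -- A single neighbour `u e`: next to `z` it gives an umbrella, with `p` as the vertex joined to
    -- its path; next to `u 0` the roles of the two paths are exchanged and a tent appears; anywhere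
    -- between, a subdivided claw.
    rcases (show e = m ∨ e = 1 ∧ e < m ∨ (2 ≤ e ∧ e < m) by omega) with rfl | ⟨rfl, h1m⟩ | ⟨h2, h3⟩
    · obtain ⟨e, rfl⟩ : ∃ e', e = e' + 2 := ⟨e - 2, by omega⟩
      have hz := hum
      have hdz := coNbrs_comm.1 (hz ▸ hd (e + 2 + 1) le_rfl)
      refine Or.inr (Or.inr (Or.inl (umbrella_isIndContained (p₀ := v (j - 1)) (p₁ := v j)
        (p₂ := u (e + 2)) (p₃ := u (e + 1)) (p₄ := u e) (u := p) (x := z) hcd.symm hce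
        (hu.adj (by omega)).symm (hu.adj (by omega)).symm (hd _ (by omega)) (hd _ (by omega))
        (hd _ (by omega)) (hcco _ (by omega) (by omega)) (hcco _ (by omega) (by omega))
        (coNbrs_comm.1 (uco _ _ (by omega) (by omega) le_rfl)) (hpv _ (by omega)) (hpv _ (by omega))
        (hpu _ (by omega)) (hpu _ (by omega)) (hpu _ (by omega)) ?_ ?_ ?_ ?_ ?_ ?_)))
      · exact hz ▸ (hu.adj (by omega)).symm
      · exact hz ▸ hd _ le_rfl
      · exact hz ▸ hcco _ le_rfl (by omega)
      · exact hz ▸ uco _ _ (by omega) le_rfl (by omega)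
      · exact hz ▸ uco _ _ (by omega) le_rfl (by omega)
      · exact hpz
    · have hjl' : j < l := by
        by_contra h
        have : j = l := by omega
        subst this
        refine (hcco (m + 1) le_rfl (by omega)).2 ?_
        rw [hum, ← hvl]
        exact hv.adj (by omega)
      have hadj' : G.Adj (u 1) (v (j + 1)) := by
        refine hG.chord (a := v j) (d := u 2) (d' := v (j + 2)) hce (hv.adj (by omega)) ?_
          (hu.adj (i := 1) (by omega)) (hv.adj (i := j + 1) (by omega)) (hcco _ (by omega) (by omega)) ?_
        · intro h
          exact (hvy (j + 1) (by omega)).2 (h ▸ hu.adj (i := 0) (by omega))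
        · have r1 := hu.reachIn (S := G.coNbrs (v j)) (i := 2) (j := m + 1) (by omega) le_rfl
            fun i h1 h2 => hcco i h2 (by omega)
          have r2 := hv.reachIn (S := G.coNbrs (v j)) (i := j + 2) (j := l + 1) (by omega) le_rfl
            fun i h1 h2 => vco j i (by omega) h2 h1
          rw [hum, ← hvl] at r1
          exact r1.trans r2.symm
      have hy1 : G.Adj (u 1) (u 0) := (hu.adj (i := 0) (by omega)).symm
      have hu1 : ∀ i ≤ l + 1, u 1 ≠ v i := fun i hi h => (hvy i hi).2 (h ▸ hy1.symm)
      obtain ⟨a, b, hab, hbl, hau⟩ := hG.exists_interval hv hu1 ⟨j, by omega, hce.symm⟩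
      have haj : a = j := by
        have h1 := (hau j (by omega)).1 hce.symm
        by_contra h2
        exact (hd 1 (by omega)).2 ((hau (j - 1) (by omega)).2 (by omega)).symm
      have hbj : j + 1 ≤ b := ((hau (j + 1) (by omega)).1 hadj').2
      have hbl' : b ≤ l := by
        by_contra h
        have h1 := (hau (l + 1) le_rfl).2 (by omega)
        rw [hvl, ← hum] at h1
        exact (uco 1 (m + 1) (by omega) le_rfl (by omega)).2 h1
      have hco1 : ∀ i ≤ l + 1, (i < a ∨ b < i) → v i ∈ G.coNbrs (u 1) := fun i hi h =>
        ⟨(hu1 i hi).symm, fun had => by have := (hau i hi).1 had; omega⟩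
      have hq := hv.sub (i := j - 1) (l := (b - j + 1) + 1) (by omega)
      refine Or.inr (Or.inl (hD.tent_of_net (by omega) hq (c := u 1) (x := u 0) ?_ ?_ ?_ hy1
        fun i hi => hvy _ (by omega)))
      · intro i h1 h2
        exact (hau _ (by omega)).2 (by omega)
      · exact hco1 _ (by omega) (by omega)
      · exact hco1 _ (by omega) (by omega)
    · exfalso
      obtain ⟨e, rfl⟩ : ∃ e', e = e' + 2 := ⟨e - 2, by omega⟩
      refine hD.no_biclaw (s := u (e + 2)) (a := v j) (a' := v (j - 1)) (b := u (e + 1)) (b' := u e)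
        (c := u (e + 3)) (c' := u (e + 4)) hce.symm (hu.adj (by omega)).symm (hu.adj (by omega)) hcd
        (hu.adj (by omega)).symm (hu.adj (by omega)) (hd _ (by omega))
        (uco _ _ (by omega) (by omega) le_rfl)
        (coNbrs_comm.1 (uco _ _ (by omega) (by omega) le_rfl)) (hcco _ (by omega) (by omega))
        (hcco _ (by omega) (by omega)) (hd _ (by omega)) (hd _ (by omega))
        (hcco _ (by omega) (by omega)) (hcco _ (by omega) (by omega)) (hd _ (by omega))
        (hd _ (by omega)) (uco _ _ (by omega) (by omega) (by omega))
        (uco _ _ (by omega) (by omega) (by omega)) (uco _ _ (by omega) (by omega) (by omega))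
        (uco _ _ (by omega) (by omega) (by omega))
  · have hcz : G.Adj (v j) z := hum ▸ (hcu (m + 1) le_rfl).2 ⟨hef, le_rfl⟩
    have hjl' : j = l := by
      by_contra h
      exact (vco j (l + 1) (by omega) le_rfl (by omega)).2 (hvl ▸ hcz)
    subst hjl'
    -- `v j` and `u m` are both adjacent to `p` and to `z`, while `z` misses `p`, so they are
    -- adjacent.
    have hem : e ≤ m := by
      have := hG.chord (a := p) (d := z) (d' := z) (hpv j le_rfl) (hpu m le_rfl)
        (hne j le_rfl m (by omega)) hcz (hum ▸ hu.adj (by omega)) hpz (.refl _)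
      exact ((hcu m (by omega)).1 this).1
    rcases hem.lt_or_eq with hlt | rfl
    · obtain ⟨j, rfl⟩ : ∃ j', j = j' + 2 := ⟨j - 2, by omega⟩
      obtain ⟨e, rfl⟩ : ∃ e', e = e' + 1 := ⟨e - 1, by omega⟩
      have hd2 := hco j (by omega)
      refine Or.inr (Or.inr (Or.inl (umbrella_isIndContained (p₀ := u e) (p₁ := u (e + 1))
        (p₂ := v (j + 2)) (p₃ := v (j + 1)) (p₄ := v j) (u := p) (x := z) (hu.adj (by omega))
        ((hcu _ (by omega)).2 ⟨le_rfl, by omega⟩).symm hcd (hv.adj (by omega)).symm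
        (coNbrs_comm.1 (hcco _ (by omega) (by omega))) (coNbrs_comm.1 (hd _ (by omega)))
        (coNbrs_comm.1 (hd2 _ (by omega))) (coNbrs_comm.1 (hd _ (by omega)))
        (coNbrs_comm.1 (hd2 _ (by omega))) (coNbrs_comm.1 (vco _ _ (by omega) (by omega) le_rfl))
        (hpu _ (by omega)) (hpu _ (by omega)) (hpv _ (by omega)) (hpv _ (by omega))
        (hpv _ (by omega)) hcz.symm ?_ ?_ ?_ ?_ hpz)))
      · exact hum ▸ uco _ _ (by omega) le_rfl (by omega)
      · exact hum ▸ uco _ _ (by omega) le_rfl (by omega)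
      · exact hvl ▸ vco _ _ (by omega) le_rfl (by omega)
      · exact hvl ▸ vco _ _ (by omega) le_rfl (by omega)
    · obtain ⟨e, rfl⟩ : ∃ e', e = e' + 1 := ⟨e - 1, by omega⟩
      have hze : z ∈ G.coNbrs (u e) := hum ▸ uco _ _ (by omega) le_rfl (by omega)
      exact Or.inl (threeSun_isIndContained (v₀ := p) (v₁ := u (e + 1)) (v₂ := v j)
        (w₀ := u e) (w₁ := z) (w₂ := v (j - 1)) (hpu _ (by omega))
        ((hcu _ (by omega)).2 ⟨le_rfl, by omega⟩).symm (hpv _ le_rfl) (hpu _ (by omega))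
        (hu.adj (by omega)).symm (hum ▸ hu.adj (by omega)) hcz hcd (hpv _ (by omega))
        (hcco _ (by omega) (by omega)) hpz (coNbrs_comm.1 (hd _ (by omega))) hze
        (coNbrs_comm.1 (hd _ (by omega))) (coNbrs_comm.1 (hum ▸ hd _ le_rfl)))

/-- The case of a vertex adjacent to `x` and `y` only, where no vertex is adjacent to `z` and
exactly one of the others. -/
theorem HasDominatingCliques.hasSunTentUmbrella_of_connector (hG : G.HoleFree)
    (hD : G.HasDominatingCliques) {x y z p q : V} (hyx : y ∈ G.coNbrs x) (hzy : z ∈ G.coNbrs y)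
    (hzx : z ∈ G.coNbrs x) (hryz : G.ReachIn (G.coNbrs x) y z) (hrxz : G.ReachIn (G.coNbrs y) x z)
    (hpx : G.Adj p x) (hpy : G.Adj p y) (hpz : z ∈ G.coNbrs p) (hqp : G.Adj p q)
    (hqz : G.Adj q z) (hqx : q ∈ G.coNbrs x) (hqy : q ∈ G.coNbrs y)
    (hnx : ∀ w ∈ G.coNbrs x, G.Adj w y → ¬ G.Adj w z)
    (hny : ∀ w ∈ G.coNbrs y, G.Adj w x → ¬ G.Adj w z) : G.HasSunTentUmbrella := by
  obtain ⟨m, u, hm, hu, hu0, hum, hux, hpu⟩ :=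
    hG.exists_indPath_in_nbrs hpx hpy hqp hqz hyx hqx hzx hzy hryz hnx
  obtain ⟨l, v, hl, hv, hv0, hvl, hvy, hpv⟩ :=
    hG.exists_indPath_in_nbrs hpy hpx hqp hqz (coNbrs_comm.1 hyx) hqy hzy hzx hrxz hny
  exact hD.hasSunTentUmbrella_of_paths hG hpz hm hl hu hv hum hvl (hv0 ▸ hux) (hu0 ▸ hvy) hpu hpv

/-- Connecting vertices, adjacent to exactly two of `x, y, z`, for two different pairs give a sun.
Otherwise a dominating clique is examined: a member serving two of the three leads to the path
analysis, and three separate members form a tent. -/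
theorem HasDominatingCliques.hasSunTentUmbrella (hG : G.HoleFree) (hD : G.HasDominatingCliques)
    (hAT : ¬ G.ATFree) : G.HasSunTentUmbrella := by
  simp only [ATFree, not_forall, not_not] at hAT
  obtain ⟨C, x, y, z, hyx, hzy, hxz, hxy, hyz, hzx⟩ := hAT
  replace hxy := hxy.mono Set.inter_subset_left
  replace hyz := hyz.mono Set.inter_subset_left
  replace hzx := hzx.mono Set.inter_subset_left
  have hxy' := coNbrs_comm.1 hyx
  have hyz' := coNbrs_comm.1 hzy
  have hzx' := coNbrs_comm.1 hxz
  set P : V → V → V → Prop := fun a b c => ∃ p, G.Adj p a ∧ G.Adj p b ∧ c ∈ G.coNbrs p with hP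
  by_cases h2 : (P x y z ∧ P x z y) ∨ (P x y z ∧ P y z x) ∨ (P x z y ∧ P y z x)
  · rcases h2 with ⟨⟨p, p1, p2, p3⟩, ⟨q, q1, q2, q3⟩⟩ | ⟨⟨p, p1, p2, p3⟩, ⟨q, q1, q2, q3⟩⟩ |
      ⟨⟨p, p1, p2, p3⟩, ⟨q, q1, q2, q3⟩⟩
    · exact hG.exists_isSun p1.symm q1.symm hyx hyz p2 q2 p3 q3
    · exact hG.exists_isSun p2.symm q1.symm hxy' hzx.symm p1 q2 p3 q3
    · exact hG.exists_isSun p2.symm q2.symm hxz hxy p1 q1 p3 q3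
  -- Restricting the witnesses to `D` prevents a clique member from dominating all of `x, y, z` at
  -- once.
  set D : Set V := G.coNbrs x ∪ G.coNbrs y ∪ G.coNbrs z with hDdef
  have hAT' : G.IsAT D x y z := by
    refine ⟨hyx, hzy, hxz, ?_, ?_, ?_⟩
    · exact hxy.mono fun v hv => Set.mem_inter hv (Or.inr hv)
    · exact hyz.mono fun v hv => Set.mem_inter hv (Or.inl (Or.inl hv))
    · exact hzx.mono fun v hv => Set.mem_inter hv (Or.inl (Or.inr hv))
  obtain ⟨T, hTD, hT, hdom⟩ := hD D x y z hAT'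
  obtain ⟨a, ha, hax⟩ := hdom x
  obtain ⟨b, hb, hby⟩ := hdom y
  obtain ⟨c, hc, hcz⟩ := hdom z
  -- `p` serves `x` and `y` but not `z`. As no other pair has a connecting vertex, the clique member
  -- `q` serving `z` misses both `x` and `y`.
  have single : ∀ {x y z : V}, y ∈ G.coNbrs x → z ∈ G.coNbrs y → z ∈ G.coNbrs x →
      G.ReachIn (G.coNbrs x) y z → G.ReachIn (G.coNbrs y) x z →
      T ⊆ G.coNbrs x ∪ G.coNbrs y ∪ G.coNbrs z → ¬ (P x y z ∧ P x z y) → ¬ (P x y z ∧ P y z x) →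
      ∀ p ∈ T, x ∉ G.coNbrs p → y ∉ G.coNbrs p → ∀ q ∈ T, z ∉ G.coNbrs q →
      G.HasSunTentUmbrella := by
    intro x y z hyx hzy hzx hyz hxz hTD n1 n2 p hp hpx hpy q hq hqz
    have hpx' : G.Adj p x := (notMem_coNbrs.1 hpx).resolve_left (by
      rintro rfl
      exact hpy hyx)
    have hpy' : G.Adj p y := (notMem_coNbrs.1 hpy).resolve_left (by
      rintro rfl
      exact hpx (coNbrs_comm.1 hyx))
    have hpz : z ∈ G.coNbrs p := by
      rcases hTD hp with (h | h) | h
      · exact absurd (coNbrs_comm.1 h) hpx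
      · exact absurd (coNbrs_comm.1 h) hpy
      · exact coNbrs_comm.1 h
    have hPxy : P x y z := ⟨p, hpx', hpy', hpz⟩
    have hpq : G.Adj p q := hT hp hq (by
      rintro rfl
      exact hqz hpz)
    have hqz' : G.Adj q z := (notMem_coNbrs.1 hqz).resolve_left (by
      rintro rfl
      exact hpz.2 hpq)
    have hnx : ∀ w ∈ G.coNbrs x, G.Adj w y → ¬ G.Adj w z := fun w hw h1 h2 =>
      n2 ⟨hPxy, w, h1, h2, coNbrs_comm.1 hw⟩
    have hny : ∀ w ∈ G.coNbrs y, G.Adj w x → ¬ G.Adj w z := fun w hw h1 h2 =>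
      n1 ⟨hPxy, w, h1, h2, coNbrs_comm.1 hw⟩
    have hqxy : q ∈ G.coNbrs x ∧ q ∈ G.coNbrs y := by
      by_cases h1 : q ∈ G.coNbrs x <;> by_cases h2 : q ∈ G.coNbrs y
      · exact ⟨h1, h2⟩
      · rcases notMem_coNbrs.1 h2 with rfl | h2
        · exact absurd hqz' hzy.2
        · exact absurd hqz' (hnx q h1 h2.symm)
      · rcases notMem_coNbrs.1 h1 with rfl | h1
        · exact absurd hqz' hzx.2
        · exact absurd hqz' (hny q h2 h1.symm)
      · rcases hTD hq with (h | h) | h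
        · exact absurd h h1
        · exact absurd h h2
        · exact absurd (coNbrs_comm.1 h) hqz
    exact hD.hasSunTentUmbrella_of_connector hG hyx hzy hzx hyz hxz hpx' hpy' hpz hpq hqz' hqxy.1
      hqxy.2 hnx hny
  have Pc : ∀ {a b c}, P a b c → P b a c := fun ⟨p, h1, h2, h3⟩ => ⟨p, h2, h1, h3⟩
  by_cases kxy : ∃ p ∈ T, x ∉ G.coNbrs p ∧ y ∉ G.coNbrs p
  · obtain ⟨p, hp, h1, h3⟩ := kxy
    exact single hyx hzy hzx' hyz hzx.symm hTD (fun h => h2 (Or.inl h))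
      (fun h => h2 (Or.inr (Or.inl h))) p hp h1 h3 c hc hcz
  by_cases kxz : ∃ p ∈ T, x ∉ G.coNbrs p ∧ z ∉ G.coNbrs p
  · obtain ⟨p, hp, h1, h3⟩ := kxz
    exact single hzx' hyz' hyx hyz.symm hxy (hTD.trans (by rw [hDdef, Set.union_right_comm])) (fun h => h2 (Or.inl ⟨h.2, h.1⟩))
      (fun h => h2 (Or.inr (Or.inr ⟨h.1, Pc h.2⟩))) p hp h1 h3 b hb hby
  by_cases kyz : ∃ p ∈ T, y ∉ G.coNbrs p ∧ z ∉ G.coNbrs p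
  · obtain ⟨p, hp, h1, h3⟩ := kyz
    exact single hzy hxz hxy' hzx hxy.symm (hTD.trans (by rw [hDdef, Set.union_assoc, Set.union_comm])) (fun h => h2 (Or.inr (Or.inl ⟨Pc h.2, h.1⟩)))
      (fun h => h2 (Or.inr (Or.inr ⟨Pc h.2, h.1⟩))) p hp h1 h3 a ha hax
  push Not at kxy kxz kyz
  have nay := kxy a ha hax
  have naz := kxz a ha hax
  have nbx : x ∈ G.coNbrs b := by
    by_contra h
    exact hby (kxy b hb h)
  have nbz := kyz b hb hby
  have ncx : x ∈ G.coNbrs c := by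
    by_contra h
    exact hcz (kxz c hc h)
  have ncy : y ∈ G.coNbrs c := by
    by_contra h
    exact hcz (kyz c hc h)
  have hab : G.Adj a b := hT ha hb (by
    rintro rfl
    exact hax nbx)
  have hac : G.Adj a c := hT ha hc (by
    rintro rfl
    exact hax ncx)
  have hbc : G.Adj b c := hT hb hc (by
    rintro rfl
    exact hby ncy)
  exact Or.inr (Or.inl (tent_isIndContained hab hbc hac
    ((notMem_coNbrs.1 hax).resolve_left (by rintro rfl; exact nbx.2 hab.symm))
    ((notMem_coNbrs.1 hby).resolve_left (by rintro rfl; exact nay.2 hab))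
    ((notMem_coNbrs.1 hcz).resolve_left (by rintro rfl; exact naz.2 hac))
    nay naz nbx nbz ncx ncy hyx hzy hzx'))

end Triples

end SimpleGraph

/-! ### The forbidden graphs are hole-free and have asteroidal triples -/

namespace SimpleGraph

section Obstructions

variable {V W : Type*} {G : SimpleGraph V} {H : SimpleGraph W}

theorem HoleFree.of_embedding (f : G ↪g H) (hH : H.HoleFree) : G.HoleFree := fun n c hc =>
  hH n (fun i => f (c i)) ⟨hc.1, f.injective.comp hc.2.1, fun i j => by
    rw [f.map_adj_iff, hc.2.2]⟩

theorem mem_coNbrs_map (f : G ↪g H) {u v : V} : f v ∈ H.coNbrs (f u) ↔ v ∈ G.coNbrs u := by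
  rw [mem_coNbrs, mem_coNbrs, f.map_adj_iff, f.injective.ne_iff]

theorem ReachIn.map (f : G ↪g H) {S : Set V} {T : Set W} (h : ∀ v ∈ S, f v ∈ T) {u v : V}
    (huv : G.ReachIn S u v) : H.ReachIn T (f u) (f v) :=
  huv.lift f fun _ _ hab => ⟨h _ hab.1, h _ hab.2.1, f.map_adj_iff.2 hab.2.2⟩

theorem IsAT.map (f : G ↪g H) {C : Set V} {x y z : V} (h : G.IsAT C x y z) :
    H.IsAT (f '' C) (f x) (f y) (f z) := by
  obtain ⟨h1, h2, h3, h4, h5, h6⟩ := h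
  have key : ∀ z, ∀ v ∈ G.coNbrs z ∩ C, f v ∈ H.coNbrs (f z) ∩ f '' C := fun z v hv =>
    ⟨(mem_coNbrs_map f).2 hv.1, v, hv.2, rfl⟩
  exact ⟨(mem_coNbrs_map f).2 h1, (mem_coNbrs_map f).2 h2, (mem_coNbrs_map f).2 h3,
    h4.map f (key z), h5.map f (key x), h6.map f (key y)⟩

/-- A graph with a perfect elimination order has no holes. -/
theorem holeFree_of_rank (r : V → ℕ) (h : ∀ w u v, G.Adj w u → G.Adj w v → u ≠ v → r w ≤ r u →
    r w ≤ r v → G.Adj u v) : G.HoleFree := by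
  intro n c hc
  have : NeZero n := ⟨by have := hc.1; omega⟩
  obtain ⟨i, -, hi⟩ := Finset.exists_min_image Finset.univ (fun i => r (c i)) ⟨0, by simp⟩
  have hco := hc.mem_coNbrs_add_two (i - 1)
  rw [show i - 1 + 2 = i + 1 by ring] at hco
  exact hco.2 (h (c i) _ _ ((hc.2.2 _ _).2 (Or.inr (by ring))) ((hc.2.2 _ _).2 (Or.inl rfl))
    hco.1.symm (hi _ (by simp)) (hi _ (by simp)))

theorem ReachIn.of_path {S : Set V} {a b c : V} (hab : G.Adj a b) (hbc : G.Adj b c) (ha : a ∈ S)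
    (hb : b ∈ S) (hc : c ∈ S) : G.ReachIn S a c :=
  (ReachIn.of_adj ha hb hab).trans (ReachIn.of_adj hb hc hbc)

theorem threeSun_holeFree : threeSun.HoleFree := by
  refine holeFree_of_rank (Sum.elim (fun _ => 1) (fun _ => 0)) ?_
  rintro (w | w) (u | u) (v | v) h1 h2 h3 h4 h5 <;> simp_all [threeSun]

theorem threeSun_isAT : threeSun.IsAT Set.univ (.inr 0) (.inr 1) (.inr 2) := by
  refine ⟨?_, ?_, ?_, ?_, ?_, ?_⟩
  · simp [mem_coNbrs, threeSun]
  · simp [mem_coNbrs, threeSun]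
  · simp [mem_coNbrs, threeSun]
  · apply ReachIn.of_path (b := .inl 1) <;> simp [mem_coNbrs, threeSun]
  · apply ReachIn.of_path (b := .inl 2) <;> simp [mem_coNbrs, threeSun]
  · apply ReachIn.of_path (b := .inl 0) <;> simp [mem_coNbrs, threeSun]

theorem tent_holeFree : tent.HoleFree := by
  refine holeFree_of_rank (Sum.elim (fun _ => 0) (fun _ => 1)) ?_
  rintro (w | w) (u | u) (v | v) h1 h2 h3 h4 h5 <;> simp_all [tent, threeSun]

theorem tent_isAT : tent.IsAT Set.univ (.inl 0) (.inl 1) (.inl 2) := by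
  have key : ∀ z : Fin 3 ⊕ Fin 3, ∀ {a b c d}, tent.Adj a b → tent.Adj b c → tent.Adj c d →
      a ∈ tent.coNbrs z → b ∈ tent.coNbrs z → c ∈ tent.coNbrs z → d ∈ tent.coNbrs z →
      tent.ReachIn (tent.coNbrs z ∩ Set.univ) a d := by
    intro z a b c d h1 h2 h3 ha hb hc hd
    rw [Set.inter_univ]
    exact (ReachIn.of_path h1 h2 ha hb hc).trans (ReachIn.of_adj hc hd h3)
  refine ⟨?_, ?_, ?_, ?_, ?_, ?_⟩
  · simp [mem_coNbrs, tent, threeSun]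
  · simp [mem_coNbrs, tent, threeSun]
  · simp [mem_coNbrs, tent, threeSun]
  · apply key (b := .inr 1) (c := .inr 2) <;> simp [mem_coNbrs, tent, threeSun]
  · apply key (b := .inr 2) (c := .inr 0) <;> simp [mem_coNbrs, tent, threeSun]
  · apply key (b := .inr 0) (c := .inr 1) <;> simp [mem_coNbrs, tent, threeSun]

theorem umbrella_holeFree : umbrella.HoleFree := by
  -- The elimination order is `6, 0, 4, 1, 3, 2, 5`: the pendant vertex, the path from its ends
  -- inwards, and the vertex joined to the path.
  refine holeFree_of_rank ![1, 3, 5, 4, 2, 6, 0] ?_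
  intro w u v h1 h2 h3 h4 h5
  fin_cases w <;> simp [umbrella] at h1 h2 <;>
    obtain ⟨h1, -⟩ := h1 <;> obtain ⟨h2, -⟩ := h2 <;>
      (try casesm* _ ∨ _) <;> subst_vars <;> first
      | exact absurd rfl h3
      | exact absurd h4 (by decide)
      | exact absurd h5 (by decide)
      | simp [umbrella]

theorem umbrella_isAT : umbrella.IsAT Set.univ 0 4 6 := by
  refine ⟨?_, ?_, ?_, ?_, ?_, ?_⟩
  · simp [mem_coNbrs, umbrella]
  · simp [mem_coNbrs, umbrella]
  · simp [mem_coNbrs, umbrella]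
  · apply ReachIn.of_path (b := 5) <;> simp [mem_coNbrs, umbrella]
  · refine (ReachIn.of_path (b := 3) (c := 2) ?_ ?_ ?_ ?_ ?_).trans (ReachIn.of_adj ?_ ?_ ?_) <;>
      simp [mem_coNbrs, umbrella]
  · refine (ReachIn.of_path (b := 2) (c := 1) ?_ ?_ ?_ ?_ ?_).trans (ReachIn.of_adj ?_ ?_ ?_) <;>
      simp [mem_coNbrs, umbrella]

theorem risingSun_adj_inl_inl {n : ℕ} {i j : Fin n} : (risingSun n).Adj (.inl i) (.inl j) ↔
    i.val ≠ j.val ∧ ((i.val + 1 = j.val ∨ i.val = 0 ∨ i.val + 1 = n) ∨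
      (j.val + 1 = i.val ∨ j.val = 0 ∨ j.val + 1 = n)) := by
  rw [risingSun, SimpleGraph.fromRel_adj, ne_eq, Sum.inl.injEq, Fin.ext_iff]

theorem risingSun_adj_inl_zero {n : ℕ} {i : Fin n} : (risingSun n).Adj (.inl i) (.inr 0) ↔
    i.val = 0 ∨ i.val = 1 := by
  simp [risingSun]

theorem risingSun_adj_inl_one {n : ℕ} {i : Fin n} : (risingSun n).Adj (.inl i) (.inr 1) ↔
    i.val + 2 = n ∨ i.val + 1 = n := by
  simp [risingSun]

theorem risingSun_adj_inl_two {n : ℕ} {i : Fin n} : (risingSun n).Adj (.inl i) (.inr 2) ↔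
    i.val + 1 = n ∨ i.val = 0 := by
  simp [risingSun]

theorem risingSun_not_adj_inr_inr {n : ℕ} {i j : Fin 3} :
    ¬ (risingSun n).Adj (.inr i) (.inr j) := by
  simp [risingSun]

theorem risingSun_holeFree {n : ℕ} (hn : 4 ≤ n) : (risingSun n).HoleFree := by
  -- The outer vertices go first, then the path in its order, then the two vertices joined to the
  -- path, tied at `n`.
  refine holeFree_of_rank
    (Sum.elim (fun i => if i.val = 0 ∨ i.val + 1 = n then n else i.val) (fun _ => 0)) ?_
  have h0 : ∀ w : Fin 3, ∀ i j : Fin n, i ≠ j → (risingSun n).Adj (.inl i) (.inr w) →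
      (risingSun n).Adj (.inl j) (.inr w) → (risingSun n).Adj (.inl i) (.inl j) := by
    intro w i j hij h1 h2
    rw [ne_eq, Fin.ext_iff] at hij
    rw [risingSun_adj_inl_inl]
    fin_cases w
    · have := risingSun_adj_inl_zero.1 h1
      have := risingSun_adj_inl_zero.1 h2
      omega
    · have := risingSun_adj_inl_one.1 h1
      have := risingSun_adj_inl_one.1 h2
      omega
    · have := risingSun_adj_inl_two.1 h1
      have := risingSun_adj_inl_two.1 h2
      omega
  rintro (w | w) (u | u) (v | v) h1 h2 h3 h4 h5
  · rw [risingSun_adj_inl_inl] at *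
    have h3' : u.val ≠ v.val := fun h => h3 (congrArg _ (Fin.ext h))
    simp only [Sum.elim_inl] at h4 h5
    split_ifs at h4 h5 <;> omega
  · simp only [Sum.elim_inl, Sum.elim_inr] at h5
    split_ifs at h5 <;> omega
  · simp only [Sum.elim_inl, Sum.elim_inr] at h4
    split_ifs at h4 <;> omega
  · simp only [Sum.elim_inl, Sum.elim_inr] at h4
    split_ifs at h4 <;> omega
  · exact h0 w u v (fun h => h3 (congrArg _ h)) h1.symm h2.symm
  · exact absurd h2 risingSun_not_adj_inr_inr
  · exact absurd h1 risingSun_not_adj_inr_inr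
  · exact absurd h1 risingSun_not_adj_inr_inr

theorem risingSun_isAT {n : ℕ} (hn : 4 ≤ n) :
    (risingSun n).IsAT Set.univ (.inr 0) (.inr 1) (.inr 2) := by
  have hrr : ∀ i j : Fin 3, i ≠ j →
      (Sum.inr j : Fin n ⊕ Fin 3) ∈ (risingSun n).coNbrs (.inr i) := fun i j hij =>
    ⟨fun h => hij (Sum.inr.inj h).symm, risingSun_not_adj_inr_inr⟩
  have hrl : ∀ (i : Fin 3) (j : Fin n), ¬ (risingSun n).Adj (.inl j) (.inr i) →
      (Sum.inl j : Fin n ⊕ Fin 3) ∈ (risingSun n).coNbrs (.inr i) := fun i j h =>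
    ⟨Sum.inl_ne_inr, fun h' => h h'.symm⟩
  refine ⟨hrr _ _ (by decide), hrr _ _ (by decide), hrr _ _ (by decide), ?_, ?_, ?_⟩ <;>
    rw [Set.inter_univ]
  · have hmid : ∀ k, ∀ hk : k + 1 < n, 1 ≤ k → (risingSun n).ReachIn
        ((risingSun n).coNbrs (.inr 2)) (.inr 0) (.inl ⟨k, by omega⟩) := by
      intro k hk hk1
      induction k, hk1 using Nat.le_induction with
      | base => exact ReachIn.of_adj (hrr _ _ (by decide)) (hrl _ _ (by
          rw [risingSun_adj_inl_two]
          simp only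
          omega)) (risingSun_adj_inl_zero.2 (Or.inr rfl)).symm
      | succ k hk1 ih =>
        exact (ih (by omega)).trans (ReachIn.of_adj (hrl _ _ (by
          rw [risingSun_adj_inl_two]
          simp only
          omega)) (hrl _ _ (by
          rw [risingSun_adj_inl_two]
          simp only
          omega)) (risingSun_adj_inl_inl.2 (by simp)))
    refine (hmid (n - 2) (by omega) (by omega)).trans (ReachIn.of_adj (hrl _ _ (by
      rw [risingSun_adj_inl_two]
      simp only
      omega)) (hrr _ _ (by decide)) (risingSun_adj_inl_one.2 ?_))
    simp only
    omega
  · refine ReachIn.of_path (b := .inl ⟨n - 1, by omega⟩) (risingSun_adj_inl_one.2 ?_).symm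
      (risingSun_adj_inl_two.2 ?_) (hrr _ _ (by decide)) (hrl _ _ ?_) (hrr _ _ (by decide))
    · simp only
      omega
    · simp only
      omega
    · rw [risingSun_adj_inl_zero]
      simp only
      omega
  · refine ReachIn.of_path (b := .inl ⟨0, by omega⟩) (risingSun_adj_inl_two.2 (Or.inr rfl)).symm
      (risingSun_adj_inl_zero.2 (Or.inl rfl)) (hrr _ _ (by decide)) (hrl _ _ ?_)
      (hrr _ _ (by decide))
    rw [risingSun_adj_inl_one]
    simp only
    omega

end Obstructions

end SimpleGraph

/-! ### Passing between models and graphs; interval models -/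

namespace CircularArcModel

variable {M : CircularArcModel}

theorem IsNormal.mono (hM : M.IsNormal) {M' : CircularArcModel} (h : M'.arcs ⊆ M.arcs) :
    M'.IsNormal := fun A hA B hB => hM A (h hA) B (h hB)

theorem NoTripleCover.mono (hM : M.NoTripleCover) {M' : CircularArcModel}
    (h : M'.arcs ⊆ M.arcs) : M'.NoTripleCover := fun A hA B hB C hC =>
  hM A (h hA) B (h hB) C (h hC)

theorem graph_adj_iff {A B : {A : CircArc // A ∈ M.arcs}} :
    M.graph.Adj A B ↔ A.1 ≠ B.1 ∧ (A.1.points ∩ B.1.points).Nonempty := by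
  rw [ne_eq, ← Subtype.ext_iff]
  rfl

/-- Induced submodels of a model are the induced subgraphs of its intersection graph. -/
theorem hasInducedSubmodel_iff {V : Type*} [Finite V] {F : SimpleGraph V} :
    M.HasInducedSubmodel F ↔ F.IsIndContained M.graph := by
  classical
  constructor
  · rintro ⟨M', hsub, ⟨φ⟩⟩
    exact ⟨⟨⟨fun v => ⟨(φ.symm v).1, hsub (φ.symm v).2⟩, fun u v h => φ.symm.injective
      (Subtype.ext (congrArg (fun A : {A : CircArc // A ∈ M.arcs} => A.1) h))⟩, fun {u v} => by
        rw [← φ.symm.map_adj_iff, graph_adj_iff]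
        exact (graph_adj_iff (A := φ.symm u) (B := φ.symm v)).symm⟩⟩
  · rintro ⟨f⟩
    have := Fintype.ofFinite V
    have hsub : Finset.univ.image (fun v => (f v).1) ⊆ M.arcs := by
      intro A hA
      obtain ⟨v, -, rfl⟩ := Finset.mem_image.1 hA
      exact (f v).2
    refine ⟨⟨Finset.univ.image fun v => (f v).1, fun A hA B hB => M.s_ne_s A (hsub hA) B (hsub hB),
      fun A hA B hB => M.t_ne_t A (hsub hA) B (hsub hB),
      fun A hA B hB => M.s_ne_t A (hsub hA) B (hsub hB)⟩, hsub, ⟨Iso.symm ⟨Equiv.ofBijective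
        (fun v => ⟨(f v).1, Finset.mem_image_of_mem _ (Finset.mem_univ v)⟩) ⟨fun u v h =>
          f.injective (Subtype.ext (Subtype.mk.inj h)), ?_⟩, fun {u v} => ?_⟩⟩⟩
    · rintro ⟨A, hA⟩
      obtain ⟨v, -, rfl⟩ := Finset.mem_image.1 hA
      exact ⟨v, rfl⟩
    · rw [← f.map_adj_iff, graph_adj_iff]
      exact (graph_adj_iff (A := f u) (B := f v)).symm

theorem exists_isCoveringTriple (hM : M.IsNormal) (hT : ¬ M.NoTripleCover) :
    ∃ A B C, M.IsCoveringTriple A B C := by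
  simp only [NoTripleCover, not_forall, not_exists, not_and, not_not] at hT
  obtain ⟨A, hA, B, hB, C, hC, h⟩ := hT
  have h' : ∀ q, q ∈ A.points ∨ q ∈ B.points ∨ q ∈ C.points := fun q => by
    have := h q
    tauto
  refine ⟨⟨A, hA⟩, ⟨B, hB⟩, ⟨C, hC⟩, notMem_coNbrs_iff.2 ?_, notMem_coNbrs_iff.2 ?_,
    notMem_coNbrs_iff.2 ?_, h'⟩
  · exact hM.inter_nonempty_of_cover hA hB hC h'
  · exact hM.inter_nonempty_of_cover hA hC hB fun q => by
      have := h' q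
      tauto
  · exact hM.inter_nonempty_of_cover hB hC hA fun q => by
      have := h' q
      tauto

/-- A covering triple is a clique, and since it covers the circle every arc meets one of its
members. -/
theorem IsNormal.hasDominatingCliques (hM : M.IsNormal) (hG : M.graph.HoleFree) :
    M.graph.HasDominatingCliques := by
  intro C x y z h
  obtain ⟨A, hA, L, hL, R, hR, hAL, hAR, hLR, hcov⟩ := exists_triple_cover_of_isAT hM hG h
  refine ⟨{A, L, R}, ?_, ?_, fun v => ?_⟩
  · rintro u (rfl | rfl | rfl) <;> assumption
  · rintro u (rfl | rfl | rfl) v (rfl | rfl | rfl) hne <;> first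
      | exact absurd rfl hne
      | assumption
      | (apply SimpleGraph.Adj.symm; assumption)
  · obtain ⟨q, hq⟩ := v.1.points_nonempty
    rcases hcov q with h | h | h
    · exact ⟨A, by simp, notMem_coNbrs_iff.2 ⟨q, h, hq⟩⟩
    · exact ⟨L, by simp, notMem_coNbrs_iff.2 ⟨q, h, hq⟩⟩
    · exact ⟨R, by simp, notMem_coNbrs_iff.2 ⟨q, h, hq⟩⟩

/-- A submodel is again normal without covering triples, but an asteroidal triple in its hole-free
graph would produce one. -/
theorem IsNormal.not_hasInducedSubmodel (hM : M.IsNormal) (hT : M.NoTripleCover) {V : Type*}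
    {F : SimpleGraph V} (hF : F.HoleFree) {C : Set V} {x y z : V} (hAT : F.IsAT C x y z) :
    ¬ M.HasInducedSubmodel F := by
  rintro ⟨M', hsub, ⟨φ⟩⟩
  obtain ⟨A, -, L, -, R, -, -, -, -, hcov⟩ := exists_triple_cover_of_isAT (hM.mono hsub)
    (hF.of_embedding φ.toEmbedding) (hAT.map φ.symm.toEmbedding)
  obtain ⟨q, h1, h2, h3⟩ := hT _ (hsub A.2) _ (hsub L.2) _ (hsub R.2)
  rcases hcov q with h | h | h
  · exact h1 h
  · exact h2 h
  · exact h3 h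

theorem IsNormal.not_hasInducedSubmodel_wheel (hM : M.IsNormal) (hT : M.NoTripleCover) {n : ℕ}
    (hn : 4 ≤ n) : ¬ M.HasInducedSubmodel (wheel n) := by
  rintro ⟨M', hsub, ⟨φ⟩⟩
  let e : cycleGraph n ↪g wheel n := ⟨⟨some, Option.some_injective _⟩, fun {i j} => by
    constructor
    · intro h
      have := ((SimpleGraph.fromRel_adj _ _ _).1 h).2
      exact this.elim id fun h => h.symm
    · intro h
      exact (SimpleGraph.fromRel_adj _ _ _).2 ⟨fun h' => h.ne (Option.some.inj h'), Or.inl h⟩⟩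
  obtain ⟨c, hc, hce⟩ := isHole_of_embedding hn (e.trans φ.symm.toEmbedding)
  refine (hM.mono hsub).not_universal (hT.mono hsub) hc (h := φ.symm none) fun i => ?_
  obtain ⟨j, hj⟩ := hce i
  rw [hj]
  exact φ.symm.map_adj_iff.2 ((SimpleGraph.fromRel_adj _ _ _).2
    ⟨(Option.some_ne_none j).symm, Or.inl trivial⟩)

/-- A family of intervals of `[0, 1)` as a normal Helly model. -/
theorem exists_model_of_intervals {V : Type*} [Finite V] {G : SimpleGraph V} (s t : V → ℝ)
    (hs : ∀ v, 0 ≤ s v) (hst : ∀ v, s v < t v) (ht : ∀ v, t v < 1) (hss : Function.Injective s)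
    (htt : Function.Injective t) (hne : ∀ u v, s u ≠ t v)
    (hG : ∀ u v, u ≠ v → (G.Adj u v ↔ s u < t v ∧ s v < t u)) :
    ∃ M : CircularArcModel, M.IsNormal ∧ M.IsHelly ∧ M.IsModelOf G := by
  classical
  have := Fintype.ofFinite V
  have hsI : ∀ v, s v ∈ Set.Ico (0 : ℝ) (0 + 1) := fun v =>
    ⟨hs v, by linarith [hst v, ht v]⟩
  have htI : ∀ v, t v ∈ Set.Ico (0 : ℝ) (0 + 1) := fun v =>
    ⟨by linarith [hst v, hs v], by linarith [ht v]⟩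
  let a : V → CircArc := fun v => ⟨s v, t v, fun h =>
    (hst v).ne ((coe_inj_Ico (hsI v) (htI v)).1 h)⟩
  have hmem : ∀ v, ∀ q ∈ Set.Ico (0 : ℝ) (0 + 1),
      ((q : UnitAddCircle) ∈ (a v).points ↔ s v < q ∧ q < t v) := by
    intro v q hq
    change sbtw (s v : UnitAddCircle) (q : UnitAddCircle) (t v : UnitAddCircle) ↔ _
    rw [sbtw_coe_iff (hsI v) hq (htI v)]
    have := hst v
    constructor
    · rintro (h | h | h)
      · exact h
      · linarith [h.1, h.2]
      · linarith [h.1, h.2]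
    · exact Or.inl
  have ha : Function.Injective a := fun u v h =>
    hss ((coe_inj_Ico (hsI u) (hsI v)).1 (congrArg CircArc.s h))
  have hzero : ∀ v, ((0 : ℝ) : UnitAddCircle) ∉ (a v).points := fun v h => by
    rw [hmem v 0 ⟨le_rfl, by norm_num⟩] at h
    linarith [h.1, hs v]
  let M : CircularArcModel := ⟨Finset.univ.image a, by
      simp only [Finset.mem_image, Finset.mem_univ, true_and, forall_exists_index,
        forall_apply_eq_imp_iff]
      intro u v huv h
      exact huv (congrArg a (hss ((coe_inj_Ico (hsI u) (hsI v)).1 h))), by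
      simp only [Finset.mem_image, Finset.mem_univ, true_and, forall_exists_index,
        forall_apply_eq_imp_iff]
      intro u v huv h
      exact huv (congrArg a (htt ((coe_inj_Ico (htI u) (htI v)).1 h))), by
      simp only [Finset.mem_image, Finset.mem_univ, true_and, forall_exists_index,
        forall_apply_eq_imp_iff]
      intro u v h
      exact hne u v ((coe_inj_Ico (hsI u) (htI v)).1 h)⟩
  -- No arc contains the point `0`, which gives normality and excludes covering triples at once.
  have hM0 : ∀ A ∈ M.arcs, ((0 : ℝ) : UnitAddCircle) ∉ A.points := by
    intro A hA
    obtain ⟨v, -, rfl⟩ := Finset.mem_image.1 hA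
    exact hzero v
  have hN : M.IsNormal := fun A hA B hB _ h => by
    have h0 : ((0 : ℝ) : UnitAddCircle) ∈ A.points ∪ B.points := h ▸ Set.mem_univ _
    exact h0.elim (hM0 A hA) (hM0 B hB)
  refine ⟨M, hN, hN.isHelly fun A hA B hB C hC => ⟨_, hM0 A hA, hM0 B hB, hM0 C hC⟩,
    ⟨Iso.symm ⟨Equiv.ofBijective (fun v => ⟨a v, Finset.mem_image_of_mem _ (Finset.mem_univ v)⟩)
      ⟨fun u v h => ha (congrArg Subtype.val h), ?_⟩, fun {u v} => ?_⟩⟩⟩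
  · rintro ⟨A, hA⟩
    obtain ⟨v, -, rfl⟩ := Finset.mem_image.1 hA
    exact ⟨v, rfl⟩
  · by_cases huv : u = v
    · subst huv
      simp
    rw [hG u v huv]
    change (_ ≠ _ ∧ ((a u).points ∩ (a v).points).Nonempty) ↔ _
    constructor
    · rintro ⟨-, q, h1, h2⟩
      obtain ⟨r, hr, rfl⟩ := exists_coe_eq 0 q
      rw [hmem u r hr] at h1
      rw [hmem v r hr] at h2
      exact ⟨by linarith [h1.1, h2.2], by linarith [h1.2, h2.1]⟩
    · rintro ⟨h1, h2⟩
      refine ⟨fun h => huv (ha (congrArg Subtype.val h)), ?_⟩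
      obtain ⟨r, hr1, hr2⟩ : ∃ r, max (s u) (s v) < r ∧ r < min (t u) (t v) :=
        exists_between (max_lt (lt_min (hst u) h1) (lt_min h2 (hst v)))
      rw [max_lt_iff] at hr1
      rw [lt_min_iff] at hr2
      have hr : r ∈ Set.Ico (0 : ℝ) (0 + 1) :=
        ⟨by linarith [hs u, hr1.1], by linarith [ht u, hr2.1]⟩
      exact ⟨r, (hmem u r hr).2 ⟨hr1.1, hr2.1⟩, (hmem v r hr).2 ⟨hr1.2, hr2.2⟩⟩

/-- Finite graphs without holes and asteroidal triples are intersection graphs of intervals. -/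
theorem exists_model_of_aTFree {V : Type*} [Finite V] {G : SimpleGraph V} (hG : G.HoleFree)
    (hAT : G.ATFree) : ∃ M : CircularArcModel, M.IsNormal ∧ M.IsHelly ∧ M.IsModelOf G := by
  classical
  have := Fintype.ofFinite V
  obtain ⟨r, hr⟩ := exists_isLeftOrder hG hAT
  set R := lastRank G Finset.univ r with hR
  set n := Finset.univ.sup r + 1 with hn
  have hrn : ∀ v, r v < n := fun v => Nat.lt_succ_of_le (Finset.le_sup (Finset.mem_univ v))
  have hrR : ∀ v, r v ≤ R v := fun v => le_lastRank (Finset.mem_univ v) (Or.inl rfl)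
  have hRn : ∀ v, R v < n := fun v => by
    obtain ⟨w, -, -, h⟩ := exists_eq_lastRank (G := G) r (Finset.mem_univ v)
    rw [hR, h]
    exact hrn w
  have hinj : ∀ u v, r u = r v → u = v := fun u v h => hr.1 (by simp) (by simp) h
  have hmod : ∀ {a b c d : ℕ}, c < n + 1 → d < n + 1 →
      (n + 1) * a + c = (n + 1) * b + d → c = d := by
    intro a b c d hc hd h
    have := congrArg (· % (n + 1)) h
    simpa [Nat.mul_add_mod, Nat.mod_eq_of_lt hc, Nat.mod_eq_of_lt hd] using this
  -- The interval from `r v` to `R v` is stretched by `n + 1`, and its right end shifted by `r v +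
  -- 1`. Left ends are then `0` modulo `n + 1` and right ends have distinct nonzero residues, so all
  -- extremes differ while the intersections stay the same.
  set S : V → ℕ := fun v => (n + 1) * r v with hS
  set T : V → ℕ := fun v => (n + 1) * R v + (r v + 1) with hT
  have hST : ∀ u v, S u < T v ↔ r u ≤ R v := by
    intro u v
    have := hrn v
    constructor
    · intro h
      by_contra hlt
      have : (n + 1) * (R v + 1) ≤ (n + 1) * r u := Nat.mul_le_mul_left _ (by omega)
      simp only [hS, hT] at h
      rw [mul_add] at this
      omega
    · intro h
      have : (n + 1) * r u ≤ (n + 1) * R v := Nat.mul_le_mul_left _ h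
      simp only [hS, hT]
      omega
  set P : ℕ := (n + 1) * (n + 1) with hP
  have hTP : ∀ v, T v < P := by
    intro v
    have h1 : (n + 1) * (R v + 1) ≤ (n + 1) * n := Nat.mul_le_mul_left _ (hRn v)
    have h2 := hrn v
    simp only [hT, hP]
    rw [mul_add] at h1 ⊢
    omega
  have hP0 : (0 : ℝ) < P := by positivity
  have hlt : ∀ {a b : ℕ}, (a : ℝ) / P < b / P ↔ a < b := by
    intro a b
    rw [div_lt_div_iff_of_pos_right hP0, Nat.cast_lt]
  have heq : ∀ {a b : ℕ}, (a : ℝ) / P = b / P → a = b := by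
    intro a b h
    rw [div_left_inj' hP0.ne'] at h
    exact_mod_cast h
  refine exists_model_of_intervals (fun v => (S v : ℝ) / P) (fun v => (T v : ℝ) / P)
    (fun v => by positivity) (fun v => hlt.2 ((hST v v).2 (hrR v))) (fun v => ?_)
    (fun u v h => ?_) (fun u v h => ?_) (fun u v h => ?_) (fun u v huv => ?_)
  · rw [div_lt_one hP0]
    exact_mod_cast hTP v
  · exact hinj u v (Nat.eq_of_mul_eq_mul_left (by omega) (heq h))
  · have h1 := hrn u
    have h2 := hrn v
    have := hmod (by omega) (by omega) (heq h)
    exact hinj u v (by omega)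
  · have h2 := hrn v
    have := hmod (a := r u) (c := 0) (b := R v) (by omega) (by omega) (heq h)
    omega
  · simp only [hlt, hST]
    rw [hr.adj_iff' (Finset.mem_univ u) (Finset.mem_univ v) huv, and_comm]

end CircularArcModel

/-! ### Assembling the characterisation -/

namespace SimpleGraph

/-- No wheels, 3-suns, rising suns, umbrellas and tents. -/
def IsForbiddenFree {V : Type*} (G : SimpleGraph V) : Prop :=
  (∀ n : ℕ, 4 ≤ n → ¬ (wheel n).IsIndContained G) ∧
    ¬ threeSun.IsIndContained G ∧
    (∀ n : ℕ, 4 ≤ n → ¬ (risingSun n).IsIndContained G) ∧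
    ¬ umbrella.IsIndContained G ∧
    ¬ tent.IsIndContained G

theorem IsForbiddenFree.of_iso {V W : Type*} {G : SimpleGraph V} {H : SimpleGraph W} (φ : G ≃g H)
    (hH : H.IsForbiddenFree) : G.IsForbiddenFree := by
  have hGH : G.IsIndContained H := ⟨φ.toEmbedding⟩
  exact ⟨fun n hn h => hH.1 n hn (h.trans hGH), fun h => hH.2.1 (h.trans hGH),
    fun n hn h => hH.2.2.1 n hn (h.trans hGH), fun h => hH.2.2.2.1 (h.trans hGH),
    fun h => hH.2.2.2.2 (h.trans hGH)⟩

end SimpleGraph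

namespace CircularArcModel

variable {M : CircularArcModel}

theorem IsNormal.isForbiddenFree (hM : M.IsNormal) (hH : M.IsHelly) :
    M.graph.IsForbiddenFree := by
  have hT := hM.noTripleCover hH
  refine ⟨fun n hn => ?_, ?_, fun n hn => ?_, ?_, ?_⟩ <;> rw [← hasInducedSubmodel_iff]
  · exact hM.not_hasInducedSubmodel_wheel hT hn
  · exact hM.not_hasInducedSubmodel hT threeSun_holeFree threeSun_isAT
  · exact hM.not_hasInducedSubmodel hT (risingSun_holeFree hn) (risingSun_isAT hn)
  · exact hM.not_hasInducedSubmodel hT umbrella_holeFree umbrella_isAT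
  · exact hM.not_hasInducedSubmodel hT tent_holeFree tent_isAT

/-- Either the given model is Helly already, or its covering triple excludes holes and then
asteroidal triples, and an interval model replaces it. -/
theorem IsNormal.exists_isHelly (hM : M.IsNormal) (hF : M.graph.IsForbiddenFree) :
    ∃ M' : CircularArcModel, M'.IsNormal ∧ M'.IsHelly ∧ M'.IsModelOf M.graph := by
  by_cases hT : M.NoTripleCover
  · exact ⟨M, hM, hM.isHelly hT, ⟨Iso.refl⟩⟩
  obtain ⟨A, B, C, hABC⟩ := exists_isCoveringTriple hM hT
  have hG : M.graph.HoleFree := by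
    by_contra hG
    obtain ⟨n, hn, h⟩ := exists_wheel_of_isCoveringTriple hABC hG
    exact hF.1 n hn h
  refine exists_model_of_aTFree hG ?_
  by_contra hAT
  rcases (hM.hasDominatingCliques hG).hasSunTentUmbrella hG hAT with h | h | h | ⟨n, hn, h⟩
  · exact hF.2.1 h
  · exact hF.2.2.2.2 h
  · exact hF.2.2.2.1 h
  · exact hF.2.2.1 n hn h

end CircularArcModel

open SimpleGraph in
theorem mainTheorem3 :
    (∀ M : CircularArcModel, M.IsNormal →
      ((∃ M' : CircularArcModel, M'.IsNormal ∧ M'.IsHelly ∧ M.Equivalent M') ↔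
        (∀ n : ℕ, 4 ≤ n → ¬ M.HasInducedSubmodel (wheel n)) ∧
        ¬ M.HasInducedSubmodel threeSun ∧
        (∀ n : ℕ, 4 ≤ n → ¬ M.HasInducedSubmodel (risingSun n)) ∧
        ¬ M.HasInducedSubmodel umbrella ∧
        ¬ M.HasInducedSubmodel tent)) ∧
    (∀ {V : Type*} (G : SimpleGraph V), G.IsNCA →
      (G.IsNHCA ↔
        (∀ n : ℕ, 4 ≤ n → ¬ (wheel n).IsIndContained G) ∧
        ¬ threeSun.IsIndContained G ∧
        (∀ n : ℕ, 4 ≤ n → ¬ (risingSun n).IsIndContained G) ∧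
        ¬ umbrella.IsIndContained G ∧
        ¬ tent.IsIndContained G)) := by
  refine ⟨fun M hM => ?_, fun {V} G hG => ?_⟩
  · simp only [CircularArcModel.hasInducedSubmodel_iff]
    change _ ↔ M.graph.IsForbiddenFree
    constructor
    · rintro ⟨M', hM', hH, ⟨φ⟩⟩
      exact (hM'.isForbiddenFree hH).of_iso φ
    · intro hF
      obtain ⟨M', hM', hH, ⟨φ⟩⟩ := hM.exists_isHelly hF
      exact ⟨M', hM', hH, ⟨φ.symm⟩⟩
  · change _ ↔ G.IsForbiddenFree
    constructor
    · rintro ⟨M, ⟨φ⟩, hM, hH⟩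
      exact (hM.isForbiddenFree hH).of_iso φ.symm
    · intro hF
      obtain ⟨M, ⟨φ⟩, hM⟩ := hG
      obtain ⟨M', hM', hH, ⟨ψ⟩⟩ := hM.exists_isHelly (hF.of_iso φ)
      exact ⟨M', ⟨ψ.trans φ⟩, hM', hH⟩
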